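/- Manifolds are smooth, finite-dimensional, Hausdorff, second countable and without boundary; vector bundles are smooth, real and of finite rank; $\Gamma(\cdot)$ denotes smooth sections; brackets on sections are $\mathbb R$-bilinear; "+ c.p." means plus the two terms obtained by cyclic permutation of the indices $1,2,3$. A *Courant algebroid* is a vector bundle $E\to P$ with a smooth nondegenerate symmetric bilinear form $(\cdot,\cdot)$ on the fibres, a skew-symmetric bracket $[\cdot,\cdot]$ on $\Gamma(E)$ and a bundle map $\rho:E\to TP$ such that, with $\mathcal D:C^\infty(P)\to\Gamma(E)$ defined by $(\mathcal D f,e)=\frac12\rho(e)f$ and $T(e_1,e_2,e_3)=\frac13([e_1,e_2],e_3)+\text{c.p.}$, for all sections and functions: (i) $[[e_1,e_2],e_3]+\text{c.p.}=\mathcal D\,T(e_1,e_2,e_3)$; (ii) $\rho[e_1,e_2]=[\rho e_1,\rho e_2]$; (iii) $[e_1,fe_2]=f[e_1,e_2]+(\rho(e_1)f)e_2-(e_1,e_2)\mathcal D f$; (iv) $\rho\circ\mathcal D=0$; (v) $\rho(e)(h_1,h_2)=([e,h_1]+\mathcal D(e,h_1),h_2)+(h_1,[e,h_2]+\mathcal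 D(e,h_2))$. A *Dirac subbundle* of $E$ is a subbundle $L$ that is maximally isotropic for $(\cdot,\cdot)$ and such that $\Gamma(L)$ is closed under $[\cdot,\cdot]$. A *Lie bialgebroid* is a pair $(A,A^*)$ of dual vector bundles over $P$, each with a Lie algebroid structure (anchors $a$, $a_*$), such that the differential $d_*$ on $\Gamma(\wedge^*A)$ defined by the Lie algebroid $A^*$ is a derivation of the Schouten bracket on $\Gamma(\wedge^*A)$ extending the bracket of $A$: $d_*[w,v]=[d_*w,v]+(-1)^{k-1}[w,d_*v]$ for $w\in\Gamma(\wedge^kA)$. Its *double* is $A\oplus A^*$ with the form $(X_1+\xi_1,X_2+\xi_2)_+=\frac12(\langle\xi_1,X_2\rangle+\langle\xi_2,X_1\rangle)$, the anchor $X+\xi\mapsto a(X)+a_*(\xi)$ and the bracket, for $e_i=X_i+\xi_i$ and $(e_1,e_2)_-=\frac12(\langle\xi_1,X_2\rangle-\langle\xi_2,X_1\rangle)$, $$[e_1,e_2]=\big([X_1,X_2]+L_{\xi_1}X_2-L_{\xi_2}X_1-d_*(e_1,e_2)_-\big)+\big([\xi_1,\xi_2]+L_{X_1}\xi_2-L_{X_2}\xi_1+d(e_1,e_2)_-\big).$$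 Here $d$ and $d_*$ on functions are given by $\langle df,X\rangle=a(X)f$, $\langle\xi,d_*f\rangle=a_*(\xi)f$, and $\langle L_X\xi,Y\rangle=a(X)\langle\xi,Y\rangle-\langle\xi,[X,Y]\rangle$, $\langle\eta,L_\xi X\rangle=a_*(\xi)\langle\eta,X\rangle-\langle[\xi,\eta],X\rangle$. **Theorem.** Let $L_1$ and $L_2$ be Dirac subbundles of a Courant algebroid $(E,\rho,[\cdot,\cdot],(\cdot,\cdot))$ with $E=L_1\oplus L_2$. Then the pairing $\langle\xi,X\rangle=2(\xi,X)$ ($\xi\in L_2$, $X\in L_1$) is perfect and so identifies $L_2$ with $L_1^*$; the restrictions of $\rho$ and $[\cdot,\cdot]$ make $L_1$ and $L_2$ Lie algebroids; with these structures $(L_1,L_2)$ is a Lie bialgebroid; and under $E=L_1\oplus L_2$ the Courant algebroid $E$ is its double, i.e. the form, anchor and bracket of $E$ are those of the double. -/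

import Mathlib

open Bundle Filter Topology
open scoped Manifold ContDiff Bundle

noncomputable section

namespace CourantBialgebroid

/-! ### Smooth sections, functions and derivatives

`P` is a smooth `d`-dimensional manifold and `E` a smooth real vector bundle over it with
finite-dimensional model fibre `F`. -/

section Basic

variable (d : ℕ) {P : Type*} [TopologicalSpace P] [ChartedSpace (EuclideanSpace ℝ (Fin d)) P]
  (F : Type*) [NormedAddCommGroup F] [NormedSpace ℝ F]
  (E : P → Type*) [TopologicalSpace (TotalSpace F E)]
  [∀ x, TopologicalSpace (E x)] [FiberBundle F E]

/-- The space `Γ(E)` of smooth sections. -/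
abbrev Sec : Type _ := ContMDiffSection (𝓡 d) F (∞ : ℕ∞ω) E

variable (P) in
/-- The smooth functions `C^∞(P)`. -/
abbrev SmoothFun : Type _ := C^∞⟮𝓡 d, P; 𝓘(ℝ, ℝ), ℝ⟯

variable {d}

/-- The differential `d₀ f` of a function at `x`, as a linear form on the tangent space: the
derivative `v f` of `f` along `v`. -/
def diff (f : P → ℝ) (x : P) : TangentSpace (𝓡 d) x →ₗ[ℝ] ℝ :=
  ((NormedSpace.fromTangentSpace (𝕜 := ℝ) (f x)).toContinuousLinearMap ∘L
    mfderiv (𝓡 d) 𝓘(ℝ, ℝ) f x).toLinearMap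

variable {F E} [∀ x, AddCommGroup (E x)] [∀ x, Module ℝ (E x)] [VectorBundle ℝ F E]

/-- The product `f e` of a smooth function and a smooth section. -/
def smulSec (f : SmoothFun d P) (e : Sec d F E) : Sec d F E :=
  ⟨fun x => f x • e x, f.contMDiff.smul_section e.contMDiff⟩

variable (F) in
theorem finiteDimensional_fiber [FiniteDimensional ℝ F] (x : P) : FiniteDimensional ℝ (E x) :=
  let phi := (trivializationAt F E x).linearEquivAt ℝ x
    (FiberBundle.mem_baseSet_trivializationAt' x)
  Module.Finite.equiv phi.symm

end Basic

/-! ### Courant algebroids -/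

section Courant

variable (d : ℕ) {P : Type*} [TopologicalSpace P] [ChartedSpace (EuclideanSpace ℝ (Fin d)) P]
  [IsManifold (𝓡 d) ∞ P]
  (F : Type*) [NormedAddCommGroup F] [NormedSpace ℝ F]
  (E : P → Type*) [TopologicalSpace (TotalSpace F E)]
  [∀ x, AddCommGroup (E x)] [∀ x, Module ℝ (E x)]
  [∀ x, TopologicalSpace (E x)] [FiberBundle F E] [VectorBundle ℝ F E]

/-- A smooth bundle map `E → TP` over the identity.  (A fibrewise linear map is smooth exactly
when it sends smooth sections to smooth sections.) -/
structure Anchor where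
  /-- the linear map on each fibre -/
  map : ∀ x : P, E x →ₗ[ℝ] TangentSpace (𝓡 d) x
  smooth : ∀ e : Sec d F E, ContMDiff (𝓡 d) (𝓡 d).tangent ∞
    (fun x => (⟨x, map x (e x)⟩ : TangentBundle (𝓡 d) P))

/-- A vector bundle with a smooth nondegenerate symmetric bilinear form and a smooth bundle map
`ρ` to the tangent bundle. -/
structure PreCourant where
  /-- the bilinear form `( , )` on each fibre -/
  form : ∀ x : P, LinearMap.BilinForm ℝ (E x)
  form_symm : ∀ x v w, form x v w = form x w v
  form_nondegenerate : ∀ x, (form x).Nondegenerate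
  form_smooth : ∀ e e' : Sec d F E,
    ContMDiff (𝓡 d) 𝓘(ℝ, ℝ) ∞ (fun x => form x (e x) (e' x))
  /-- the anchor `ρ` -/
  rho : Anchor d F E

variable {d F E}

/-- The operator `𝒟 = ½ β⁻¹ ρ^* d₀`, where `β : E ≃ E^*` is induced by the bilinear form; in other
words `(𝒟 f, e) = ½ ρ(e) f`. -/
def PreCourant.D [FiniteDimensional ℝ F] (C : PreCourant d F E) (f : P → ℝ) (x : P) : E x :=
  haveI : FiniteDimensional ℝ (E x) := finiteDimensional_fiber F x
  (2⁻¹ : ℝ) • ((C.form x).toDual (C.form_nondegenerate x)).symm (diff f x ∘ₗ C.rho.map x)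

theorem PreCourant.form_D [FiniteDimensional ℝ F] (C : PreCourant d F E) (f : P → ℝ) (x : P)
    (v : E x) : C.form x (C.D f x) v = 2⁻¹ * diff f x (C.rho.map x v) := by
  have : FiniteDimensional ℝ (E x) := finiteDimensional_fiber F x
  simp [PreCourant.D, LinearMap.BilinForm.apply_toDual_symm_apply]

variable (d F E) in
/-- A Courant algebroid.  `D T`, `D f` are evaluated pointwise, and `c.p.` is written out. -/
structure CourantAlgebroid [FiniteDimensional ℝ F] extends PreCourant d F E where
  /-- the bracket on sections -/
  bracket : Sec d F E →ₗ[ℝ] Sec d F E →ₗ[ℝ] Sec d F E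
  bracket_skew : ∀ e₁ e₂, bracket e₁ e₂ = -bracket e₂ e₁
  jacobi_anomaly : ∀ (e₁ e₂ e₃ : Sec d F E) (x : P),
    (bracket (bracket e₁ e₂) e₃ + bracket (bracket e₂ e₃) e₁ + bracket (bracket e₃ e₁) e₂) x =
      toPreCourant.D (fun y => (1 / 3 : ℝ) *
        (form y (bracket e₁ e₂ y) (e₃ y) + form y (bracket e₂ e₃ y) (e₁ y) +
          form y (bracket e₃ e₁ y) (e₂ y))) x
  rho_bracket : ∀ (e₁ e₂ : Sec d F E) (x : P),
    rho.map x (bracket e₁ e₂ x) =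
      VectorField.mlieBracket (𝓡 d) (fun y => rho.map y (e₁ y)) (fun y => rho.map y (e₂ y)) x
  leibniz : ∀ (e₁ e₂ : Sec d F E) (f : SmoothFun d P) (x : P),
    bracket e₁ (smulSec f e₂) x =
      f x • bracket e₁ e₂ x + diff f x (rho.map x (e₁ x)) • e₂ x
        - form x (e₁ x) (e₂ x) • toPreCourant.D f x
  rho_D : ∀ (f : SmoothFun d P) (x : P), rho.map x (toPreCourant.D f x) = 0
  invariance : ∀ (e h₁ h₂ : Sec d F E) (x : P),
    diff (fun y => form y (h₁ y) (h₂ y)) x (rho.map x (e x)) =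
      form x (bracket e h₁ x + toPreCourant.D (fun y => form y (e y) (h₁ y)) x) (h₂ x) +
      form x (h₁ x) (bracket e h₂ x + toPreCourant.D (fun y => form y (e y) (h₂ y)) x)

end Courant

/-! ### Lie algebroids, subbundles and dual pairs -/

section Algebroid

variable (d : ℕ) {P : Type*} [TopologicalSpace P] [ChartedSpace (EuclideanSpace ℝ (Fin d)) P]
  [IsManifold (𝓡 d) ∞ P]
  (F₁ : Type*) [NormedAddCommGroup F₁] [NormedSpace ℝ F₁]
  (A : P → Type*) [TopologicalSpace (TotalSpace F₁ A)]
  [∀ x, AddCommGroup (A x)] [∀ x, Module ℝ (A x)]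
  [∀ x, TopologicalSpace (A x)] [FiberBundle F₁ A] [VectorBundle ℝ F₁ A]
  (F₂ : Type*) [NormedAddCommGroup F₂] [NormedSpace ℝ F₂]
  (B : P → Type*) [TopologicalSpace (TotalSpace F₂ B)]
  [∀ x, AddCommGroup (B x)] [∀ x, Module ℝ (B x)]
  [∀ x, TopologicalSpace (B x)] [FiberBundle F₂ B] [VectorBundle ℝ F₂ B]

/-- A Lie algebroid structure on the vector bundle `A`. -/
structure LieAlgebroid where
  /-- the anchor `a : A → TP` -/
  anchor : Anchor d F₁ A
  /-- the bracket on sections -/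
  bracket : Sec d F₁ A →ₗ[ℝ] Sec d F₁ A →ₗ[ℝ] Sec d F₁ A
  bracket_skew : ∀ X Y, bracket X Y = -bracket Y X
  jacobi : ∀ X Y Z,
    bracket (bracket X Y) Z + bracket (bracket Y Z) X + bracket (bracket Z X) Y = 0
  anchor_bracket : ∀ (X Y : Sec d F₁ A) (x : P),
    anchor.map x (bracket X Y x) =
      VectorField.mlieBracket (𝓡 d) (fun y => anchor.map y (X y)) (fun y => anchor.map y (Y y)) x
  leibniz : ∀ (X Y : Sec d F₁ A) (f : SmoothFun d P) (x : P),
    bracket X (smulSec f Y) x = f x • bracket X Y x + diff f x (anchor.map x (X x)) • Y x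

/-- `A` as a vector subbundle of `B`: a smooth, fibrewise injective bundle map `A → B` over the
identity.  The subbundle itself is the family of ranges. -/
structure Subbundle where
  /-- the inclusion on each fibre -/
  incl : ∀ x : P, A x →ₗ[ℝ] B x
  injective : ∀ x, Function.Injective (incl x)
  smooth : ∀ X : Sec d F₁ A, ContMDiff (𝓡 d) ((𝓡 d).prod 𝓘(ℝ, F₂)) ∞
    (fun x => (⟨x, incl x (X x)⟩ : TotalSpace F₂ B))

/-- A smooth fibrewise perfect pairing `⟨ξ, X⟩` (`ξ ∈ B`, `X ∈ A`), which identifies `B` with the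
dual bundle `A^*`. -/
structure DualPairing where
  /-- the pairing on each fibre -/
  pair : ∀ x : P, B x →ₗ[ℝ] A x →ₗ[ℝ] ℝ
  nondegenerate : ∀ x, (pair x).Nondegenerate
  smooth : ∀ (ξ : Sec d F₂ B) (X : Sec d F₁ A),
    ContMDiff (𝓡 d) 𝓘(ℝ, ℝ) ∞ (fun x => pair x (ξ x) (X x))

variable {d F₁ A F₂ B}

/-- A section of a subbundle, as a section of the ambient bundle. -/
def Subbundle.sec (i : Subbundle d F₁ A F₂ B) (X : Sec d F₁ A) : Sec d F₂ B :=
  ⟨fun x => i.incl x (X x), i.smooth X⟩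

/-- The same pairing, with `A` regarded as the dual of `B`. -/
def DualPairing.flip (p : DualPairing d F₁ A F₂ B) : DualPairing d F₂ B F₁ A where
  pair x := (p.pair x).flip
  nondegenerate x := ⟨(p.nondegenerate x).2, (p.nondegenerate x).1⟩
  smooth X ξ := p.smooth ξ X

/-- `θ = df` for the Lie algebroid `A`: `⟨df, Y⟩ = a(Y) f`. -/
def IsDifferential (LA : LieAlgebroid d F₁ A) (p : DualPairing d F₁ A F₂ B)
    (f : P → ℝ) (θ : Sec d F₂ B) : Prop :=
  ∀ (Y : Sec d F₁ A) (x : P), p.pair x (θ x) (Y x) = diff f x (LA.anchor.map x (Y x))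

/-- `θ = L_X ξ` for the Lie algebroid `A` and `ξ ∈ Γ(A^*)`:
`⟨L_X ξ, Y⟩ = a(X)⟨ξ, Y⟩ - ⟨ξ, [X, Y]⟩`. -/
def IsLieDerivative (LA : LieAlgebroid d F₁ A) (p : DualPairing d F₁ A F₂ B)
    (X : Sec d F₁ A) (ξ θ : Sec d F₂ B) : Prop :=
  ∀ (Y : Sec d F₁ A) (x : P), p.pair x (θ x) (Y x) =
    diff (fun y => p.pair y (ξ y) (Y y)) x (LA.anchor.map x (X x))
      - p.pair x (ξ x) (LA.bracket X Y x)

/-- `U + V` (with `U ∈ Γ(A)`, `V ∈ Γ(A^*)`) is the bracket of `X₁ + ξ₁` and `X₂ + ξ₂` in the double: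
`U = [X₁, X₂] + L_{ξ₁} X₂ - L_{ξ₂} X₁ - d_*(e₁, e₂)₋`,
`V = [ξ₁, ξ₂] + L_{X₁} ξ₂ - L_{X₂} ξ₁ + d(e₁, e₂)₋`,
with `(e₁, e₂)₋ = ½(⟨ξ₁, X₂⟩ - ⟨ξ₂, X₁⟩)`.  All terms on the right are determined by their defining
formulas because the pairing is perfect. -/
def IsDoubleBracket (LA : LieAlgebroid d F₁ A) (LB : LieAlgebroid d F₂ B)
    (p : DualPairing d F₁ A F₂ B) (X₁ : Sec d F₁ A) (ξ₁ : Sec d F₂ B)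
    (X₂ : Sec d F₁ A) (ξ₂ : Sec d F₂ B) (U : Sec d F₁ A) (V : Sec d F₂ B) : Prop :=
  ∃ (Lξ₁X₂ Lξ₂X₁ dstar : Sec d F₁ A) (LX₁ξ₂ LX₂ξ₁ dd : Sec d F₂ B),
    IsLieDerivative LB p.flip ξ₁ X₂ Lξ₁X₂ ∧
    IsLieDerivative LB p.flip ξ₂ X₁ Lξ₂X₁ ∧
    IsDifferential LB p.flip
      (fun y => (1 / 2 : ℝ) * (p.pair y (ξ₁ y) (X₂ y) - p.pair y (ξ₂ y) (X₁ y))) dstar ∧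
    IsLieDerivative LA p X₁ ξ₂ LX₁ξ₂ ∧
    IsLieDerivative LA p X₂ ξ₁ LX₂ξ₁ ∧
    IsDifferential LA p
      (fun y => (1 / 2 : ℝ) * (p.pair y (ξ₁ y) (X₂ y) - p.pair y (ξ₂ y) (X₁ y))) dd ∧
    U = LA.bracket X₁ X₂ + Lξ₁X₂ - Lξ₂X₁ - dstar ∧
    V = LB.bracket ξ₁ ξ₂ + LX₁ξ₂ - LX₂ξ₁ + dd

end Algebroid

/-! ### Multivector fields, the Schouten bracket and Lie bialgebroids -/

section Multivector

variable (d : ℕ) {P : Type*} [TopologicalSpace P] [ChartedSpace (EuclideanSpace ℝ (Fin d)) P]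
  [IsManifold (𝓡 d) ∞ P]
  (F₁ : Type*) [NormedAddCommGroup F₁] [NormedSpace ℝ F₁]
  (A : P → Type*) [TopologicalSpace (TotalSpace F₁ A)]
  [∀ x, AddCommGroup (A x)] [∀ x, Module ℝ (A x)]
  [∀ x, TopologicalSpace (A x)] [FiberBundle F₁ A] [VectorBundle ℝ F₁ A]
  {F₂ : Type*} [NormedAddCommGroup F₂] [NormedSpace ℝ F₂]
  {B : P → Type*} [TopologicalSpace (TotalSpace F₂ B)]
  [∀ x, AddCommGroup (B x)] [∀ x, Module ℝ (B x)]
  [∀ x, TopologicalSpace (B x)] [FiberBundle F₂ B] [VectorBundle ℝ F₂ B]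

/-- Smooth functions and smooth sections of `A`, as sections of the bundle of exterior algebras. -/
def multivectorGenerators : Set (∀ x : P, ExteriorAlgebra ℝ (A x)) :=
  {w | ∃ f : SmoothFun d P, w = fun x => algebraMap ℝ (ExteriorAlgebra ℝ (A x)) (f x)} ∪
  {w | ∃ X : Sec d F₁ A, w = fun x => ExteriorAlgebra.ι ℝ (X x)}

/-- The algebra `Γ(∧^* A)` of smooth sections of the exterior algebra bundle of `A`: those sections
`x ↦ w x ∈ ∧^*(A x)` that are, near every point, a finite sum of wedge products of smooth functions
and smooth sections of `A`. -/
def Multivector : Subalgebra ℝ (∀ x : P, ExteriorAlgebra ℝ (A x)) where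
  carrier := {w | ∀ x₀ : P, ∃ v ∈ Algebra.adjoin ℝ (multivectorGenerators d F₁ A),
    ∀ᶠ x in 𝓝 x₀, w x = v x}
  mul_mem' := by
    intro w w' hw hw' x₀
    obtain ⟨v, hv, h⟩ := hw x₀
    obtain ⟨v', hv', h'⟩ := hw' x₀
    refine ⟨v * v', mul_mem hv hv', ?_⟩
    filter_upwards [h, h'] with x hx hx'
    simp [hx, hx']
  add_mem' := by
    intro w w' hw hw' x₀
    obtain ⟨v, hv, h⟩ := hw x₀
    obtain ⟨v', hv', h'⟩ := hw' x₀
    refine ⟨v + v', add_mem hv hv', ?_⟩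
    filter_upwards [h, h'] with x hx hx'
    simp [hx, hx']
  algebraMap_mem' r x₀ := ⟨_, Subalgebra.algebraMap_mem _ r, Eventually.of_forall fun _ => rfl⟩

variable {d F₁ A}

theorem mem_multivector_of_generator {w : ∀ x : P, ExteriorAlgebra ℝ (A x)}
    (hw : w ∈ multivectorGenerators d F₁ A) : w ∈ Multivector d F₁ A :=
  fun _ => ⟨w, Algebra.subset_adjoin hw, Eventually.of_forall fun _ => rfl⟩

variable (F₁ A) in
/-- A smooth function as a multivector field of degree `0`. -/
def ofFun (f : SmoothFun d P) : Multivector d F₁ A :=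
  ⟨fun x => algebraMap ℝ (ExteriorAlgebra ℝ (A x)) (f x),
    mem_multivector_of_generator (Or.inl ⟨f, rfl⟩)⟩

/-- A section of `A` as a multivector field of degree `1`. -/
def ofSec (X : Sec d F₁ A) : Multivector d F₁ A :=
  ⟨fun x => ExteriorAlgebra.ι ℝ (X x), mem_multivector_of_generator (Or.inr ⟨X, rfl⟩)⟩

/-- `w ∈ Γ(∧^k A)`. -/
def IsHomogeneous (k : ℕ) (w : Multivector d F₁ A) : Prop :=
  ∀ x, w.1 x ∈ ⋀[ℝ]^k (A x)

/-- The contraction `i_φ : ∧^* V → ∧^{*-1} V` with `φ ∈ V^*`: the antiderivation with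
`i_φ v = φ(v)`. -/
def contract {V : Type*} [AddCommGroup V] [Module ℝ V] (φ : V →ₗ[ℝ] ℝ) :
    ExteriorAlgebra ℝ V →ₗ[ℝ] ExteriorAlgebra ℝ V :=
  CliffordAlgebra.contractLeft (Q := (0 : QuadraticForm ℝ V)) φ

/-- `δ` is the differential `d_*` on `Γ(∧^* A)` induced by a Lie algebroid structure on `B = A^*`
with anchor `a_*`: the antiderivation of degree `1` of the wedge product with
`⟨ξ, d_* f⟩ = a_*(ξ) f` and
`(d_* X)(ξ, η) = a_*(ξ)⟨η, X⟩ - a_*(η)⟨ξ, X⟩ - ⟨[ξ, η], X⟩`. -/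
structure IsAlgebroidDifferential (LB : LieAlgebroid d F₂ B) (p : DualPairing d F₁ A F₂ B)
    (δ : Multivector d F₁ A →ₗ[ℝ] Multivector d F₁ A) : Prop where
  degree : ∀ k w, IsHomogeneous k w → IsHomogeneous (k + 1) (δ w)
  on_functions : ∀ (f : SmoothFun d P) (ξ : Sec d F₂ B) (x : P),
    contract (p.pair x (ξ x)) ((δ (ofFun F₁ A f)).1 x) =
      algebraMap ℝ _ (diff f x (LB.anchor.map x (ξ x)))
  on_sections : ∀ (X : Sec d F₁ A) (ξ η : Sec d F₂ B) (x : P),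
    contract (p.pair x (η x)) (contract (p.pair x (ξ x)) ((δ (ofSec X)).1 x)) =
      algebraMap ℝ _
        (diff (fun y => p.pair y (η y) (X y)) x (LB.anchor.map x (ξ x))
          - diff (fun y => p.pair y (ξ y) (X y)) x (LB.anchor.map x (η x))
          - p.pair x (LB.bracket ξ η x) (X x))
  wedge : ∀ (k : ℕ) (w v : Multivector d F₁ A), IsHomogeneous k w →
    δ (w * v) = δ w * v + (-1 : ℝ) ^ k • (w * δ v)

/-- `S` is the Schouten bracket on `Γ(∧^* A)` of the Lie algebroid `A`: the extension of the bracket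
on `Γ(A)` and of `[X, f] = a(X) f` to a bracket of degree `-1` which is graded skew-symmetric,
`[w, v] = -(-1)^{(k-1)(l-1)} [v, w]`, and a graded derivation of the wedge product,
`[w, v ∧ u] = [w, v] ∧ u + (-1)^{(k-1)l} v ∧ [w, u]`, for `w`, `v` of degrees `k`, `l`.
These properties determine it. -/
structure IsSchoutenBracket (LA : LieAlgebroid d F₁ A)
    (S : Multivector d F₁ A →ₗ[ℝ] Multivector d F₁ A →ₗ[ℝ] Multivector d F₁ A) : Prop where
  degree : ∀ k l m w v, k + l = m + 1 → IsHomogeneous k w → IsHomogeneous l v →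
    IsHomogeneous m (S w v)
  degree_zero : ∀ w v, IsHomogeneous 0 w → IsHomogeneous 0 v → S w v = 0
  on_sections : ∀ X Y : Sec d F₁ A, S (ofSec X) (ofSec Y) = ofSec (LA.bracket X Y)
  on_functions : ∀ (X : Sec d F₁ A) (f : SmoothFun d P) (x : P),
    (S (ofSec X) (ofFun F₁ A f)).1 x = algebraMap ℝ _ (diff f x (LA.anchor.map x (X x)))
  skew : ∀ k l w v, IsHomogeneous k w → IsHomogeneous l v →
    S w v = -((-1 : ℝ) ^ ((k + 1) * (l + 1)) • S v w)
  wedge : ∀ k l w v u, IsHomogeneous k w → IsHomogeneous l v →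
    S w (v * u) = S w v * u + (-1 : ℝ) ^ ((k + 1) * l) • (v * S w u)

/-- `(A, B)`, with `B` identified with `A^*` by the pairing, is a Lie bialgebroid: the differential
`d_*` of `B = A^*` is a derivation of the Schouten bracket of `A` on `Γ(∧^* A)`, that is,
`d_*[w, v] = [d_* w, v] + (-1)^{k-1} [w, d_* v]` for `w` of degree `k`. -/
def IsLieBialgebroid (LA : LieAlgebroid d F₁ A) (LB : LieAlgebroid d F₂ B)
    (p : DualPairing d F₁ A F₂ B) : Prop :=
  ∃ (δ : Multivector d F₁ A →ₗ[ℝ] Multivector d F₁ A)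
    (S : Multivector d F₁ A →ₗ[ℝ] Multivector d F₁ A →ₗ[ℝ] Multivector d F₁ A),
    IsAlgebroidDifferential LB p δ ∧ IsSchoutenBracket LA S ∧
    ∀ (k : ℕ) (w v : Multivector d F₁ A), IsHomogeneous k w →
      δ (S w v) = S (δ w) v + (-1 : ℝ) ^ (k + 1) • S w (δ v)

end Multivector

/-! ### Dirac subbundles and the double -/

section Dirac

variable {d : ℕ} {P : Type*} [TopologicalSpace P] [ChartedSpace (EuclideanSpace ℝ (Fin d)) P]
  [IsManifold (𝓡 d) ∞ P]
  {F : Type*} [NormedAddCommGroup F] [NormedSpace ℝ F] [FiniteDimensional ℝ F]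
  {E : P → Type*} [TopologicalSpace (TotalSpace F E)]
  [∀ x, AddCommGroup (E x)] [∀ x, Module ℝ (E x)]
  [∀ x, TopologicalSpace (E x)] [FiberBundle F E] [VectorBundle ℝ F E]
  {F₁ : Type*} [NormedAddCommGroup F₁] [NormedSpace ℝ F₁]
  {L₁ : P → Type*} [TopologicalSpace (TotalSpace F₁ L₁)]
  [∀ x, AddCommGroup (L₁ x)] [∀ x, Module ℝ (L₁ x)]
  [∀ x, TopologicalSpace (L₁ x)] [FiberBundle F₁ L₁] [VectorBundle ℝ F₁ L₁]
  {F₂ : Type*} [NormedAddCommGroup F₂] [NormedSpace ℝ F₂]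
  {L₂ : P → Type*} [TopologicalSpace (TotalSpace F₂ L₂)]
  [∀ x, AddCommGroup (L₂ x)] [∀ x, Module ℝ (L₂ x)]
  [∀ x, TopologicalSpace (L₂ x)] [FiberBundle F₂ L₂] [VectorBundle ℝ F₂ L₂]

/-- A Dirac subbundle: maximally isotropic, and integrable, i.e. its sections are closed under
the bracket. -/
structure IsDirac (C : CourantAlgebroid d F E) (i : Subbundle d F₁ L₁ F E) : Prop where
  maximal_isotropic : ∀ x, Maximal
    (fun W : Submodule ℝ (E x) => ∀ v ∈ W, ∀ w ∈ W, C.form x v w = 0)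
    (LinearMap.range (i.incl x))
  integrable : ∀ X Y : Sec d F₁ L₁, ∃ Z : Sec d F₁ L₁,
    i.sec Z = C.bracket (i.sec X) (i.sec Y)

/-- The Lie algebroid structure on a subbundle of a Courant algebroid is the one obtained by
restricting the anchor and the bracket. -/
def IsRestriction (C : CourantAlgebroid d F E) (i : Subbundle d F₁ L₁ F E)
    (L : LieAlgebroid d F₁ L₁) : Prop :=
  (∀ x v, L.anchor.map x v = C.rho.map x (i.incl x v)) ∧
  ∀ X Y, i.sec (L.bracket X Y) = C.bracket (i.sec X) (i.sec Y)

/-- Under the map `X + ξ ↦ i₁ X + i₂ ξ` the Courant algebroid `C` is the double of `(L₁, L₂)`: this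
map is an isomorphism `L₁ ⊕ L₂ ≃ E` and the form, the anchor and the bracket are
`(X₁ + ξ₁, X₂ + ξ₂)₊ = ½(⟨ξ₁, X₂⟩ + ⟨ξ₂, X₁⟩)`, `ρ(X + ξ) = a(X) + a_*(ξ)` and the
bracket of the double. -/
structure IsDouble (C : CourantAlgebroid d F E) (i₁ : Subbundle d F₁ L₁ F E)
    (i₂ : Subbundle d F₂ L₂ F E) (A₁ : LieAlgebroid d F₁ L₁) (A₂ : LieAlgebroid d F₂ L₂)
    (p : DualPairing d F₁ L₁ F₂ L₂) : Prop where
  bijective : ∀ x, Function.Bijective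
    (fun v : L₁ x × L₂ x => i₁.incl x v.1 + i₂.incl x v.2)
  form_eq : ∀ x (X₁ X₂ : L₁ x) (ξ₁ ξ₂ : L₂ x),
    C.form x (i₁.incl x X₁ + i₂.incl x ξ₁) (i₁.incl x X₂ + i₂.incl x ξ₂) =
      (1 / 2 : ℝ) * (p.pair x ξ₁ X₂ + p.pair x ξ₂ X₁)
  rho_eq : ∀ x (X : L₁ x) (ξ : L₂ x),
    C.rho.map x (i₁.incl x X + i₂.incl x ξ) = A₁.anchor.map x X + A₂.anchor.map x ξ
  bracket_eq : ∀ (X₁ X₂ : Sec d F₁ L₁) (ξ₁ ξ₂ : Sec d F₂ L₂),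
    ∃ (U : Sec d F₁ L₁) (V : Sec d F₂ L₂),
      IsDoubleBracket A₁ A₂ p X₁ ξ₁ X₂ ξ₂ U V ∧
      C.bracket (i₁.sec X₁ + i₂.sec ξ₁) (i₁.sec X₂ + i₂.sec ξ₂) = i₁.sec U + i₂.sec V

end Dirac

end CourantBialgebroid

end

/-!
# Transversal Dirac subbundles form a Lie bialgebroid

The Courant bracket is replaced by the Dorfman product `X ∘ Y = [X, Y] + 𝒟 (X, Y)`. It is a
derivation of the form, its anchor is a morphism, it satisfies the Leibniz form of the Jacobi
identity, `X ∘ 𝒟 f = 𝒟 (ρ(X) f)` and `𝒟 f ∘ X = 0`. On an isotropic subbundle it agrees with the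
bracket, so a Dirac subbundle is a Lie algebroid: the Jacobi anomaly `𝒟 T` vanishes there because
`T` does. For `X` in `L₁` and `ξ` in `L₂`, the `L₂`-part of `X ∘ ξ` is the Lie derivative
`L_X ξ` and its `L₁`-part is the contraction of `-d_* X` by `ξ`; since
`X ∘ ξ + ξ ∘ X = 2 𝒟 (X, ξ)`, this already identifies `E` with the double (`DiracPair.isDouble`).

For the compatibility of `d_*` with the Schouten bracket, both operators are first constructed by
formulas in a dual frame near each point, out of the connection that is flat in the frame. The
failure of `d_*` to be a derivation of the bracket (`defect`) is a graded skew biderivation of the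
algebra of multivector fields. That algebra is locally generated by functions and sections, so the
defect vanishes as soon as it does on pairs of generators
(`isLieBialgebroid_of_generators`). For two functions it vanishes because `ρ ∘ 𝒟 = 0`, and for a
section `X` and a function `f` because `X ∘ 𝒟 f = 𝒟 (ρ(X) f)`. For two sections `X`, `Y` it is a
bivector, which is evaluated on `ξ`, `η` in `Γ(L₂)`; since `(d_* X)(ξ, η) = -2 (X ∘ ξ, η)`
(`DiracPair.dform_eq`), what is left is the Jacobi identity of the Dorfman product applied to `X`,
`Y`, `ξ` (`DiracPair.dform_bracket`).
-/

noncomputable section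

set_option linter.unusedSectionVars false

namespace CourantBialgebroid

/-! ### Contractions and parity in the exterior algebra -/

section Exterior

variable {V : Type*} [AddCommGroup V] [Module ℝ V]

/-- The grade involution of the exterior algebra: `w ↦ (-1)^k w` on `∧^k V`. -/
def invol : ExteriorAlgebra ℝ V →ₐ[ℝ] ExteriorAlgebra ℝ V :=
  CliffordAlgebra.involute

/-- `w` is a sum of terms whose degrees are congruent to `n` modulo `2`.  The signs in the Schouten
calculus depend on parities only, and `0` has every parity, so no truncated subtraction of degrees
is needed. -/
def HasParity (n : ℕ) (w : ExteriorAlgebra ℝ V) : Prop :=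
  invol w = (-1 : ℝ) ^ n • w

@[simp] theorem invol_ι (v : V) : invol (ExteriorAlgebra.ι ℝ v) = -ExteriorAlgebra.ι ℝ v :=
  CliffordAlgebra.involute_ι _

@[simp] theorem contract_ι (φ : V →ₗ[ℝ] ℝ) (v : V) :
    contract φ (ExteriorAlgebra.ι ℝ v) = algebraMap ℝ _ (φ v) :=
  CliffordAlgebra.contractLeft_ι (Q := 0) _ _

@[simp] theorem contract_algebraMap (φ : V →ₗ[ℝ] ℝ) (r : ℝ) :
    contract φ (algebraMap ℝ (ExteriorAlgebra ℝ V) r) = 0 :=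
  CliffordAlgebra.contractLeft_algebraMap 0 _ _

theorem contract_ι_mul (φ : V →ₗ[ℝ] ℝ) (v : V) (x : ExteriorAlgebra ℝ V) :
    contract φ (ExteriorAlgebra.ι ℝ v * x) = φ v • x - ExteriorAlgebra.ι ℝ v * contract φ x :=
  CliffordAlgebra.contractLeft_ι_mul (Q := 0) _ _ _

theorem exterior_left_induction {p : ExteriorAlgebra ℝ V → Prop}
    (scalar : ∀ r, p (algebraMap ℝ _ r)) (add : ∀ x y, p x → p y → p (x + y))
    (ι_mul : ∀ x v, p x → p (ExteriorAlgebra.ι ℝ v * x)) (x : ExteriorAlgebra ℝ V) : p x :=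
  CliffordAlgebra.left_induction (Q := (0 : QuadraticForm ℝ V)) (P := p) scalar add
    ι_mul x

theorem contract_mul (φ : V →ₗ[ℝ] ℝ) (x y : ExteriorAlgebra ℝ V) :
    contract φ (x * y) = contract φ x * y + invol x * contract φ y := by
  induction x using exterior_left_induction with
  | scalar r =>
    simp [← Algebra.smul_def]
  | add a b ha hb => simp only [add_mul, map_add, ha, hb]; abel
  | ι_mul a v ha =>
    rw [mul_assoc, contract_ι_mul, contract_ι_mul, ha, map_mul, invol_ι]
    simp only [sub_mul, mul_add, smul_mul_assoc, neg_mul, mul_assoc]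
    abel

theorem invol_contract (φ : V →ₗ[ℝ] ℝ) (x : ExteriorAlgebra ℝ V) :
    invol (contract φ x) = -contract φ (invol x) := by
  induction x using exterior_left_induction with
  | scalar r => simp
  | add a b ha hb => simp only [map_add, ha, hb]; abel
  | ι_mul a v ha =>
    rw [contract_ι_mul, map_mul, invol_ι, map_sub, map_mul, ha, map_smul, neg_mul, map_neg,
      contract_ι_mul, invol_ι]
    simp

theorem invol_invol (x : ExteriorAlgebra ℝ V) : invol (invol x) = x :=
  CliffordAlgebra.involute_involute x

theorem hasParity_algebraMap (r : ℝ) : HasParity 0 (algebraMap ℝ (ExteriorAlgebra ℝ V) r) := by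
  simp [HasParity]

theorem hasParity_one : HasParity 0 (1 : ExteriorAlgebra ℝ V) := by
  simp [HasParity]

theorem hasParity_zero (n : ℕ) : HasParity n (0 : ExteriorAlgebra ℝ V) := by
  simp [HasParity]

theorem hasParity_ι (v : V) : HasParity 1 (ExteriorAlgebra.ι ℝ v) := by
  simp [HasParity]

theorem HasParity.mul {m n : ℕ} {x y : ExteriorAlgebra ℝ V} (hx : HasParity m x)
    (hy : HasParity n y) : HasParity (m + n) (x * y) := by
  unfold HasParity at *
  rw [map_mul, hx, hy, smul_mul_smul_comm, pow_add]

theorem HasParity.add {n : ℕ} {x y : ExteriorAlgebra ℝ V} (hx : HasParity n x)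
    (hy : HasParity n y) : HasParity n (x + y) := by
  unfold HasParity at *
  rw [map_add, hx, hy, smul_add]

theorem HasParity.smul {n : ℕ} {x : ExteriorAlgebra ℝ V} (c : ℝ) (hx : HasParity n x) :
    HasParity n (c • x) := by
  unfold HasParity at *
  rw [map_smul, hx, smul_comm]

theorem HasParity.sub {n : ℕ} {x y : ExteriorAlgebra ℝ V} (hx : HasParity n x)
    (hy : HasParity n y) : HasParity n (x - y) := by
  unfold HasParity at *
  rw [map_sub, hx, hy, smul_sub]

theorem HasParity.sum {n : ℕ} {J : Type*} {s : Finset J} {x : J → ExteriorAlgebra ℝ V}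
    (h : ∀ j ∈ s, HasParity n (x j)) : HasParity n (∑ j ∈ s, x j) := by
  unfold HasParity at *
  rw [map_sum, Finset.smul_sum]
  exact Finset.sum_congr rfl h

theorem HasParity.contract {n : ℕ} {x : ExteriorAlgebra ℝ V} (φ : V →ₗ[ℝ] ℝ)
    (hx : HasParity n x) : HasParity (n + 1) (contract φ x) := by
  unfold HasParity at *
  rw [invol_contract, hx, map_smul, pow_succ]
  simp

theorem HasParity.invol {n : ℕ} {x : ExteriorAlgebra ℝ V} (hx : HasParity n x) :
    HasParity n (invol x) := by
  unfold HasParity at *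
  rw [hx, map_smul, hx]

theorem HasParity.congr {m n : ℕ} {x : ExteriorAlgebra ℝ V} (hx : HasParity m x)
    (h : m % 2 = n % 2) : HasParity n x := by
  unfold HasParity at *
  rw [hx, neg_one_pow_eq_pow_mod_two, h, ← neg_one_pow_eq_pow_mod_two]

theorem hasParity_of_mem {n : ℕ} {x : ExteriorAlgebra ℝ V} (hx : x ∈ ⋀[ℝ]^n V) :
    HasParity n x := by
  rw [← ExteriorAlgebra.ιMulti_span_fixedDegree] at hx
  induction hx using Submodule.span_induction with
  | mem x h =>
    obtain ⟨v, rfl⟩ := h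
    induction n with
    | zero => simpa using hasParity_one
    | succ n ih =>
      rw [ExteriorAlgebra.ιMulti_succ_apply]
      exact ((hasParity_ι _).mul (ih _)).congr (by omega)
  | zero => exact hasParity_zero _
  | add x y _ _ hx hy => exact hx.add hy
  | smul c x _ hx => exact hx.smul c

theorem ι_mul_eq (v : V) (y : ExteriorAlgebra ℝ V) :
    ExteriorAlgebra.ι ℝ v * y = invol y * ExteriorAlgebra.ι ℝ v := by
  induction y using exterior_left_induction with
  | scalar r => simp [Algebra.commutes]
  | add a b ha hb => simp only [map_add, add_mul, mul_add, ha, hb]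
  | ι_mul a u ha =>
    have h := ExteriorAlgebra.ι_add_mul_swap (R := ℝ) v u
    rw [map_mul, invol_ι, neg_mul, neg_mul, mul_assoc, ← ha, ← mul_assoc, ← mul_assoc,
      eq_neg_of_add_eq_zero_left h, neg_mul]

/-- The even and the odd part of `x` commute and graded commute, respectively, with everything. -/
theorem even_odd_part_mul (x y : ExteriorAlgebra ℝ V) :
    (x + invol x) * y = y * (x + invol x) ∧ (x - invol x) * y = invol y * (x - invol x) := by
  induction x using exterior_left_induction generalizing y with
  | scalar r =>
    simp only [AlgHom.commutes, ← map_add, sub_self, zero_mul, mul_zero, and_true]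
    exact Algebra.commutes _ _
  | add a b ha hb =>
    have h1 : a + b + (invol a + invol b) = (a + invol a) + (b + invol b) := by abel
    have h2 : a + b - (invol a + invol b) = (a - invol a) + (b - invol b) := by abel
    rw [map_add, h1, h2]
    generalize a + invol a = a₁ at *
    generalize a - invol a = a₂ at *
    generalize b + invol b = b₁ at *
    generalize b - invol b = b₂ at *
    rw [add_mul, mul_add, add_mul, mul_add, (ha y).1, (ha y).2, (hb y).1, (hb y).2]
    exact ⟨rfl, rfl⟩
  | ι_mul a u ha =>
    have e1 : ExteriorAlgebra.ι ℝ u * a + invol (ExteriorAlgebra.ι ℝ u * a) =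
      ExteriorAlgebra.ι ℝ u * (a - invol a) := by
      rw [map_mul, invol_ι, mul_sub]; simp [sub_eq_add_neg]
    have e2 : ExteriorAlgebra.ι ℝ u * a - invol (ExteriorAlgebra.ι ℝ u * a) =
      ExteriorAlgebra.ι ℝ u * (a + invol a) := by
      rw [map_mul, invol_ι, mul_add]; simp
    rw [e1, e2]
    constructor
    · rw [mul_assoc, (ha y).2, ← mul_assoc, ι_mul_eq, invol_invol, mul_assoc]
    · rw [mul_assoc, (ha y).1, ← mul_assoc, ι_mul_eq, mul_assoc]

theorem HasParity.mul_comm {m n : ℕ} {x y : ExteriorAlgebra ℝ V} (hx : HasParity m x)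
    (hy : HasParity n y) : x * y = (-1 : ℝ) ^ (m * n) • (y * x) := by
  have h := even_odd_part_mul x y
  unfold HasParity at hx hy
  have h2 : (2 : ℝ) ≠ 0 := two_ne_zero
  rcases Nat.even_or_odd m with hm | hm
  · rw [hx, hm.neg_one_pow, one_smul, ← two_smul ℝ, smul_mul_assoc, mul_smul_comm] at h
    rw [(hm.mul_right n).neg_one_pow, one_smul]
    exact smul_right_injective _ h2 h.1
  · rw [hx, hm.neg_one_pow, neg_one_smul, sub_neg_eq_add, ← two_smul ℝ, smul_mul_assoc,
      mul_smul_comm] at h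
    rw [smul_right_injective _ h2 h.2, hy, smul_mul_assoc, pow_mul, hm.neg_one_pow]

theorem contract_mem {k : ℕ} {x : ExteriorAlgebra ℝ V} (φ : V →ₗ[ℝ] ℝ)
    (hx : x ∈ ⋀[ℝ]^(k + 1) V) : contract φ x ∈ ⋀[ℝ]^k V := by
  rw [← ExteriorAlgebra.ιMulti_span_fixedDegree] at hx
  induction hx using Submodule.span_induction with
  | mem x h =>
    obtain ⟨v, rfl⟩ := h
    induction k with
    | zero =>
      rw [ExteriorAlgebra.ιMulti_succ_apply, ExteriorAlgebra.ιMulti_zero_apply, mul_one,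
        contract_ι]
      simp [ExteriorAlgebra.exteriorPower, Submodule.mem_one]
    | succ k ih =>
      rw [ExteriorAlgebra.ιMulti_succ_apply, contract_ι_mul]
      refine sub_mem (Submodule.smul_mem _ _ ?_) ?_
      · exact (exteriorPower.ιMulti ℝ (k + 1) _).2
      · rw [ExteriorAlgebra.exteriorPower, pow_succ']
        exact Submodule.mul_mem_mul ⟨_, rfl⟩ (ih _)
  | zero => simp
  | add x y _ _ hx hy => rw [map_add]; exact add_mem hx hy
  | smul c x _ hx => rw [map_smul]; exact Submodule.smul_mem _ _ hx

theorem exists_of_mem_zero {x : ExteriorAlgebra ℝ V} (hx : x ∈ ⋀[ℝ]^0 V) :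
    ∃ r : ℝ, x = algebraMap ℝ _ r := by
  rw [ExteriorAlgebra.exteriorPower, pow_zero, Submodule.mem_one] at hx
  obtain ⟨r, rfl⟩ := hx
  exact ⟨r, rfl⟩

theorem contract_eq_zero_of_mem {x : ExteriorAlgebra ℝ V} (φ : V →ₗ[ℝ] ℝ)
    (hx : x ∈ ⋀[ℝ]^0 V) : contract φ x = 0 := by
  obtain ⟨r, rfl⟩ := exists_of_mem_zero hx
  simp

theorem ι_mem_one (v : V) : ExteriorAlgebra.ι ℝ v ∈ ⋀[ℝ]^1 V := by
  rw [ExteriorAlgebra.exteriorPower, pow_one]; exact ⟨v, rfl⟩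

theorem algebraMap_mem_zero (r : ℝ) : algebraMap ℝ (ExteriorAlgebra ℝ V) r ∈ ⋀[ℝ]^0 V := by
  rw [ExteriorAlgebra.exteriorPower, pow_zero, Submodule.mem_one]; exact ⟨r, rfl⟩

theorem mul_mem_exteriorPower {k l : ℕ} {x y : ExteriorAlgebra ℝ V} (hx : x ∈ ⋀[ℝ]^k V)
    (hy : y ∈ ⋀[ℝ]^l V) : x * y ∈ ⋀[ℝ]^(k + l) V := by
  rw [ExteriorAlgebra.exteriorPower, pow_add]
  exact Submodule.mul_mem_mul hx hy

theorem invol_mem {k : ℕ} {x : ExteriorAlgebra ℝ V} (hx : x ∈ ⋀[ℝ]^k V) :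
    invol x ∈ ⋀[ℝ]^k V := by
  have h := hasParity_of_mem hx
  unfold HasParity at h
  rw [h]
  exact Submodule.smul_mem _ _ hx

/-- Euler's identity: `∑ eⱼ ∧ i_{fⱼ}` is multiplication by the degree, for dual bases `e`, `f`. -/
theorem sum_ι_mul_contract {J : Type*} [Fintype J] (e : J → V) (f : J → V →ₗ[ℝ] ℝ)
    (hef : ∀ v, ∑ j, f j v • e j = v) {k : ℕ} {x : ExteriorAlgebra ℝ V} (hx : x ∈ ⋀[ℝ]^k V) :
    ∑ j, ExteriorAlgebra.ι ℝ (e j) * contract (f j) x = (k : ℝ) • x := by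
  rw [← ExteriorAlgebra.ιMulti_span_fixedDegree] at hx
  induction hx using Submodule.span_induction with
  | mem x h =>
    obtain ⟨v, rfl⟩ := h
    induction k with
    | zero =>
      rw [ExteriorAlgebra.ιMulti_zero_apply, ← map_one (algebraMap ℝ (ExteriorAlgebra ℝ V))]
      simp only [contract_algebraMap]; simp
    | succ k ih =>
      rw [ExteriorAlgebra.ιMulti_succ_apply]
      have h1 : ∀ j, ExteriorAlgebra.ι ℝ (e j) * contract (f j) (ExteriorAlgebra.ι ℝ (v 0) *
          ExteriorAlgebra.ιMulti ℝ k (Matrix.vecTail v)) =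
          ExteriorAlgebra.ι ℝ (f j (v 0) • e j) * ExteriorAlgebra.ιMulti ℝ k (Matrix.vecTail v) +
          ExteriorAlgebra.ι ℝ (v 0) * (ExteriorAlgebra.ι ℝ (e j) *
            contract (f j) (ExteriorAlgebra.ιMulti ℝ k (Matrix.vecTail v))) := by
        intro j
        have h := ExteriorAlgebra.ι_add_mul_swap (R := ℝ) (e j) (v 0)
        rw [contract_ι_mul, mul_sub, mul_smul_comm, map_smul, smul_mul_assoc, ← mul_assoc,
          eq_neg_of_add_eq_zero_left h, ← mul_assoc]
        simp
      rw [Finset.sum_congr rfl fun j _ => h1 j, Finset.sum_add_distrib, ← Finset.sum_mul,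
        ← Finset.mul_sum, ih, ← map_sum, hef]
      push_cast
      rw [add_smul, one_smul, mul_smul_comm, add_comm]
  | zero => simp
  | add x y _ _ hx hy => simp only [map_add, mul_add, Finset.sum_add_distrib, hx, hy, smul_add]
  | smul c x _ hx =>
    simp only [map_smul, mul_smul_comm, ← Finset.smul_sum, hx]; rw [smul_comm]

/-- An element of positive degree is determined by its contractions. -/
theorem eq_of_contract_eq {J : Type*} [Fintype J] (e : J → V) (f : J → V →ₗ[ℝ] ℝ)
    (hef : ∀ v, ∑ j, f j v • e j = v) {k : ℕ} {x y : ExteriorAlgebra ℝ V}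
    (hx : x ∈ ⋀[ℝ]^(k + 1) V) (hy : y ∈ ⋀[ℝ]^(k + 1) V)
    (h : ∀ j, contract (f j) x = contract (f j) y) : x = y := by
  have hx' := sum_ι_mul_contract e f hef hx
  rw [Finset.sum_congr rfl fun j _ => by rw [h j], sum_ι_mul_contract e f hef hy] at hx'
  exact (smul_right_injective _ (by positivity : ((k + 1 : ℕ) : ℝ) ≠ 0) hx').symm

end Exterior

/-! ### Derivatives of functions along vector fields -/

section Derivatives

variable {d : ℕ} {P : Type*} [TopologicalSpace P] [ChartedSpace (EuclideanSpace ℝ (Fin d)) P]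

theorem diff_eq_mvfderiv (f : P → ℝ) (x : P) (v : TangentSpace (𝓡 d) x) :
    diff f x v = mvfderiv (𝓡 d) f x v := rfl

theorem diff_add {f g : P → ℝ} {x : P} (hf : MDifferentiableAt (𝓡 d) 𝓘(ℝ, ℝ) f x)
    (hg : MDifferentiableAt (𝓡 d) 𝓘(ℝ, ℝ) g x) (v : TangentSpace (𝓡 d) x) :
    diff (fun y => f y + g y) x v = diff f x v + diff g x v := by
  simp only [diff_eq_mvfderiv]
  rw [mvfderiv_fun_add hf hg]; rfl

theorem diff_mul {f g : P → ℝ} {x : P} (hf : MDifferentiableAt (𝓡 d) 𝓘(ℝ, ℝ) f x)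
    (hg : MDifferentiableAt (𝓡 d) 𝓘(ℝ, ℝ) g x) (v : TangentSpace (𝓡 d) x) :
    diff (fun y => f y * g y) x v = f x * diff g x v + g x * diff f x v := by
  simp only [diff_eq_mvfderiv]
  rw [mvfderiv_fun_mul hf hg]; rfl

theorem diff_const (c : ℝ) (x : P) (v : TangentSpace (𝓡 d) x) :
    diff (fun _ : P => c) x v = 0 := by
  rw [diff_eq_mvfderiv, mvfderiv_const]; rfl

theorem diff_const_mul {f : P → ℝ} {x : P} (c : ℝ) (hf : MDifferentiableAt (𝓡 d) 𝓘(ℝ, ℝ) f x)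
    (v : TangentSpace (𝓡 d) x) : diff (fun y => c * f y) x v = c * diff f x v := by
  rw [diff_mul mdifferentiableAt_const hf, diff_const]; simp

theorem diff_congr {f g : P → ℝ} {x : P} (h : f =ᶠ[𝓝 x] g) (v : TangentSpace (𝓡 d) x) :
    diff f x v = diff g x v := by
  simp only [diff, ContinuousLinearMap.coe_coe, ContinuousLinearMap.coe_comp,
    Function.comp_apply]
  rw [h.mfderiv_eq]
  rfl

theorem mdifferentiableAt_sum {J : Type*} {s : Finset J} {f : J → P → ℝ} {x : P}
    (hf : ∀ j ∈ s, MDifferentiableAt (𝓡 d) 𝓘(ℝ, ℝ) (f j) x) :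
    MDifferentiableAt (𝓡 d) 𝓘(ℝ, ℝ) (fun y => ∑ j ∈ s, f j y) x := by
  classical
  induction s using Finset.induction_on with
  | empty => simpa using mdifferentiableAt_const
  | insert a s ha ih =>
    simp only [Finset.sum_insert ha]
    exact (hf a (by simp)).add (ih fun j hj => hf j (by simp [hj]))

theorem diff_sum {J : Type*} {s : Finset J} {f : J → P → ℝ} {x : P}
    (hf : ∀ j ∈ s, MDifferentiableAt (𝓡 d) 𝓘(ℝ, ℝ) (f j) x) (v : TangentSpace (𝓡 d) x) :
    diff (fun y => ∑ j ∈ s, f j y) x v = ∑ j ∈ s, diff (f j) x v := by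
  classical
  induction s using Finset.induction_on with
  | empty => simpa using diff_const 0 x v
  | insert a s ha ih =>
    simp only [Finset.sum_insert ha]
    rw [diff_add (hf a (by simp)) (mdifferentiableAt_sum fun j hj => hf j (by simp [hj])),
      ih fun j hj => hf j (by simp [hj])]

theorem SmoothFun.mdiff (f : SmoothFun d P) (x : P) : MDifferentiableAt (𝓡 d) 𝓘(ℝ, ℝ) f x :=
  f.contMDiff.mdifferentiableAt (by simp)

variable [IsManifold (𝓡 d) ∞ P]

/-- The derivative of a smooth function along a smooth vector field is smooth. -/
theorem contMDiff_diff {f : P → ℝ} (hf : ContMDiff (𝓡 d) 𝓘(ℝ, ℝ) ∞ f)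
    {W : ∀ y : P, TangentSpace (𝓡 d) y}
    (hW : ContMDiff (𝓡 d) (𝓡 d).tangent ∞ (fun y => (⟨y, W y⟩ : TangentBundle (𝓡 d) P))) :
    ContMDiff (𝓡 d) 𝓘(ℝ, ℝ) ∞ (fun y => diff f y (W y)) := by
  have h1 : ContMDiff (𝓡 d).tangent 𝓘(ℝ, ℝ).tangent ∞ (tangentMap (𝓡 d) 𝓘(ℝ, ℝ) f) :=
    hf.contMDiff_tangentMap (by simp)
  have h2 := (contMDiff_snd_tangentBundle_modelSpace ℝ 𝓘(ℝ, ℝ) (n := ∞)).comp (h1.comp hW)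
  exact h2

/-- The vector field `W` read in the preferred chart at `x`. -/
def chartField (x : P) (W : ∀ y : P, TangentSpace (𝓡 d) y) (z : EuclideanSpace ℝ (Fin d)) :
    EuclideanSpace ℝ (Fin d) :=
  VectorField.mpullbackWithin 𝓘(ℝ, EuclideanSpace ℝ (Fin d)) (𝓡 d)
    (extChartAt (𝓡 d) x).symm W (Set.range (𝓡 d)) z

theorem range_model_eq : Set.range (𝓡 d) = Set.univ := by simp

theorem diff_eq_fderiv_chart {f : P → ℝ} (hf : ContMDiff (𝓡 d) 𝓘(ℝ, ℝ) ∞ f)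
    (x : P) {z : EuclideanSpace ℝ (Fin d)} (hz : z ∈ (extChartAt (𝓡 d) x).target)
    (W : ∀ y : P, TangentSpace (𝓡 d) y) :
    diff f ((extChartAt (𝓡 d) x).symm z) (W ((extChartAt (𝓡 d) x).symm z)) =
      fderiv ℝ (f ∘ (extChartAt (𝓡 d) x).symm) z (chartField x W z) := by
  have hinv := isInvertible_mfderivWithin_extChartAt_symm (I := 𝓡 d) hz
  have hc := (contMDiffOn_extChartAt_symm (I := 𝓡 d) (n := ∞) x).mdifferentiableOn (by simp) z hz
  have hc' : MDifferentiableAt 𝓘(ℝ, EuclideanSpace ℝ (Fin d)) (𝓡 d) (extChartAt (𝓡 d) x).symm z :=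
    hc.mdifferentiableAt ((isOpen_extChartAt_target x).mem_nhds hz)
  rw [range_model_eq, mfderivWithin_univ] at hinv
  have hcomp := mvfderiv_comp (I := 𝓘(ℝ, EuclideanSpace ℝ (Fin d))) z
    (hf.mdifferentiableAt (by simp)) hc'
  have hfd : mvfderiv 𝓘(ℝ, EuclideanSpace ℝ (Fin d)) (f ∘ (extChartAt (𝓡 d) x).symm) z =
      fderiv ℝ (f ∘ (extChartAt (𝓡 d) x).symm) z := by
    unfold mvfderiv
    rw [mfderiv_eq_fderiv]
    rfl
  rw [← hfd, hcomp, chartField, range_model_eq, diff_eq_mvfderiv]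
  simp only [VectorField.mpullbackWithin, mfderivWithin_univ]
  exact congrArg (mvfderiv (𝓡 d) f _) (hinv.self_apply_inverse _).symm

theorem diff_eq_fderiv_chart_self {f : P → ℝ} (hf : ContMDiff (𝓡 d) 𝓘(ℝ, ℝ) ∞ f) (x : P)
    (W : ∀ y : P, TangentSpace (𝓡 d) y) :
    diff f x (W x) =
      fderiv ℝ (f ∘ (extChartAt (𝓡 d) x).symm) (extChartAt (𝓡 d) x x)
        (chartField x W (extChartAt (𝓡 d) x x)) := by
  have h := diff_eq_fderiv_chart hf x (mem_extChartAt_target x) W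
  rwa [extChartAt_to_inv] at h

theorem chartField_self (x : P) (W : ∀ y : P, TangentSpace (𝓡 d) y) :
    chartField x W (extChartAt (𝓡 d) x x) = W x := by
  have hinv := isInvertible_mfderivWithin_extChartAt_symm (I := 𝓡 d) (mem_extChartAt_target x)
  have h1 : chartField x W (extChartAt (𝓡 d) x x) =
      W ((extChartAt (𝓡 d) x).symm (extChartAt (𝓡 d) x x)) :=
    hinv.inverse_apply_eq.2
      (DFunLike.congr_fun (mfderivWithin_range_extChartAt_symm (I := 𝓡 d) (x := x)) _).symm
  rw [h1, extChartAt_to_inv]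

theorem differentiableAt_chartField {W : ∀ y : P, TangentSpace (𝓡 d) y}
    (hW : ContMDiff (𝓡 d) (𝓡 d).tangent ∞ (fun y => (⟨y, W y⟩ : TangentBundle (𝓡 d) P)))
    (x : P) : DifferentiableAt ℝ (chartField x W) (extChartAt (𝓡 d) x x) := by
  have : IsManifold (𝓡 d) 2 P := IsManifold.of_le (n := ∞) (by norm_cast)
  have h := MDifferentiableWithinAt.differentiableWithinAt_mpullbackWithin_vectorField
    (hW.mdifferentiableAt (x := x) (by simp)).mdifferentiableWithinAt (s := Set.univ)
  rw [Set.preimage_univ, Set.univ_inter] at h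
  have h' : DifferentiableWithinAt ℝ (chartField x W) (Set.range (𝓡 d))
    (extChartAt (𝓡 d) x x) := h
  rwa [range_model_eq, differentiableWithinAt_univ] at h'

theorem mlieBracket_eq_chart (x : P) (V W : ∀ y : P, TangentSpace (𝓡 d) y) :
    VectorField.mlieBracket (𝓡 d) V W x =
      VectorField.lieBracket ℝ (chartField x V) (chartField x W) (extChartAt (𝓡 d) x x) := by
  have hinv := isInvertible_mfderiv_extChartAt (I := 𝓡 d) (mem_extChartAt_source x)
  have h : VectorField.mlieBracket (𝓡 d) V W x =
      VectorField.lieBracketWithin ℝ (chartField x V) (chartField x W)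
        ((extChartAt (𝓡 d) x).symm ⁻¹' Set.univ ∩ Set.range (𝓡 d)) (extChartAt (𝓡 d) x x) :=
    hinv.inverse_apply_eq.2
      (DFunLike.congr_fun (mfderiv_extChartAt_self (I := 𝓡 d) (x := x)) _).symm
  rw [h, Set.preimage_univ, Set.univ_inter, range_model_eq, VectorField.lieBracketWithin_univ]

/-- The Lie bracket of vector fields acts on functions as the commutator of derivations. -/
theorem diff_mlieBracket {f : P → ℝ} (hf : ContMDiff (𝓡 d) 𝓘(ℝ, ℝ) ∞ f)
    {V W : ∀ y : P, TangentSpace (𝓡 d) y}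
    (hV : ContMDiff (𝓡 d) (𝓡 d).tangent ∞ (fun y => (⟨y, V y⟩ : TangentBundle (𝓡 d) P)))
    (hW : ContMDiff (𝓡 d) (𝓡 d).tangent ∞ (fun y => (⟨y, W y⟩ : TangentBundle (𝓡 d) P)))
    (x : P) :
    diff f x (VectorField.mlieBracket (𝓡 d) V W x) =
      diff (fun y => diff f y (W y)) x (V x) - diff (fun y => diff f y (V y)) x (W x) := by
  set z := extChartAt (𝓡 d) x x with hz
  set f' : EuclideanSpace ℝ (Fin d) → ℝ := f ∘ (extChartAt (𝓡 d) x).symm with hf'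
  have hsmooth : ContDiffAt ℝ ∞ f' z := by
    have h1 := (contMDiffOn_extChartAt_symm (I := 𝓡 d) (n := ∞) x).contMDiffAt
      ((isOpen_extChartAt_target x).mem_nhds (mem_extChartAt_target x))
    exact (hf.contMDiffAt.comp _ h1).contDiffAt
  have hsec : IsSymmSndFDerivAt ℝ f' z :=
    hsmooth.isSymmSndFDerivAt (by simp [minSmoothness_of_isRCLikeNormedField]; norm_cast)
  have hD : DifferentiableAt ℝ (fderiv ℝ f') z :=
    (hsmooth.fderiv_right (m := 1) (by norm_cast)).differentiableAt (by simp)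
  have key : ∀ U U' : ∀ y : P, TangentSpace (𝓡 d) y,
      ContMDiff (𝓡 d) (𝓡 d).tangent ∞ (fun y => (⟨y, U y⟩ : TangentBundle (𝓡 d) P)) →
      diff (fun y => diff f y (U y)) x (U' x) =
        fderiv ℝ f' z (fderiv ℝ (chartField x U) z (chartField x U' z)) +
          fderiv ℝ (fderiv ℝ f') z (chartField x U' z) (chartField x U z) := by
    intro U U' hU
    have h : ((fun y => diff f y (U y)) ∘ (extChartAt (𝓡 d) x).symm) =ᶠ[𝓝 z]
        fun w => fderiv ℝ f' w (chartField x U w) := by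
      filter_upwards [(isOpen_extChartAt_target x).mem_nhds (mem_extChartAt_target x)] with w hw
      exact diff_eq_fderiv_chart hf x hw U
    rw [diff_eq_fderiv_chart_self (contMDiff_diff hf hU) x U', ← hz, h.fderiv_eq,
      fderiv_clm_apply hD (differentiableAt_chartField hU x)]
    rfl
  have hl := diff_eq_fderiv_chart_self hf x (VectorField.mlieBracket (𝓡 d) V W)
  rw [chartField_self] at hl
  have hb : (VectorField.mlieBracket (𝓡 d) V W x : EuclideanSpace ℝ (Fin d)) =
      fderiv ℝ (chartField x W) z (chartField x V z) -
        fderiv ℝ (chartField x V) z (chartField x W z) := mlieBracket_eq_chart x V W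
  have hl' : diff f x (VectorField.mlieBracket (𝓡 d) V W x) =
      fderiv ℝ f' z (fderiv ℝ (chartField x W) z (chartField x V z) -
        fderiv ℝ (chartField x V) z (chartField x W z)) := hl.trans (congrArg (fderiv ℝ f' z) hb)
  rw [hl', map_sub, key W V hW, key V W hV, hsec.eq]
  ring

end Derivatives

/-! ### Local frames and sections representing smooth functionals -/

section Frames

variable {d : ℕ} {P : Type*} [TopologicalSpace P] [T2Space P]
  [ChartedSpace (EuclideanSpace ℝ (Fin d)) P] [IsManifold (𝓡 d) ∞ P]
  {F₁ : Type*} [NormedAddCommGroup F₁] [NormedSpace ℝ F₁]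
  {A : P → Type*} [TopologicalSpace (TotalSpace F₁ A)]
  [∀ x, AddCommGroup (A x)] [∀ x, Module ℝ (A x)]
  [∀ x, TopologicalSpace (A x)] [FiberBundle F₁ A] [VectorBundle ℝ F₁ A]
  {F₂ : Type*} [NormedAddCommGroup F₂] [NormedSpace ℝ F₂]
  {B : P → Type*} [TopologicalSpace (TotalSpace F₂ B)]
  [∀ x, AddCommGroup (B x)] [∀ x, Module ℝ (B x)]
  [∀ x, TopologicalSpace (B x)] [FiberBundle F₂ B] [VectorBundle ℝ F₂ B]

theorem exists_bump (x : P) {s : Set P} (hs : s ∈ 𝓝 x) :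
    ∃ χ : SmoothFun d P, (∀ᶠ y in 𝓝 x, χ y = 1) ∧ tsupport χ ⊆ s := by
  obtain ⟨f, hf, hfs⟩ := (SmoothBumpFunction.nhds_basis_tsupport (I := 𝓡 d) x).mem_iff.1 hs
  exact ⟨⟨f, f.contMDiff⟩, f.eventuallyEq_one, hfs⟩

theorem exists_sec_eventuallyEq {u : Set P} (hu : IsOpen u) {x : P} (hx : x ∈ u)
    {s : ∀ y, A y}
    (hs : ContMDiffOn (𝓡 d) ((𝓡 d).prod 𝓘(ℝ, F₁)) ∞ (fun y => (⟨y, s y⟩ : TotalSpace F₁ A)) u) :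
    ∃ X : Sec d F₁ A, ∀ᶠ y in 𝓝 x, X y = s y := by
  obtain ⟨χ, hχ, hsupp⟩ := exists_bump (d := d) x (hu.mem_nhds hx)
  refine ⟨⟨fun y => χ y • s y, ?_⟩, ?_⟩
  · exact ContMDiffOn.smul_section_of_tsupport χ.contMDiff.contMDiffOn hu hsupp hs
  · filter_upwards [hχ] with y hy
    simp [hy]

/-- Near every point there is a smooth frame consisting of global sections. -/
theorem exists_frame [ContMDiffVectorBundle ∞ F₁ A (𝓡 d)] {J : Type*} [Finite J]
    (b : Module.Basis J ℝ F₁) (x : P) :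
    ∃ X : J → Sec d F₁ A, ∀ᶠ y in 𝓝 x, ∃ b' : Module.Basis J ℝ (A y), ∀ j, b' j = X j y := by
  set e := trivializationAt F₁ A x
  have hx : x ∈ e.baseSet := FiberBundle.mem_baseSet_trivializationAt' x
  choose X hX using fun j => exists_sec_eventuallyEq (d := d) e.open_baseSet hx
    (e.contMDiffOn_localFrame_baseSet (I := 𝓡 d) ∞ b j)
  refine ⟨X, ?_⟩
  filter_upwards [eventually_all.2 hX, e.open_baseSet.mem_nhds hx] with y hy hye
  exact ⟨e.basisAt b hye, fun j => by rw [hy j, e.localFrame_apply_of_mem_baseSet b hye]⟩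

theorem contMDiffAt_det {J : Type*} [Fintype J] [DecidableEq J] {M : P → Matrix J J ℝ} {x : P}
    (hM : ∀ i j, ContMDiffAt (𝓡 d) 𝓘(ℝ, ℝ) ∞ (fun y => M y i j) x) :
    ContMDiffAt (𝓡 d) 𝓘(ℝ, ℝ) ∞ (fun y => (M y).det) x := by
  simp only [Matrix.det_apply]
  refine contMDiffAt_finsetSum fun σ _ => ?_
  have h : ContMDiffAt (𝓡 d) 𝓘(ℝ, ℝ) ∞ (fun y => ∏ i, M y (σ i) i) x :=
    contMDiffAt_finsetProd fun i _ => hM _ _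
  have h2 := (contMDiffAt_const (c := ((Equiv.Perm.sign σ : ℤ) : ℝ))).mul h
  refine h2.congr_of_eventuallyEq (Eventually.of_forall fun y => ?_)
  simp [Units.smul_def]

theorem contMDiffAt_inv_matrix {J : Type*} [Fintype J] [DecidableEq J] {M : P → Matrix J J ℝ}
    {x : P} (hM : ∀ i j, ContMDiffAt (𝓡 d) 𝓘(ℝ, ℝ) ∞ (fun y => M y i j) x)
    (hdet : (M x).det ≠ 0) (i j : J) :
    ContMDiffAt (𝓡 d) 𝓘(ℝ, ℝ) ∞ (fun y => (M y)⁻¹ i j) x := by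
  simp only [Matrix.inv_def, Matrix.smul_apply, Ring.inverse_eq_inv', smul_eq_mul,
    Matrix.adjugate_apply]
  refine ((contMDiffAt_det hM).inv₀ hdet).mul (contMDiffAt_det fun k l => ?_)
  simp only [Matrix.updateRow_apply]
  split_ifs
  · exact contMDiffAt_const
  · exact hM k l

theorem DualPairing.exists_pair_eq (p : DualPairing d F₁ A F₂ B) [FiniteDimensional ℝ F₁]
    [FiniteDimensional ℝ F₂] (x : P) (φ : B x →ₗ[ℝ] ℝ) : ∃ v : A x, ∀ w, p.pair x w v = φ w := by
  have : FiniteDimensional ℝ (A x) := finiteDimensional_fiber F₁ x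
  have : FiniteDimensional ℝ (B x) := finiteDimensional_fiber F₂ x
  have h1 : Function.Injective (p.pair x) :=
    LinearMap.ker_eq_bot.1 (LinearMap.separatingLeft_iff_ker_eq_bot.1 (p.nondegenerate x).1)
  have h2 : Function.Injective (p.pair x).flip :=
    LinearMap.ker_eq_bot.1 (LinearMap.separatingRight_iff_flip_ker_eq_bot.1 (p.nondegenerate x).2)
  have := LinearMap.IsPerfPair.of_injective h1 h2
  obtain ⟨v, hv⟩ := (LinearMap.IsPerfPair.bijective_right (p.pair x)).2 φ
  exact ⟨v, fun w => by rw [← hv]; rfl⟩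

theorem DualPairing.finrank_eq (p : DualPairing d F₁ A F₂ B) [FiniteDimensional ℝ F₁]
    [FiniteDimensional ℝ F₂] (x : P) : Module.finrank ℝ F₂ = Module.finrank ℝ F₁ := by
  have : FiniteDimensional ℝ (A x) := finiteDimensional_fiber F₁ x
  have : FiniteDimensional ℝ (B x) := finiteDimensional_fiber F₂ x
  have h1 : Function.Injective (p.pair x) :=
    LinearMap.ker_eq_bot.1 (LinearMap.separatingLeft_iff_ker_eq_bot.1 (p.nondegenerate x).1)
  have h2 : Function.Injective (p.pair x).flip :=
    LinearMap.ker_eq_bot.1 (LinearMap.separatingRight_iff_flip_ker_eq_bot.1 (p.nondegenerate x).2)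
  have e1 := ((trivializationAt F₁ A x).linearEquivAt ℝ x
    (FiberBundle.mem_baseSet_trivializationAt' x)).finrank_eq
  have e2 := ((trivializationAt F₂ B x).linearEquivAt ℝ x
    (FiberBundle.mem_baseSet_trivializationAt' x)).finrank_eq
  have h3 := LinearMap.finrank_le_finrank_of_injective h1
  have h4 := LinearMap.finrank_le_finrank_of_injective h2
  rw [Subspace.dual_finrank_eq] at h3 h4
  omega

theorem DualPairing.pair_ext (p : DualPairing d F₁ A F₂ B) {x : P} {v v' : A x}
    (h : ∀ w, p.pair x w v = p.pair x w v') : v = v' := by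
  have := (p.nondegenerate x).2 (v - v') fun w => by rw [map_sub, h, sub_self]
  exact sub_eq_zero.1 this

variable [FiniteDimensional ℝ F₁] [FiniteDimensional ℝ F₂]
  [ContMDiffVectorBundle ∞ F₁ A (𝓡 d)] [ContMDiffVectorBundle ∞ F₂ B (𝓡 d)]

/-- A fibrewise linear functional on `B = A^*` that takes smooth sections to smooth functions is
evaluation on a smooth section of `A`. -/
theorem DualPairing.exists_sec (p : DualPairing d F₁ A F₂ B) (φ : ∀ x, B x →ₗ[ℝ] ℝ)
    (hφ : ∀ ξ : Sec d F₂ B, ContMDiff (𝓡 d) 𝓘(ℝ, ℝ) ∞ (fun x => φ x (ξ x))) :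
    ∃ X : Sec d F₁ A, ∀ x w, p.pair x w (X x) = φ x w := by
  choose X hX using fun x => p.exists_pair_eq x (φ x)
  refine ⟨⟨X, fun x₀ => ?_⟩, hX⟩
  let b₁ := Module.finBasis ℝ F₁
  let b₂ := Module.finBasisOfFinrankEq ℝ F₂ (p.finrank_eq x₀)
  obtain ⟨e, he⟩ := exists_frame (d := d) (A := A) b₁ x₀
  obtain ⟨f, hf⟩ := exists_frame (d := d) (A := B) b₂ x₀
  -- the components of `X` in the frame `e` are obtained by inverting the Gram matrix
  let G : P → Matrix (Fin (Module.finrank ℝ F₁)) (Fin (Module.finrank ℝ F₁)) ℝ :=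
    fun y => Matrix.of fun k j => p.pair y (f k y) (e j y)
  have hdet : ∀ᶠ y in 𝓝 x₀, (G y).det ≠ 0 := by
    filter_upwards [he, hf] with y ⟨b, hb⟩ ⟨b', hb'⟩ h0
    obtain ⟨v, hv, hGv⟩ := Matrix.exists_mulVec_eq_zero_iff.2 h0
    have h1 : ∑ j, v j • e j y = 0 := by
      refine p.pair_ext fun w => ?_
      rw [map_zero]
      have h2 : (p.pair y).flip (∑ j, v j • e j y) = 0 := by
        refine b'.ext fun k => ?_
        have := congrFun hGv k
        simp only [Matrix.mulVec, dotProduct, G, Matrix.of_apply, Pi.zero_apply] at this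
        rw [LinearMap.flip_apply, hb', map_sum, LinearMap.zero_apply, ← this]
        simp [mul_comm]
      exact DFunLike.congr_fun h2 w
    refine hv (funext fun j => ?_)
    simp only [← hb] at h1
    exact Fintype.linearIndependent_iff.1 b.linearIndependent v h1 j
  have hXeq : ∀ᶠ y in 𝓝 x₀, X y = ∑ j, (∑ k, (G y)⁻¹ j k * φ y (f k y)) • e j y := by
    filter_upwards [he, hdet] with y ⟨b, hb⟩ hd
    have h1 : (G y).mulVec (b.repr (X y)) = fun k => φ y (f k y) := by
      funext k
      rw [← hX y (f k y)]
      conv_rhs => rw [← b.sum_repr (X y)]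
      simp [Matrix.mulVec, dotProduct, G, hb, mul_comm]
    have h2 : (b.repr (X y) : _ → ℝ) = (G y)⁻¹.mulVec fun k => φ y (f k y) := by
      rw [← h1, Matrix.mulVec_mulVec, Matrix.nonsing_inv_mul _ (isUnit_iff_ne_zero.2 hd),
        Matrix.one_mulVec]
    conv_lhs => rw [← b.sum_repr (X y)]
    refine Finset.sum_congr rfl fun j _ => ?_
    rw [h2, hb]
    rfl
  have hsmooth : ContMDiffAt (𝓡 d) ((𝓡 d).prod 𝓘(ℝ, F₁)) ∞
      (fun y => (⟨y, ∑ j, (∑ k, (G y)⁻¹ j k * φ y (f k y)) • e j y⟩ : TotalSpace F₁ A)) x₀ := by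
    refine ContMDiffAt.sum_section fun j _ => ?_
    refine ContMDiffAt.smul_section ?_ (e j).contMDiff.contMDiffAt
    refine contMDiffAt_finsetSum fun k _ => ?_
    exact (contMDiffAt_inv_matrix (fun k j => (p.smooth (f k) (e j)).contMDiffAt)
      hdet.self_of_nhds j k).mul (hφ (f k)).contMDiffAt
  refine hsmooth.congr_of_eventuallyEq ?_
  filter_upwards [hXeq] with y hy
  rw [hy]

/-- Dual frames near `x`, consisting of global smooth sections `e j` of `A` and `f j` of
`B = A^*`. -/
structure DualFrame (p : DualPairing d F₁ A F₂ B) (x : P) where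
  /-- the frame of `A` -/
  e : Fin (Module.finrank ℝ F₁) → Sec d F₁ A
  /-- the dual frame of `B` -/
  f : Fin (Module.finrank ℝ F₁) → Sec d F₂ B
  pair_eq : ∀ᶠ y in 𝓝 x, ∀ j k, p.pair y (f j y) (e k y) = if j = k then 1 else 0
  expand : ∀ᶠ y in 𝓝 x, ∀ v : A y, ∑ j, p.pair y (f j y) v • e j y = v

theorem exists_dualFrame (p : DualPairing d F₁ A F₂ B) (x : P) : Nonempty (DualFrame p x) := by
  let b := Module.finBasis ℝ F₁
  set t := trivializationAt F₁ A x with ht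
  have hx : x ∈ t.baseSet := FiberBundle.mem_baseSet_trivializationAt' x
  choose e he using fun j => exists_sec_eventuallyEq (d := d) t.open_baseSet hx
    (t.contMDiffOn_localFrame_baseSet (I := 𝓡 d) ∞ b j)
  obtain ⟨χ, hχ, hsupp⟩ := exists_bump (d := d) x (t.open_baseSet.mem_nhds hx)
  have : ContMDiffVectorBundle 1 F₁ A (𝓡 d) := ContMDiffVectorBundle.of_le (n := ∞) (by simp)
  have hcoef : ∀ j (X : Sec d F₁ A), ContMDiff (𝓡 d) 𝓘(ℝ, ℝ) ∞
      (fun y => (χ y • t.localFrameCoeff (𝓡 d) b j y) (X y)) := by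
    intro j X
    refine contMDiff_of_tsupport fun y hy => ?_
    have hy' : y ∈ t.baseSet := by
      refine hsupp (closure_mono (fun z hz => ?_) hy)
      rw [Function.mem_support] at hz ⊢
      exact fun h => hz (by simp [h])
    exact χ.contMDiff.contMDiffAt.mul
      (contMDiffAt_localFrameCoeff b hy' X.contMDiff.contMDiffAt j)
  choose f hf using fun j => p.flip.exists_sec _ (hcoef j)
  refine ⟨⟨e, f, ?_, ?_⟩⟩
  · filter_upwards [eventually_all.2 he, t.open_baseSet.mem_nhds hx, hχ] with y hy hyt hyχ j k
    have h1 := hf j y (e k y)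
    rw [LinearMap.smul_apply, hyχ, one_smul, t.localFrameCoeff_apply_of_mem_baseSet b hyt, hy k,
      t.localFrame_apply_of_mem_baseSet b hyt, Module.Basis.repr_self, Finsupp.single_apply] at h1
    rw [hy k, t.localFrame_apply_of_mem_baseSet b hyt]
    simp only [eq_comm (a := j)]
    exact h1
  · filter_upwards [eventually_all.2 he, t.open_baseSet.mem_nhds hx, hχ] with y hy hyt hyχ v
    conv_rhs => rw [← (t.basisAt b hyt).sum_repr v]
    refine Finset.sum_congr rfl fun j _ => ?_
    have h1 := hf j y v
    classical
    have h2 := t.localFrameCoeff_apply_of_mem_baseSet (I := 𝓡 d) b hyt (Pi.single y v) j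
    rw [Pi.single_eq_same] at h2
    rw [LinearMap.smul_apply, hyχ, one_smul, h2] at h1
    rw [hy j, t.localFrame_apply_of_mem_baseSet b hyt, ← h1]
    rfl

end Frames

/-! ### Derivatives of functions with values in a finite-dimensional algebra -/

section AlgebraValued

variable {d : ℕ} {P : Type*} [TopologicalSpace P] [ChartedSpace (EuclideanSpace ℝ (Fin d)) P]
  {G : Type*} [Ring G] [Algebra ℝ G] {J : Type*} [Fintype J] (b : Module.Basis J ℝ G)

/-- The derivative along `v` of a function with values in a finite-dimensional algebra, computed in
a basis.  No topology on the algebra is needed. -/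
def vdiff (h : P → G) (x : P) (v : TangentSpace (𝓡 d) x) : G :=
  ∑ i, diff (fun y => b.repr (h y) i) x v • b i

variable (d) in
/-- Differentiability, at `x`, of all components with respect to a basis. -/
def VDiffAt (h : P → G) (x : P) : Prop :=
  ∀ i, MDifferentiableAt (𝓡 d) 𝓘(ℝ, ℝ) (fun y => b.repr (h y) i) x

variable {b}

theorem VDiffAt.linear {h : P → G} {x : P} (hh : VDiffAt d b h x) (φ : G →ₗ[ℝ] ℝ) :
    MDifferentiableAt (𝓡 d) 𝓘(ℝ, ℝ) (fun y => φ (h y)) x := by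
  have h1 : (fun y => φ (h y)) = fun y => ∑ i, b.repr (h y) i * φ (b i) := by
    funext y
    conv_lhs => rw [← b.sum_repr (h y)]
    simp only [map_sum, map_smul, smul_eq_mul]
  rw [h1]
  exact mdifferentiableAt_sum fun i _ => (hh i).mul mdifferentiableAt_const

theorem map_vdiff {h : P → G} {x : P} (hh : VDiffAt d b h x) (φ : G →ₗ[ℝ] ℝ)
    (v : TangentSpace (𝓡 d) x) : φ (vdiff b h x v) = diff (fun y => φ (h y)) x v := by
  have h1 : (fun y => φ (h y)) = fun y => ∑ i, φ (b i) * b.repr (h y) i := by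
    funext y
    conv_lhs => rw [← b.sum_repr (h y)]
    simp only [map_sum, map_smul, smul_eq_mul, mul_comm]
  have hd : ∀ i, MDifferentiableAt (𝓡 d) 𝓘(ℝ, ℝ) (fun y => φ (b i) * b.repr (h y) i) x :=
    fun i => mdifferentiableAt_const.mul (hh i)
  rw [h1, diff_sum fun i _ => hd i]
  simp only [vdiff, map_sum, map_smul, smul_eq_mul]
  refine Finset.sum_congr rfl fun i _ => ?_
  rw [diff_const_mul _ (hh i), mul_comm]

theorem vdiff_ext {g g' : G} (h : ∀ φ : G →ₗ[ℝ] ℝ, φ g = φ g') : g = g' :=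
  sub_eq_zero.1 <| (Module.forall_dual_apply_eq_zero_iff ℝ (g - g')).1 fun φ => by
    rw [map_sub, h φ, sub_self]

theorem vdiffAt_of_linear {h : P → G} {x : P}
    (hh : ∀ φ : G →ₗ[ℝ] ℝ, MDifferentiableAt (𝓡 d) 𝓘(ℝ, ℝ) (fun y => φ (h y)) x) :
    VDiffAt d b h x :=
  fun i => hh (b.coord i)

theorem VDiffAt.mul {h k : P → G} {x : P} (hh : VDiffAt d b h x) (hk : VDiffAt d b k x) :
    VDiffAt d b (fun y => h y * k y) x := by
  refine vdiffAt_of_linear fun φ => ?_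
  have h1 : (fun y => φ (h y * k y)) =
      fun y => ∑ i, b.repr (h y) i * φ (b i * k y) := by
    funext y
    conv_lhs => rw [← b.sum_repr (h y)]
    simp only [Finset.sum_mul, smul_mul_assoc, map_sum, map_smul, smul_eq_mul]
  rw [h1]
  exact mdifferentiableAt_sum fun i _ =>
    (hh i).mul (hk.linear (φ ∘ₗ LinearMap.mulLeft ℝ (b i)))

theorem vdiff_mul {h k : P → G} {x : P} (hh : VDiffAt d b h x) (hk : VDiffAt d b k x)
    (v : TangentSpace (𝓡 d) x) :
    vdiff b (fun y => h y * k y) x v = vdiff b h x v * k x + h x * vdiff b k x v := by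
  refine vdiff_ext fun φ => ?_
  rw [map_vdiff (hh.mul hk)]
  have h1 : (fun y => φ (h y * k y)) =
      fun y => ∑ i, b.repr (h y) i * φ (b i * k y) := by
    funext y
    conv_lhs => rw [← b.sum_repr (h y)]
    simp only [Finset.sum_mul, smul_mul_assoc, map_sum, map_smul, smul_eq_mul]
  have hk' : ∀ i, MDifferentiableAt (𝓡 d) 𝓘(ℝ, ℝ) (fun y => φ (b i * k y)) x := fun i =>
    hk.linear (φ ∘ₗ LinearMap.mulLeft ℝ (b i))
  have hk'' : ∀ i, diff (fun y => φ (b i * k y)) x v = φ (b i * vdiff b k x v) := fun i =>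
    (map_vdiff hk (φ ∘ₗ LinearMap.mulLeft ℝ (b i)) v).symm
  have hd : ∀ i, MDifferentiableAt (𝓡 d) 𝓘(ℝ, ℝ) (fun y => b.repr (h y) i * φ (b i * k y)) x :=
    fun i => (hh i).mul (hk' i)
  rw [h1, diff_sum fun i _ => hd i]
  have h2 : φ (h x * vdiff b k x v) = ∑ i, b.repr (h x) i * φ (b i * vdiff b k x v) := by
    conv_lhs => rw [← b.sum_repr (h x)]
    simp only [Finset.sum_mul, smul_mul_assoc, map_sum, map_smul, smul_eq_mul]
  rw [map_add, h2, vdiff, Finset.sum_mul, map_sum, ← Finset.sum_add_distrib]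
  refine Finset.sum_congr rfl fun i _ => ?_
  rw [diff_mul (hh i) (hk' i), hk'', smul_mul_assoc, map_smul, smul_eq_mul]
  ring

theorem VDiffAt.add {h k : P → G} {x : P} (hh : VDiffAt d b h x) (hk : VDiffAt d b k x) :
    VDiffAt d b (fun y => h y + k y) x := by
  refine vdiffAt_of_linear fun φ => ?_
  simp only [map_add]
  exact (hh.linear φ).add (hk.linear φ)

theorem vdiff_add {h k : P → G} {x : P} (hh : VDiffAt d b h x) (hk : VDiffAt d b k x)
    (v : TangentSpace (𝓡 d) x) :
    vdiff b (fun y => h y + k y) x v = vdiff b h x v + vdiff b k x v := by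
  refine vdiff_ext fun φ => ?_
  rw [map_vdiff (hh.add hk), map_add, map_vdiff hh, map_vdiff hk]
  simp only [map_add]
  exact diff_add (hh.linear φ) (hk.linear φ) v

theorem VDiffAt.smul_const {f : P → ℝ} {x : P} (hf : MDifferentiableAt (𝓡 d) 𝓘(ℝ, ℝ) f x)
    (g : G) : VDiffAt d b (fun y => f y • g) x := by
  refine vdiffAt_of_linear fun φ => ?_
  simp only [map_smul, smul_eq_mul]
  exact hf.mul mdifferentiableAt_const

theorem vdiff_smul_const {f : P → ℝ} {x : P} (hf : MDifferentiableAt (𝓡 d) 𝓘(ℝ, ℝ) f x)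
    (g : G) (v : TangentSpace (𝓡 d) x) : vdiff b (fun y => f y • g) x v = diff f x v • g := by
  refine vdiff_ext fun φ => ?_
  rw [map_vdiff (VDiffAt.smul_const hf g)]
  simp only [map_smul, smul_eq_mul]
  rw [diff_mul hf mdifferentiableAt_const, diff_const]
  ring

theorem VDiffAt.sum {K : Type*} {s : Finset K} {h : K → P → G} {x : P}
    (hh : ∀ j ∈ s, VDiffAt d b (h j) x) : VDiffAt d b (fun y => ∑ j ∈ s, h j y) x := by
  refine vdiffAt_of_linear fun φ => ?_
  simp only [map_sum]
  exact mdifferentiableAt_sum fun j hj => (hh j hj).linear φ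

theorem vdiff_sum {K : Type*} {s : Finset K} {h : K → P → G} {x : P}
    (hh : ∀ j ∈ s, VDiffAt d b (h j) x) (v : TangentSpace (𝓡 d) x) :
    vdiff b (fun y => ∑ j ∈ s, h j y) x v = ∑ j ∈ s, vdiff b (h j) x v := by
  refine vdiff_ext fun φ => ?_
  rw [map_vdiff (VDiffAt.sum hh), map_sum]
  simp only [map_sum]
  rw [diff_sum fun j hj => (hh j hj).linear φ]
  exact Finset.sum_congr rfl fun j hj => (map_vdiff (hh j hj) φ v).symm

theorem VDiffAt.congr {h k : P → G} {x : P} (hh : VDiffAt d b h x) (e : k =ᶠ[𝓝 x] h) :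
    VDiffAt d b k x := fun i =>
  (hh i).congr_of_eventuallyEq (by filter_upwards [e] with y hy; rw [hy])

theorem vdiff_congr {h k : P → G} {x : P} (e : h =ᶠ[𝓝 x] k) (v : TangentSpace (𝓡 d) x) :
    vdiff b h x v = vdiff b k x v := by
  refine Finset.sum_congr rfl fun i _ => ?_
  rw [diff_congr (g := fun y => b.repr (k y) i)]
  filter_upwards [e] with y hy
  rw [hy]

theorem vdiff_mem {h : P → G} {x : P} (hh : VDiffAt d b h x) (U : Submodule ℝ G)
    (hU : ∀ y, h y ∈ U) (v : TangentSpace (𝓡 d) x) : vdiff b h x v ∈ U := by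
  by_contra hn
  obtain ⟨φ, hφ, hφU⟩ := Submodule.exists_le_ker_of_notMem hn
  refine hφ ?_
  rw [map_vdiff hh]
  have : (fun y => φ (h y)) = fun _ => 0 := funext fun y => hφU (hU y)
  rw [this, diff_const]

end AlgebraValued

/-! ### The connection of a dual frame on multivector fields -/

section Nabla

variable {d : ℕ} {P : Type*} [TopologicalSpace P] [T2Space P]
  [ChartedSpace (EuclideanSpace ℝ (Fin d)) P] [IsManifold (𝓡 d) ∞ P]
  {F₁ : Type*} [NormedAddCommGroup F₁] [NormedSpace ℝ F₁]
  {A : P → Type*} [TopologicalSpace (TotalSpace F₁ A)]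
  [∀ x, AddCommGroup (A x)] [∀ x, Module ℝ (A x)]
  [∀ x, TopologicalSpace (A x)] [FiberBundle F₁ A] [VectorBundle ℝ F₁ A]
  {F₂ : Type*} [NormedAddCommGroup F₂] [NormedSpace ℝ F₂]
  {B : P → Type*} [TopologicalSpace (TotalSpace F₂ B)]
  [∀ x, AddCommGroup (B x)] [∀ x, Module ℝ (B x)]
  [∀ x, TopologicalSpace (B x)] [FiberBundle F₂ B] [VectorBundle ℝ F₂ B]
  [FiniteDimensional ℝ F₁] [FiniteDimensional ℝ F₂]
  [ContMDiffVectorBundle ∞ F₁ A (𝓡 d)] [ContMDiffVectorBundle ∞ F₂ B (𝓡 d)]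
  {p : DualPairing d F₁ A F₂ B} {x : P}

theorem invol_map {V W : Type*} [AddCommGroup V] [Module ℝ V] [AddCommGroup W] [Module ℝ W]
    (f : V →ₗ[ℝ] W) (w : ExteriorAlgebra ℝ V) :
    invol (ExteriorAlgebra.map f w) = ExteriorAlgebra.map f (invol w) := by
  have : (invol (V := W)).comp (ExteriorAlgebra.map f) =
      (ExteriorAlgebra.map f).comp (invol (V := V)) := by
    ext v
    simp
  exact DFunLike.congr_fun this w

theorem map_mem_exteriorPower {V W : Type*} [AddCommGroup V] [Module ℝ V] [AddCommGroup W]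
    [Module ℝ W] (f : V →ₗ[ℝ] W) {k : ℕ} {w : ExteriorAlgebra ℝ V} (hw : w ∈ ⋀[ℝ]^k V) :
    ExteriorAlgebra.map f w ∈ ⋀[ℝ]^k W := by
  rw [← ExteriorAlgebra.ιMulti_span_fixedDegree] at hw ⊢
  induction hw using Submodule.span_induction with
  | mem x h =>
    obtain ⟨v, rfl⟩ := h
    rw [ExteriorAlgebra.map_apply_ιMulti]
    exact Submodule.subset_span ⟨_, rfl⟩
  | zero => simp
  | add x y _ _ hx hy => rw [map_add]; exact add_mem hx hy
  | smul c x _ hx => rw [map_smul]; exact Submodule.smul_mem _ _ hx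

theorem HasParity.map {V W : Type*} [AddCommGroup V] [Module ℝ V] [AddCommGroup W]
    [Module ℝ W] (f : V →ₗ[ℝ] W) {n : ℕ} {w : ExteriorAlgebra ℝ V} (hw : HasParity n w) :
    HasParity n (ExteriorAlgebra.map f w) := by
  unfold HasParity at *
  rw [invol_map, hw, map_smul]

/-- The submodule of elements of parity `n`. -/
def paritySubmodule (V : Type*) [AddCommGroup V] [Module ℝ V] (n : ℕ) :
    Submodule ℝ (ExteriorAlgebra ℝ V) where
  carrier := {w | HasParity n w}
  zero_mem' := hasParity_zero n
  add_mem' := HasParity.add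
  smul_mem' c _ h := h.smul c

namespace DualFrame

/-- The components of a vector of `A y` in the frame. -/
def comp (D : DualFrame p x) (y : P) : A y →ₗ[ℝ] (Fin (Module.finrank ℝ F₁) → ℝ) :=
  LinearMap.pi fun j => p.pair y (D.f j y)

/-- The vector of `A x` with given components. -/
def ofComp (D : DualFrame p x) : (Fin (Module.finrank ℝ F₁) → ℝ) →ₗ[ℝ] A x :=
  Fintype.linearCombination ℝ fun j => D.e j x

/-- The covariant derivative at `x` of a multivector field along `v`, with respect to the flat
connection for which the frame is parallel. -/
def nabla (D : DualFrame p x) (v : TangentSpace (𝓡 d) x) (w : ∀ y, ExteriorAlgebra ℝ (A y)) :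
    ExteriorAlgebra ℝ (A x) :=
  ExteriorAlgebra.map D.ofComp (vdiff
    (Pi.basisFun ℝ (Fin (Module.finrank ℝ F₁))).ExteriorAlgebra
    (fun y => ExteriorAlgebra.map (D.comp y) (w y)) x v)

variable (D : DualFrame p x)

theorem ofComp_comp (w : ExteriorAlgebra ℝ (A x)) :
    ExteriorAlgebra.map D.ofComp (ExteriorAlgebra.map (D.comp x) w) = w := by
  have h : D.ofComp ∘ₗ D.comp x = LinearMap.id := by
    ext v
    exact D.expand.self_of_nhds v
  have h2 := ExteriorAlgebra.map_comp_map (D.comp x) D.ofComp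
  rw [h, ExteriorAlgebra.map_id] at h2
  exact DFunLike.congr_fun h2 w

theorem map_comp_ι (X : Sec d F₁ A) :
    (fun y => ExteriorAlgebra.map (D.comp y) (ExteriorAlgebra.ι ℝ (X y))) =
      fun y => ∑ j, p.pair y (D.f j y) (X y) •
        ExteriorAlgebra.ι ℝ (Pi.single j (1 : ℝ)) := by
  funext y
  rw [ExteriorAlgebra.map_apply_ι]
  have : D.comp y (X y) = ∑ j, p.pair y (D.f j y) (X y) • Pi.single j (1 : ℝ) := by
    funext k
    simp [comp, Finset.sum_apply, Pi.single_apply]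
  rw [this, map_sum]
  simp only [map_smul]

theorem vdiffAt_of_mem {w : ∀ y, ExteriorAlgebra ℝ (A y)} (hw : w ∈ Multivector d F₁ A) :
    VDiffAt d (Pi.basisFun ℝ (Fin (Module.finrank ℝ F₁))).ExteriorAlgebra
      (fun y => ExteriorAlgebra.map (D.comp y) (w y)) x := by
  obtain ⟨v, hv, hwv⟩ := hw x
  suffices h : VDiffAt d (Pi.basisFun ℝ (Fin (Module.finrank ℝ F₁))).ExteriorAlgebra
      (fun y => ExteriorAlgebra.map (D.comp y) (v y)) x from
    h.congr (by filter_upwards [hwv] with y hy; rw [hy])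
  clear hwv
  induction hv using Algebra.adjoin_induction with
  | mem w hw =>
    rcases hw with ⟨f, rfl⟩ | ⟨X, rfl⟩
    · simp only [AlgHom.commutes]
      simp only [Algebra.algebraMap_eq_smul_one]
      exact VDiffAt.smul_const (f.mdiff x) _
    · rw [map_comp_ι]
      exact VDiffAt.sum fun j _ => VDiffAt.smul_const
        ((p.smooth _ _).mdifferentiableAt (by simp)) _
  | algebraMap r =>
    simp only [Pi.algebraMap_apply, AlgHom.commutes]
    simp only [Algebra.algebraMap_eq_smul_one]
    exact VDiffAt.smul_const mdifferentiableAt_const _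
  | add a b _ _ ha hb => simp only [Pi.add_apply, map_add]; exact ha.add hb
  | mul a b _ _ ha hb => simp only [Pi.mul_apply, map_mul]; exact ha.mul hb

theorem nabla_mul {w w' : ∀ y, ExteriorAlgebra ℝ (A y)} (hw : w ∈ Multivector d F₁ A)
    (hw' : w' ∈ Multivector d F₁ A) (v : TangentSpace (𝓡 d) x) :
    D.nabla v (w * w') = D.nabla v w * w' x + w x * D.nabla v w' := by
  simp only [nabla, Pi.mul_apply, map_mul]
  rw [vdiff_mul (D.vdiffAt_of_mem hw) (D.vdiffAt_of_mem hw')]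
  simp only [map_add, map_mul, ofComp_comp]

theorem nabla_add {w w' : ∀ y, ExteriorAlgebra ℝ (A y)} (hw : w ∈ Multivector d F₁ A)
    (hw' : w' ∈ Multivector d F₁ A) (v : TangentSpace (𝓡 d) x) :
    D.nabla v (w + w') = D.nabla v w + D.nabla v w' := by
  simp only [nabla, Pi.add_apply, map_add]
  rw [vdiff_add (D.vdiffAt_of_mem hw) (D.vdiffAt_of_mem hw'), map_add]

theorem nabla_congr {w w' : ∀ y, ExteriorAlgebra ℝ (A y)} (h : ∀ᶠ y in 𝓝 x, w y = w' y)
    (v : TangentSpace (𝓡 d) x) : D.nabla v w = D.nabla v w' := by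
  simp only [nabla]
  rw [vdiff_congr]
  filter_upwards [h] with y hy
  rw [hy]

theorem nabla_fun (f : SmoothFun d P) (v : TangentSpace (𝓡 d) x) :
    D.nabla v (fun y => algebraMap ℝ (ExteriorAlgebra ℝ (A y)) (f y)) =
      algebraMap ℝ _ (diff f x v) := by
  simp only [nabla, AlgHom.commutes]
  simp only [Algebra.algebraMap_eq_smul_one]
  rw [vdiff_smul_const (f.mdiff x), map_smul, map_one]

theorem nabla_sec (X : Sec d F₁ A) (v : TangentSpace (𝓡 d) x) :
    D.nabla v (fun y => ExteriorAlgebra.ι ℝ (X y)) =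
      ExteriorAlgebra.ι ℝ (∑ j, diff (fun y => p.pair y (D.f j y) (X y)) x v • D.e j x) := by
  have h : ∀ j, MDifferentiableAt (𝓡 d) 𝓘(ℝ, ℝ) (fun y => p.pair y (D.f j y) (X y)) x := fun j =>
    (p.smooth _ _).mdifferentiableAt (by simp)
  rw [nabla, map_comp_ι, vdiff_sum fun j _ => VDiffAt.smul_const (h j) _, map_sum, map_sum]
  refine Finset.sum_congr rfl fun j _ => ?_
  rw [vdiff_smul_const (h j), map_smul, map_smul, ExteriorAlgebra.map_apply_ι]
  simp [ofComp, Fintype.linearCombination_apply_single]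

theorem nabla_mem {w : ∀ y, ExteriorAlgebra ℝ (A y)} (hw : w ∈ Multivector d F₁ A) {k : ℕ}
    (hk : ∀ y, w y ∈ ⋀[ℝ]^k (A y)) (v : TangentSpace (𝓡 d) x) : D.nabla v w ∈ ⋀[ℝ]^k (A x) :=
  map_mem_exteriorPower _ (vdiff_mem (D.vdiffAt_of_mem hw) _
    (fun y => map_mem_exteriorPower _ (hk y)) v)

theorem nabla_hasParity {w : ∀ y, ExteriorAlgebra ℝ (A y)} (hw : w ∈ Multivector d F₁ A) {n : ℕ}
    (hn : ∀ y, HasParity n (w y)) (v : TangentSpace (𝓡 d) x) : HasParity n (D.nabla v w) :=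
  HasParity.map _ (vdiff_mem (D.vdiffAt_of_mem hw) (paritySubmodule _ n)
    (fun y => HasParity.map (D.comp y) (hn y)) v)

theorem nabla_add_left {w : ∀ y, ExteriorAlgebra ℝ (A y)} (v v' : TangentSpace (𝓡 d) x) :
    D.nabla (v + v') w = D.nabla v w + D.nabla v' w := by
  simp only [nabla, vdiff, map_add, add_smul, Finset.sum_add_distrib]

theorem nabla_smul {w : ∀ y, ExteriorAlgebra ℝ (A y)} (hw : w ∈ Multivector d F₁ A) (c : ℝ)
    (v : TangentSpace (𝓡 d) x) : D.nabla v (c • w) = c • D.nabla v w := by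
  let c' : SmoothFun d P := ⟨fun _ => c, contMDiff_const⟩
  have h : c • w = (fun y => algebraMap ℝ (ExteriorAlgebra ℝ (A y)) (c' y)) * w := by
    funext y
    exact Algebra.smul_def c (w y)
  rw [h, nabla_mul D (mem_multivector_of_generator (Or.inl ⟨_, rfl⟩)) hw, nabla_fun]
  have : diff c' x v = 0 := diff_const c x v
  rw [this, map_zero, zero_mul, zero_add, Algebra.smul_def]
  rfl

theorem nabla_smul_left {w : ∀ y, ExteriorAlgebra ℝ (A y)} (c : ℝ) (v : TangentSpace (𝓡 d) x) :
    D.nabla (c • v) w = c • D.nabla v w := by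
  simp only [nabla, vdiff, map_smul, smul_eq_mul, mul_smul, ← Finset.smul_sum]

end DualFrame

end Nabla

/-! ### Locality and tensoriality -/

section Tensorial

variable {d : ℕ} {P : Type*} [TopologicalSpace P] [T2Space P]
  [ChartedSpace (EuclideanSpace ℝ (Fin d)) P] [IsManifold (𝓡 d) ∞ P]
  {F₁ : Type*} [NormedAddCommGroup F₁] [NormedSpace ℝ F₁]
  {A : P → Type*} [TopologicalSpace (TotalSpace F₁ A)]
  [∀ x, AddCommGroup (A x)] [∀ x, Module ℝ (A x)]
  [∀ x, TopologicalSpace (A x)] [FiberBundle F₁ A] [VectorBundle ℝ F₁ A]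
  {F₂ : Type*} [NormedAddCommGroup F₂] [NormedSpace ℝ F₂]
  {B : P → Type*} [TopologicalSpace (TotalSpace F₂ B)]
  [∀ x, AddCommGroup (B x)] [∀ x, Module ℝ (B x)]
  [∀ x, TopologicalSpace (B x)] [FiberBundle F₂ B] [VectorBundle ℝ F₂ B]

variable (d F₁ A) in
/-- Evaluation of sections at a point. -/
def evalSec (x : P) : Sec d F₁ A →ₗ[ℝ] A x where
  toFun X := X x
  map_add' _ _ := rfl
  map_smul' _ _ := rfl

theorem sec_sum_apply {J : Type*} (s : Finset J) (X : J → Sec d F₁ A) (x : P) :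
    (∑ j ∈ s, X j) x = ∑ j ∈ s, X j x :=
  map_sum (evalSec d F₁ A x) X s

@[simp] theorem smulSec_apply (f : SmoothFun d P) (X : Sec d F₁ A) (x : P) :
    smulSec f X x = f x • X x := rfl

/-- An additive functional on sections that is unchanged by multiplication with functions equal to
`1` near `x` depends on the germ at `x` only. -/
theorem tensorial_congr {G : Type*} [AddCommGroup G] [Module ℝ G] {x : P} (T : Sec d F₁ A → G)
    (hadd : ∀ X Y, T (X + Y) = T X + T Y)
    (hsmul : ∀ (χ : SmoothFun d P) X, (∀ᶠ y in 𝓝 x, χ y = 1) → T (smulSec χ X) = T X)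
    {X Y : Sec d F₁ A} (h : ∀ᶠ y in 𝓝 x, X y = Y y) : T X = T Y := by
  obtain ⟨χ, hχ, hsupp⟩ := exists_bump (d := d) x (s := {y | X y = Y y}) h
  have h0 : T 0 = 0 := by simpa using hadd 0 0
  have h1 : smulSec χ (X - Y) = 0 := by
    ext y
    change χ y • (X y - Y y) = 0
    by_cases hy : y ∈ tsupport χ
    · rw [show X y = Y y from hsupp hy, sub_self, smul_zero]
    · rw [image_eq_zero_of_notMem_tsupport hy, zero_smul]
  have h2 : T (X - Y) = 0 := by rw [← hsmul χ _ hχ, h1, h0]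
  have h3 := hadd (X - Y) Y
  rwa [sub_add_cancel, h2, zero_add] at h3

variable (LA : LieAlgebroid d F₁ A)

theorem LieAlgebroid.bracket_congr (X : Sec d F₁ A) {Y Y' : Sec d F₁ A} {x : P}
    (h : ∀ᶠ y in 𝓝 x, Y y = Y' y) : LA.bracket X Y x = LA.bracket X Y' x := by
  refine tensorial_congr (fun Z => LA.bracket X Z x) (fun Z W => ?_) (fun χ Z hχ => ?_) h
  · rw [map_add]; rfl
  · rw [LA.leibniz, diff_congr (g := fun _ => 1) hχ, diff_const, hχ.self_of_nhds]
    simp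

theorem LieAlgebroid.bracket_skew_apply (X Y : Sec d F₁ A) (x : P) :
    LA.bracket X Y x = -LA.bracket Y X x := by
  rw [LA.bracket_skew]; rfl

theorem LieAlgebroid.bracket_congr_left {X X' : Sec d F₁ A} (Y : Sec d F₁ A) {x : P}
    (h : ∀ᶠ y in 𝓝 x, X y = X' y) : LA.bracket X Y x = LA.bracket X' Y x := by
  rw [LA.bracket_skew_apply, LA.bracket_congr Y h, ← LA.bracket_skew_apply]

theorem LieAlgebroid.leibniz_left (f : SmoothFun d P) (X Y : Sec d F₁ A) (x : P) :
    LA.bracket (smulSec f X) Y x =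
      f x • LA.bracket X Y x - diff f x (LA.anchor.map x (Y x)) • X x := by
  rw [LA.bracket_skew_apply, LA.leibniz, LA.bracket_skew_apply Y X, smul_neg]
  abel

variable (p : DualPairing d F₁ A F₂ B)

/-- The function `⟨ξ, X⟩`. -/
def DualPairing.fn (ξ : Sec d F₂ B) (X : Sec d F₁ A) : SmoothFun d P :=
  ⟨fun y => p.pair y (ξ y) (X y), p.smooth ξ X⟩

theorem DualPairing.fn_apply (ξ : Sec d F₂ B) (X : Sec d F₁ A) (x : P) :
    p.fn ξ X x = p.pair x (ξ x) (X x) := rfl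

theorem DualPairing.fn_eq (ξ : Sec d F₂ B) (X : Sec d F₁ A) :
    (fun y => p.pair y (ξ y) (X y)) = p.fn ξ X := rfl

/-- The function `a(X) f`. -/
def LieAlgebroid.act (X : Sec d F₁ A) (f : SmoothFun d P) : SmoothFun d P :=
  ⟨fun y => diff f y (LA.anchor.map y (X y)), contMDiff_diff f.contMDiff (LA.anchor.smooth X)⟩

theorem LieAlgebroid.act_apply (X : Sec d F₁ A) (f : SmoothFun d P) (x : P) :
    LA.act X f x = diff f x (LA.anchor.map x (X x)) := rfl

variable (LB : LieAlgebroid d F₂ B)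

/-- The value of the bivector field `d_* X` on two sections of `B = A^*`:
`(d_* X)(ξ, η) = a_*(ξ)⟨η, X⟩ - a_*(η)⟨ξ, X⟩ - ⟨[ξ, η], X⟩`.  It is tensorial in `ξ`
and `η`, but a derivation in `X`. -/
def dform (X : Sec d F₁ A) (ξ η : Sec d F₂ B) : SmoothFun d P :=
  LB.act ξ (p.fn η X) - LB.act η (p.fn ξ X) - p.fn (LB.bracket ξ η) X

theorem dform_apply (X : Sec d F₁ A) (ξ η : Sec d F₂ B) (x : P) :
    dform p LB X ξ η x = diff (p.fn η X) x (LB.anchor.map x (ξ x))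
      - diff (p.fn ξ X) x (LB.anchor.map x (η x)) - p.pair x (LB.bracket ξ η x) (X x) := rfl

theorem dform_antisymm (X : Sec d F₁ A) (ξ η : Sec d F₂ B) (x : P) :
    dform p LB X ξ η x = -dform p LB X η ξ x := by
  rw [dform_apply, dform_apply, LB.bracket_skew_apply, map_neg, LinearMap.neg_apply]
  ring

theorem diff_fn_add_right (ξ : Sec d F₂ B) (X Y : Sec d F₁ A) (x : P) (v : TangentSpace (𝓡 d) x) :
    diff (p.fn ξ (X + Y)) x v = diff (p.fn ξ X) x v + diff (p.fn ξ Y) x v := by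
  rw [← diff_add (SmoothFun.mdiff _ x) (SmoothFun.mdiff _ x)]
  refine diff_congr (Eventually.of_forall fun y => ?_) v
  change p.pair y (ξ y) (X y + Y y) = p.pair y (ξ y) (X y) + p.pair y (ξ y) (Y y)
  exact map_add _ _ _

theorem diff_fn_add_left (ξ η : Sec d F₂ B) (X : Sec d F₁ A) (x : P) (v : TangentSpace (𝓡 d) x) :
    diff (p.fn (ξ + η) X) x v = diff (p.fn ξ X) x v + diff (p.fn η X) x v :=
  diff_fn_add_right p.flip X ξ η x v

theorem diff_fn_smul_right (f : SmoothFun d P) (ξ : Sec d F₂ B) (X : Sec d F₁ A) (x : P)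
    (v : TangentSpace (𝓡 d) x) :
    diff (p.fn ξ (smulSec f X)) x v =
      f x * diff (p.fn ξ X) x v + diff f x v * p.pair x (ξ x) (X x) := by
  rw [mul_comm (diff f x v), ← p.fn_apply, ← diff_mul (SmoothFun.mdiff f x) (SmoothFun.mdiff _ x)]
  refine diff_congr (Eventually.of_forall fun y => ?_) v
  change p.pair y (ξ y) (f y • X y) = f y * p.pair y (ξ y) (X y)
  exact map_smul _ _ _

theorem diff_fn_smul_left (f : SmoothFun d P) (ξ : Sec d F₂ B) (X : Sec d F₁ A) (x : P)
    (v : TangentSpace (𝓡 d) x) :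
    diff (p.fn (smulSec f ξ) X) x v =
      f x * diff (p.fn ξ X) x v + diff f x v * p.pair x (ξ x) (X x) :=
  diff_fn_smul_right p.flip f X ξ x v

theorem dform_add_left (X : Sec d F₁ A) (ξ ξ' η : Sec d F₂ B) (x : P) :
    dform p LB X (ξ + ξ') η x = dform p LB X ξ η x + dform p LB X ξ' η x := by
  simp only [dform_apply, diff_fn_add_left, map_add, LinearMap.add_apply, ContMDiffSection.coe_add,
    Pi.add_apply]
  ring

theorem dform_smul_left (X : Sec d F₁ A) (f : SmoothFun d P) (ξ η : Sec d F₂ B) (x : P) :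
    dform p LB X (smulSec f ξ) η x = f x * dform p LB X ξ η x := by
  simp only [dform_apply, diff_fn_smul_left, LB.leibniz_left, map_sub, map_smul, smulSec_apply,
    LinearMap.sub_apply, LinearMap.smul_apply, smul_eq_mul]
  ring

theorem dform_add (X Y : Sec d F₁ A) (ξ η : Sec d F₂ B) (x : P) :
    dform p LB (X + Y) ξ η x = dform p LB X ξ η x + dform p LB Y ξ η x := by
  simp only [dform_apply, diff_fn_add_right, map_add, ContMDiffSection.coe_add, Pi.add_apply]
  ring

theorem dform_smul (X : Sec d F₁ A) (f : SmoothFun d P) (ξ η : Sec d F₂ B) (x : P) :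
    dform p LB (smulSec f X) ξ η x = f x * dform p LB X ξ η x
      + diff f x (LB.anchor.map x (ξ x)) * p.pair x (η x) (X x)
      - diff f x (LB.anchor.map x (η x)) * p.pair x (ξ x) (X x) := by
  simp only [dform_apply, diff_fn_smul_right, map_smul, smulSec_apply, smul_eq_mul]
  ring

theorem dform_congr {X Y : Sec d F₁ A} {x : P} (h : ∀ᶠ y in 𝓝 x, X y = Y y)
    (ξ η : Sec d F₂ B) : dform p LB X ξ η x = dform p LB Y ξ η x := by
  have h1 : ∀ (ζ : Sec d F₂ B) (v : TangentSpace (𝓡 d) x),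
      diff (p.fn ζ X) x v = diff (p.fn ζ Y) x v := fun ζ v =>
    diff_congr (by filter_upwards [h] with y hy; rw [p.fn_apply, p.fn_apply, hy]) v
  rw [dform_apply, dform_apply, h.self_of_nhds, h1, h1]

variable {p} [FiniteDimensional ℝ F₁] [FiniteDimensional ℝ F₂]
  [ContMDiffVectorBundle ∞ F₁ A (𝓡 d)] [ContMDiffVectorBundle ∞ F₂ B (𝓡 d)]

namespace DualFrame

variable {x : P} (D : DualFrame p x)

theorem eventually_sum_eq (X : Sec d F₁ A) :
    ∀ᶠ y in 𝓝 x, (∑ j, smulSec (p.fn (D.f j) X) (D.e j)) y = X y := by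
  filter_upwards [D.expand] with y hy
  rw [sec_sum_apply]
  exact hy (X y)

theorem sum_eq (v : A x) : ∑ j, p.pair x (D.f j x) v • D.e j x = v := D.expand.self_of_nhds v

theorem pair_sum_eq (w : B x) (v : A x) :
    ∑ j, p.pair x w (D.e j x) * p.pair x (D.f j x) v = p.pair x w v := by
  conv_rhs => rw [← D.sum_eq v, map_sum]
  exact Finset.sum_congr rfl fun j _ => by rw [map_smul, smul_eq_mul, mul_comm]

theorem eventually_sum_dual_eq (ξ : Sec d F₂ B) :
    ∀ᶠ y in 𝓝 x, (∑ j, smulSec (p.fn ξ (D.e j)) (D.f j)) y = ξ y := by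
  filter_upwards [D.expand] with y hy
  rw [sec_sum_apply]
  refine p.flip.pair_ext fun v => ?_
  change p.pair y (∑ j, p.pair y (ξ y) (D.e j y) • D.f j y) v = p.pair y (ξ y) v
  conv_rhs => rw [← hy v]
  simp only [map_sum, map_smul, LinearMap.sum_apply, LinearMap.smul_apply, smul_eq_mul]
  exact Finset.sum_congr rfl fun j _ => mul_comm _ _

/-- Near its base point a dual frame is a dual frame at every point. -/
theorem eventually_shift :
    ∀ᶠ y in 𝓝 x, ∃ D' : DualFrame p y, D'.e = D.e ∧ D'.f = D.f := by
  filter_upwards [eventually_eventually_nhds.2 D.pair_eq, eventually_eventually_nhds.2 D.expand]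
    with y h1 h2
  exact ⟨⟨D.e, D.f, h1, h2⟩, rfl, rfl⟩

/-- A tensorial functional on sections is determined by its values on a frame. -/
theorem tensorial_dual (T : Sec d F₂ B → ℝ) (hadd : ∀ ξ η, T (ξ + η) = T ξ + T η)
    (hsmul : ∀ (f : SmoothFun d P) ξ, T (smulSec f ξ) = f x * T ξ) (ξ : Sec d F₂ B) :
    T ξ = ∑ j, p.pair x (ξ x) (D.e j x) * T (D.f j) := by
  rw [← tensorial_congr T hadd (fun χ Z hχ => by rw [hsmul, hχ.self_of_nhds, one_mul])
    (D.eventually_sum_dual_eq ξ)]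
  have h := map_sum (AddMonoidHom.mk' T hadd) (fun j => smulSec (p.fn ξ (D.e j)) (D.f j))
    Finset.univ
  refine h.trans (Finset.sum_congr rfl fun j _ => ?_)
  exact hsmul _ _

theorem dform_eq_sum (X : Sec d F₁ A) (ξ η : Sec d F₂ B) :
    dform p LB X ξ η x = ∑ i, ∑ j, dform p LB X (D.f i) (D.f j) x *
      (p.pair x (ξ x) (D.e i x) * p.pair x (η x) (D.e j x)) := by
  rw [D.tensorial_dual (fun ξ => dform p LB X ξ η x) (fun ξ ξ' => dform_add_left p LB X ξ ξ' η x)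
    (fun f ξ => dform_smul_left p LB X f ξ η x) ξ]
  refine Finset.sum_congr rfl fun i _ => ?_
  have h := D.tensorial_dual (fun η => dform p LB X η (D.f i) x)
    (fun ξ ξ' => dform_add_left p LB X ξ ξ' _ x) (fun f ξ => dform_smul_left p LB X f ξ _ x) η
  rw [dform_antisymm, h, ← Finset.sum_neg_distrib, Finset.mul_sum]
  refine Finset.sum_congr rfl fun j _ => ?_
  rw [dform_antisymm p LB X (D.f j)]
  ring

theorem exists_sec_eq (D : DualFrame p x) (w : B x) : ∃ ξ : Sec d F₂ B, ξ x = w := by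
  refine ⟨∑ j, p.pair x w (D.e j x) • D.f j, ?_⟩
  rw [sec_sum_apply]
  refine p.flip.pair_ext fun v => ?_
  change p.pair x (∑ j, p.pair x w (D.e j x) • D.f j x) v = p.pair x w v
  rw [← D.pair_sum_eq w v]
  simp only [map_sum, map_smul, LinearMap.sum_apply, LinearMap.smul_apply, smul_eq_mul]

/-- Elements of positive degree are determined by their contractions with the dual frame. -/
theorem ext_of_contract {k : ℕ} {w w' : ExteriorAlgebra ℝ (A x)} (hw : w ∈ ⋀[ℝ]^(k + 1) (A x))
    (hw' : w' ∈ ⋀[ℝ]^(k + 1) (A x))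
    (h : ∀ j, contract (p.pair x (D.f j x)) w = contract (p.pair x (D.f j x)) w') : w = w' :=
  eq_of_contract_eq (fun j => D.e j x) (fun j => p.pair x (D.f j x)) D.sum_eq hw hw' h

theorem ext_of_contract_contract (D : DualFrame p x) {w w' : ExteriorAlgebra ℝ (A x)}
    (hw : w ∈ ⋀[ℝ]^2 (A x)) (hw' : w' ∈ ⋀[ℝ]^2 (A x))
    (h : ∀ ξ η : Sec d F₂ B, contract (p.pair x (η x)) (contract (p.pair x (ξ x)) w) =
      contract (p.pair x (η x)) (contract (p.pair x (ξ x)) w')) : w = w' :=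
  D.ext_of_contract hw hw' fun _ =>
    D.ext_of_contract (contract_mem _ hw) (contract_mem _ hw') fun _ => h _ _

end DualFrame

end Tensorial

/-! ### The differential of a Lie algebroid on `B = A^*` -/

section Differential

variable {d : ℕ} {P : Type*} [TopologicalSpace P] [T2Space P]
  [ChartedSpace (EuclideanSpace ℝ (Fin d)) P] [IsManifold (𝓡 d) ∞ P]
  {F₁ : Type*} [NormedAddCommGroup F₁] [NormedSpace ℝ F₁]
  {A : P → Type*} [TopologicalSpace (TotalSpace F₁ A)]
  [∀ x, AddCommGroup (A x)] [∀ x, Module ℝ (A x)]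
  [∀ x, TopologicalSpace (A x)] [FiberBundle F₁ A] [VectorBundle ℝ F₁ A]
  {F₂ : Type*} [NormedAddCommGroup F₂] [NormedSpace ℝ F₂]
  {B : P → Type*} [TopologicalSpace (TotalSpace F₂ B)]
  [∀ x, AddCommGroup (B x)] [∀ x, Module ℝ (B x)]
  [∀ x, TopologicalSpace (B x)] [FiberBundle F₂ B] [VectorBundle ℝ F₂ B]
  [FiniteDimensional ℝ F₁] [FiniteDimensional ℝ F₂]
  [ContMDiffVectorBundle ∞ F₁ A (𝓡 d)] [ContMDiffVectorBundle ∞ F₂ B (𝓡 d)]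
  {p : DualPairing d F₁ A F₂ B}

theorem contract_ι_mul_ι {V : Type*} [AddCommGroup V] [Module ℝ V] (φ ψ : V →ₗ[ℝ] ℝ) (v w : V) :
    contract ψ (contract φ (ExteriorAlgebra.ι ℝ v * ExteriorAlgebra.ι ℝ w)) =
      algebraMap ℝ _ (φ v * ψ w - φ w * ψ v) := by
  rw [contract_ι_mul, contract_ι, map_sub, map_smul, contract_ι, ← Algebra.commutes,
    ← Algebra.smul_def, map_smul, contract_ι, map_sub, map_mul, map_mul, Algebra.smul_def,
    Algebra.smul_def]

theorem ι_mul_ι_anticomm {V : Type*} [AddCommGroup V] [Module ℝ V] (v w : V) :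
    ExteriorAlgebra.ι ℝ v * ExteriorAlgebra.ι ℝ w =
      -(ExteriorAlgebra.ι ℝ w * ExteriorAlgebra.ι ℝ v) := by
  rw [ι_mul_eq, invol_ι, neg_mul]

namespace DualFrame

section

variable {x : P} (D : DualFrame p x)

/-- The bivector `½ ∑ c i j e_i ∧ e_j`.  Only the skew part of `c` matters; if `c` is skew, then
`c i j` is the value of the bivector on `f_i, f_j`. -/
def bivector (c : Fin (Module.finrank ℝ F₁) → Fin (Module.finrank ℝ F₁) → ℝ) :
    ExteriorAlgebra ℝ (A x) :=
  (1 / 2 : ℝ) • ∑ i, ∑ j, c i j •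
    (ExteriorAlgebra.ι ℝ (D.e i x) * ExteriorAlgebra.ι ℝ (D.e j x))

variable (c : Fin (Module.finrank ℝ F₁) → Fin (Module.finrank ℝ F₁) → ℝ)

theorem bivector_mem : D.bivector c ∈ ⋀[ℝ]^2 (A x) :=
  Submodule.smul_mem _ _ <| sum_mem fun _ _ => sum_mem fun _ _ => Submodule.smul_mem _ _ <|
    mul_mem_exteriorPower (ι_mem_one _) (ι_mem_one _)

theorem bivector_mul_comm (y : ExteriorAlgebra ℝ (A x)) : D.bivector c * y = y * D.bivector c := by
  simp only [bivector, smul_mul_assoc, mul_smul_comm, Finset.sum_mul, Finset.mul_sum]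
  refine congrArg _ (Finset.sum_congr rfl fun i _ => Finset.sum_congr rfl fun j _ => ?_)
  rw [mul_assoc, ι_mul_eq (D.e j x) y, ← mul_assoc, ι_mul_eq (D.e i x) (invol y), invol_invol,
    mul_assoc]

theorem contract_contract_bivector (hc : ∀ i j, c i j = -c j i) (ξ η : B x) :
    contract (p.pair x η) (contract (p.pair x ξ) (D.bivector c)) =
      algebraMap ℝ _ (∑ i, ∑ j, c i j * (p.pair x ξ (D.e i x) * p.pair x η (D.e j x))) := by
  simp only [bivector, map_smul, map_sum, contract_ι_mul_ι]
  simp only [Algebra.smul_def, ← map_mul, ← map_sum]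
  congr 1
  simp only [mul_sub, Finset.sum_sub_distrib]
  have h : ∑ i, ∑ j, c i j * (p.pair x ξ (D.e j x) * p.pair x η (D.e i x)) =
      -∑ i, ∑ j, c i j * (p.pair x ξ (D.e i x) * p.pair x η (D.e j x)) := by
    rw [Finset.sum_comm, ← Finset.sum_neg_distrib]
    refine Finset.sum_congr rfl fun i _ => ?_
    rw [← Finset.sum_neg_distrib]
    refine Finset.sum_congr rfl fun j _ => ?_
    rw [hc, neg_mul]
  rw [h]
  ring

theorem sum_ι_mul_ι (m : Fin (Module.finrank ℝ F₁) → Fin (Module.finrank ℝ F₁) → ℝ) :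
    ∑ i, ∑ j, m i j • (ExteriorAlgebra.ι ℝ (D.e i x) * ExteriorAlgebra.ι ℝ (D.e j x)) =
      D.bivector fun i j => m i j - m j i := by
  have h : ∑ i, ∑ j, m j i • (ExteriorAlgebra.ι ℝ (D.e i x) * ExteriorAlgebra.ι ℝ (D.e j x)) =
      -∑ i, ∑ j, m i j • (ExteriorAlgebra.ι ℝ (D.e i x) * ExteriorAlgebra.ι ℝ (D.e j x)) := by
    rw [Finset.sum_comm, ← Finset.sum_neg_distrib]
    refine Finset.sum_congr rfl fun i _ => ?_
    rw [← Finset.sum_neg_distrib]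
    refine Finset.sum_congr rfl fun j _ => ?_
    rw [ι_mul_ι_anticomm, smul_neg]
  simp only [bivector, sub_smul, Finset.sum_sub_distrib, h]
  module

theorem bivector_add (c' : Fin (Module.finrank ℝ F₁) → Fin (Module.finrank ℝ F₁) → ℝ) :
    D.bivector (fun i j => c i j + c' i j) = D.bivector c + D.bivector c' := by
  simp only [bivector, add_smul, Finset.sum_add_distrib, smul_add]

theorem bivector_sum {J : Type*} (s : Finset J) (r : J → ℝ)
    (c : J → Fin (Module.finrank ℝ F₁) → Fin (Module.finrank ℝ F₁) → ℝ) :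
    ∑ k ∈ s, r k • D.bivector (c k) = D.bivector fun i j => ∑ k ∈ s, r k * c k i j := by
  simp only [bivector, Finset.sum_smul, Finset.smul_sum, smul_smul]
  rw [Finset.sum_comm]
  refine Finset.sum_congr rfl fun i _ => ?_
  rw [Finset.sum_comm]
  refine Finset.sum_congr rfl fun j _ => Finset.sum_congr rfl fun k _ => ?_
  congr 1
  ring

variable (LB : LieAlgebroid d F₂ B)

/-- The differential `d_*` at the base point of a dual frame:
`d_* w = ∑ e_i ∧ ∇_{a_* f_i} w + ∑ d_* e_k ∧ i_{f_k} w`, where `∇` is the connection for which the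
frame is parallel. -/
def delta (w : ∀ y, ExteriorAlgebra ℝ (A y)) : ExteriorAlgebra ℝ (A x) :=
  ∑ i, ExteriorAlgebra.ι ℝ (D.e i x) * D.nabla (LB.anchor.map x (D.f i x)) w +
    ∑ k, D.bivector (fun i j => dform p LB (D.e k) (D.f i) (D.f j) x) *
      contract (p.pair x (D.f k x)) (w x)

variable {w w' : ∀ y, ExteriorAlgebra ℝ (A y)}

theorem delta_mul (hw : w ∈ Multivector d F₁ A) (hw' : w' ∈ Multivector d F₁ A) :
    D.delta LB (w * w') = D.delta LB w * w' x + invol (w x) * D.delta LB w' := by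
  have h1 : ∀ k, D.bivector (fun i j => dform p LB (D.e k) (D.f i) (D.f j) x) *
      contract (p.pair x (D.f k x)) ((w * w') x) =
      D.bivector (fun i j => dform p LB (D.e k) (D.f i) (D.f j) x) *
        contract (p.pair x (D.f k x)) (w x) * w' x +
      invol (w x) * (D.bivector (fun i j => dform p LB (D.e k) (D.f i) (D.f j) x) *
        contract (p.pair x (D.f k x)) (w' x)) := by
    intro k
    rw [Pi.mul_apply, contract_mul, mul_add, ← mul_assoc, ← mul_assoc, ← mul_assoc,
      D.bivector_mul_comm _ (invol (w x))]
  have h2 : ∀ i, ExteriorAlgebra.ι ℝ (D.e i x) *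
      D.nabla (LB.anchor.map x (D.f i x)) (w * w') =
      ExteriorAlgebra.ι ℝ (D.e i x) * D.nabla (LB.anchor.map x (D.f i x)) w * w' x +
      invol (w x) * (ExteriorAlgebra.ι ℝ (D.e i x) *
        D.nabla (LB.anchor.map x (D.f i x)) w') := by
    intro i
    rw [D.nabla_mul hw hw', mul_add, ← mul_assoc, ← mul_assoc, ← mul_assoc, ι_mul_eq _ (w x)]
  simp only [delta, h1, h2, Finset.sum_add_distrib, add_mul, mul_add, Finset.sum_mul,
    Finset.mul_sum]
  abel

theorem delta_add (hw : w ∈ Multivector d F₁ A) (hw' : w' ∈ Multivector d F₁ A) :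
    D.delta LB (w + w') = D.delta LB w + D.delta LB w' := by
  simp only [delta, D.nabla_add hw hw', Pi.add_apply, map_add, mul_add, Finset.sum_add_distrib]
  abel

theorem delta_smul (hw : w ∈ Multivector d F₁ A) (r : ℝ) :
    D.delta LB (r • w) = r • D.delta LB w := by
  simp only [delta, D.nabla_smul hw, Pi.smul_apply, map_smul, mul_smul_comm, smul_add,
    Finset.smul_sum]

theorem delta_congr (h : ∀ᶠ y in 𝓝 x, w y = w' y) : D.delta LB w = D.delta LB w' := by
  simp only [delta, D.nabla_congr h, h.self_of_nhds]

theorem delta_mem (hw : w ∈ Multivector d F₁ A) {k : ℕ} (hk : ∀ y, w y ∈ ⋀[ℝ]^k (A y)) :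
    D.delta LB w ∈ ⋀[ℝ]^(k + 1) (A x) := by
  refine add_mem (sum_mem fun i _ => ?_) (sum_mem fun i _ => ?_)
  · rw [add_comm]
    exact mul_mem_exteriorPower (ι_mem_one _) (D.nabla_mem hw hk _)
  · cases k with
    | zero => rw [contract_eq_zero_of_mem _ (hk x), mul_zero]; exact zero_mem _
    | succ k =>
      rw [show k + 1 + 1 = 2 + k by ring]
      exact mul_mem_exteriorPower (D.bivector_mem _) (contract_mem _ (hk x))

theorem contract_delta_fun (f : SmoothFun d P) (ξ : B x) :
    contract (p.pair x ξ) (D.delta LB fun y => algebraMap ℝ (ExteriorAlgebra ℝ (A y)) (f y)) =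
      algebraMap ℝ _ (diff f x (LB.anchor.map x ξ)) := by
  have h : LB.anchor.map x ξ = ∑ i, p.pair x ξ (D.e i x) • LB.anchor.map x (D.f i x) := by
    simp only [← map_smul, ← map_sum]
    refine congrArg _ (p.flip.pair_ext fun v => ?_)
    change p.pair x ξ v = p.pair x (∑ j, p.pair x ξ (D.e j x) • D.f j x) v
    rw [← D.pair_sum_eq ξ v]
    simp only [map_sum, map_smul, LinearMap.sum_apply, LinearMap.smul_apply, smul_eq_mul]
  simp only [delta, D.nabla_fun, contract_algebraMap, mul_zero, Finset.sum_const_zero, add_zero,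
    map_sum, contract_ι_mul, sub_zero]
  rw [h, map_sum, map_sum]
  refine Finset.sum_congr rfl fun i _ => ?_
  rw [map_smul, smul_eq_mul, map_mul, Algebra.smul_def]

/-- The formula for `d_*` uses `d_* e_k` for the sections of the frame only; on any section it gives
the expected bivector because both sides are the same derivation in `X`. -/
theorem delta_sec (X : Sec d F₁ A) :
    D.delta LB (fun y => ExteriorAlgebra.ι ℝ (X y)) =
      D.bivector fun i j => dform p LB X (D.f i) (D.f j) x := by
  have h1 : ∀ i j, dform p LB X (D.f i) (D.f j) x =
      (diff (p.fn (D.f j) X) x (LB.anchor.map x (D.f i x))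
        - diff (p.fn (D.f i) X) x (LB.anchor.map x (D.f j x))) +
      ∑ k, p.pair x (D.f k x) (X x) * dform p LB (D.e k) (D.f i) (D.f j) x := by
    intro i j
    have hadd : ∀ Y Z, dform p LB (Y + Z) (D.f i) (D.f j) x =
        dform p LB Y (D.f i) (D.f j) x + dform p LB Z (D.f i) (D.f j) x :=
      fun Y Z => dform_add p LB Y Z (D.f i) (D.f j) x
    rw [← dform_congr p LB (D.eventually_sum_eq X)]
    have h := map_sum (AddMonoidHom.mk' (fun Y => dform p LB Y (D.f i) (D.f j) x) hadd)
      (fun j => smulSec (p.fn (D.f j) X) (D.e j)) Finset.univ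
    refine h.trans ?_
    simp only [AddMonoidHom.mk'_apply, dform_smul, D.pair_eq.self_of_nhds, Finset.sum_add_distrib,
      Finset.sum_sub_distrib]
    simp only [mul_ite, mul_one, mul_zero, Finset.sum_ite_eq, Finset.mem_univ, if_true,
      p.fn_apply]
    ring
  simp only [delta, D.nabla_sec, contract_ι, map_sum, map_smul, Finset.mul_sum, mul_smul_comm]
  simp only [p.fn_eq, D.sum_ι_mul_ι, h1, D.bivector_add]
  congr 1
  rw [← D.bivector_sum]
  refine Finset.sum_congr rfl fun k _ => ?_
  rw [← Algebra.commutes, ← Algebra.smul_def]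

theorem contract_contract_delta_sec (X : Sec d F₁ A) (ξ η : Sec d F₂ B) :
    contract (p.pair x (η x)) (contract (p.pair x (ξ x))
      (D.delta LB (fun y => ExteriorAlgebra.ι ℝ (X y)))) =
      algebraMap ℝ _ (dform p LB X ξ η x) := by
  rw [delta_sec, contract_contract_bivector _ _ (fun i j => dform_antisymm p LB X _ _ x),
    D.dform_eq_sum]

end

end DualFrame

variable (p) in
/-- A choice of a dual frame near each point.  The frames at different points are unrelated. -/
def dualFrame (x : P) : DualFrame p x := Classical.choice (exists_dualFrame p x)

theorem exists_isDifferential_flip (p : DualPairing d F₁ A F₂ B) (LB : LieAlgebroid d F₂ B)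
    (f : SmoothFun d P) : ∃ X : Sec d F₁ A, IsDifferential LB p.flip f X := by
  obtain ⟨X, hX⟩ := p.exists_sec (fun x => diff f x ∘ₗ LB.anchor.map x)
    (fun ξ => (LB.act ξ f).contMDiff)
  exact ⟨X, fun ξ x => hX x (ξ x)⟩

theorem delta_fun_eq (LB : LieAlgebroid d F₂ B) {f : SmoothFun d P} {X : Sec d F₁ A}
    (hX : IsDifferential LB p.flip f X) {x : P} (D : DualFrame p x) :
    D.delta LB (fun y => algebraMap ℝ (ExteriorAlgebra ℝ (A y)) (f y)) =
      ExteriorAlgebra.ι ℝ (X x) := by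
  refine D.ext_of_contract (k := 0) (D.delta_mem LB (mem_multivector_of_generator (Or.inl ⟨f, rfl⟩))
    fun y => algebraMap_mem_zero _) (ι_mem_one _) fun j => ?_
  rw [D.contract_delta_fun, contract_ι]
  exact congrArg _ (hX (D.f j) x).symm

theorem invol_mem_multivector {w : ∀ x, ExteriorAlgebra ℝ (A x)} (hw : w ∈ Multivector d F₁ A) :
    (fun x => invol (w x)) ∈ Multivector d F₁ A := by
  intro x₀
  obtain ⟨v, hv, h⟩ := hw x₀
  have key : (fun x => invol (v x)) ∈ Algebra.adjoin ℝ (multivectorGenerators d F₁ A) := by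
    clear h
    induction hv using Algebra.adjoin_induction with
    | mem v hv =>
      rcases hv with ⟨f, rfl⟩ | ⟨X, rfl⟩
      · simp only [AlgHom.commutes]
        exact Algebra.subset_adjoin (Or.inl ⟨f, rfl⟩)
      · simp only [invol_ι]
        exact (Algebra.adjoin ℝ _).neg_mem (Algebra.subset_adjoin (Or.inr ⟨X, rfl⟩))
    | algebraMap r =>
      simp only [Pi.algebraMap_apply, AlgHom.commutes]
      exact Subalgebra.algebraMap_mem _ r
    | add a b _ _ ha hb => simp only [Pi.add_apply, map_add]; exact add_mem ha hb
    | mul a b _ _ ha hb => simp only [Pi.mul_apply, map_mul]; exact mul_mem ha hb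
  exact ⟨_, key, h.mono fun x hx => congrArg _ hx⟩

/-- Membership in `Multivector` is local. -/
theorem mem_multivector_of_locally {w : ∀ x, ExteriorAlgebra ℝ (A x)}
    (h : ∀ x₀, ∃ v ∈ Multivector d F₁ A, ∀ᶠ x in 𝓝 x₀, w x = v x) : w ∈ Multivector d F₁ A := by
  intro x₀
  obtain ⟨v, hv, hwv⟩ := h x₀
  obtain ⟨u, hu, hvu⟩ := hv x₀
  exact ⟨u, hu, by filter_upwards [hwv, hvu] with x h1 h2; rw [h1, h2]⟩

theorem adjoin_le_multivector :
    Algebra.adjoin ℝ (multivectorGenerators d F₁ A) ≤ Multivector d F₁ A :=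
  Algebra.adjoin_le fun _ h => mem_multivector_of_generator h

/-- Smoothness of `d_* X`.  The frame used varies discontinuously with the point, but the value does
not depend on it, being determined by its contractions; so it may be computed near `x₀` in a single
frame. -/
theorem delta_sec_mem (LB : LieAlgebroid d F₂ B) (X : Sec d F₁ A) :
    (fun x => (dualFrame p x).delta LB (fun y => ExteriorAlgebra.ι ℝ (X y))) ∈
      Multivector d F₁ A := by
  refine mem_multivector_of_locally fun x₀ => ?_
  let D := dualFrame p x₀
  refine ⟨(1 / 2 : ℝ) • ∑ i, ∑ j, (ofFun F₁ A (dform p LB X (D.f i) (D.f j))).1 *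
    ((ofSec (D.e i)).1 * (ofSec (D.e j)).1), ?_, ?_⟩
  · exact Subalgebra.smul_mem _ (sum_mem fun _ _ => sum_mem fun _ _ =>
      mul_mem (Subtype.property _) (mul_mem (Subtype.property _) (Subtype.property _))) _
  · filter_upwards [D.eventually_shift] with y ⟨D', he, hf⟩
    have hX : (fun y => ExteriorAlgebra.ι ℝ (X y)) ∈ Multivector d F₁ A :=
      mem_multivector_of_generator (Or.inr ⟨X, rfl⟩)
    have h1 : (dualFrame p y).delta LB (fun y => ExteriorAlgebra.ι ℝ (X y)) =
        D'.delta LB (fun y => ExteriorAlgebra.ι ℝ (X y)) :=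
      D'.ext_of_contract_contract (DualFrame.delta_mem _ LB hX fun y => ι_mem_one _)
        (DualFrame.delta_mem _ LB hX fun y => ι_mem_one _) fun ξ η => by
          rw [DualFrame.contract_contract_delta_sec, DualFrame.contract_contract_delta_sec]
    rw [h1, D'.delta_sec, DualFrame.bivector, he, hf]
    simp only [Pi.smul_apply, Finset.sum_apply, Pi.mul_apply]
    refine congrArg _ (Finset.sum_congr rfl fun i _ => Finset.sum_congr rfl fun j _ => ?_)
    rw [Algebra.smul_def]
    rfl

/-- Smoothness of `d_* w`: it holds for functions and sections, and is inherited by products and sums. -/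
theorem delta_mem_multivector (LB : LieAlgebroid d F₂ B) {w : ∀ x, ExteriorAlgebra ℝ (A x)}
    (hw : w ∈ Multivector d F₁ A) :
    (fun x => (dualFrame p x).delta LB w) ∈ Multivector d F₁ A := by
  refine mem_multivector_of_locally fun x₀ => ?_
  obtain ⟨v, hv, hwv⟩ := hw x₀
  refine ⟨fun x => (dualFrame p x).delta LB v, ?_, ?_⟩
  · clear hwv
    induction hv using Algebra.adjoin_induction with
    | mem v hv =>
      rcases hv with ⟨f, rfl⟩ | ⟨X, rfl⟩
      · obtain ⟨X, hX⟩ := exists_isDifferential_flip p LB f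
        simp only [delta_fun_eq LB hX]
        exact mem_multivector_of_generator (Or.inr ⟨X, rfl⟩)
      · exact delta_sec_mem LB X
    | algebraMap r =>
      let f : SmoothFun d P := ⟨fun _ => r, contMDiff_const⟩
      obtain ⟨X, hX⟩ := exists_isDifferential_flip p LB f
      have h : (fun x => (dualFrame p x).delta LB
          (algebraMap ℝ (∀ x, ExteriorAlgebra ℝ (A x)) r)) = fun x => ExteriorAlgebra.ι ℝ (X x) :=
        funext fun x => delta_fun_eq LB hX (dualFrame p x)
      rw [h]
      exact mem_multivector_of_generator (Or.inr ⟨X, rfl⟩)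
    | add a b ha hb iha ihb =>
      have h : (fun x => (dualFrame p x).delta LB (a + b)) =
          (fun x => (dualFrame p x).delta LB a) + fun x => (dualFrame p x).delta LB b :=
        funext fun x => DualFrame.delta_add _ LB (adjoin_le_multivector ha)
          (adjoin_le_multivector hb)
      rw [h]
      exact add_mem iha ihb
    | mul a b ha hb iha ihb =>
      have h : (fun x => (dualFrame p x).delta LB (a * b)) =
          (fun x => (dualFrame p x).delta LB a) * b +
            (fun x => invol (a x)) * fun x => (dualFrame p x).delta LB b :=
        funext fun x => DualFrame.delta_mul _ LB (adjoin_le_multivector ha)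
          (adjoin_le_multivector hb)
      rw [h]
      exact add_mem (mul_mem iha (adjoin_le_multivector hb))
        (mul_mem (invol_mem_multivector (adjoin_le_multivector ha)) ihb)
  · filter_upwards [eventually_eventually_nhds.2 hwv] with y hy
    exact DualFrame.delta_congr _ LB hy

variable (p) in
/-- The differential `d_*` on multivector fields, computed at each point in the dual frame chosen
there. -/
def differential (LB : LieAlgebroid d F₂ B) : Multivector d F₁ A →ₗ[ℝ] Multivector d F₁ A where
  toFun w := ⟨fun x => (dualFrame p x).delta LB w.1, delta_mem_multivector LB w.2⟩
  map_add' w w' := Subtype.ext <| funext fun _ => DualFrame.delta_add _ LB w.2 w'.2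
  map_smul' r w := Subtype.ext <| funext fun _ => DualFrame.delta_smul _ LB w.2 r

/-- The parity automorphism of the algebra of multivector fields. -/
def mvInvol (w : Multivector d F₁ A) : Multivector d F₁ A :=
  ⟨fun x => invol (w.1 x), invol_mem_multivector w.2⟩

theorem differential_mul (LB : LieAlgebroid d F₂ B) (w w' : Multivector d F₁ A) :
    differential p LB (w * w') = differential p LB w * w' + mvInvol w * differential p LB w' :=
  Subtype.ext <| funext fun _ => DualFrame.delta_mul _ LB w.2 w'.2

theorem differential_congr (LB : LieAlgebroid d F₂ B) {w w' : Multivector d F₁ A} {x : P}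
    (h : ∀ᶠ y in 𝓝 x, w.1 y = w'.1 y) : (differential p LB w).1 x = (differential p LB w').1 x :=
  DualFrame.delta_congr _ LB h

theorem differential_ofFun (LB : LieAlgebroid d F₂ B) {f : SmoothFun d P} {X : Sec d F₁ A}
    (hX : IsDifferential LB p.flip f X) : differential p LB (ofFun F₁ A f) = ofSec X :=
  Subtype.ext <| funext fun _ => delta_fun_eq LB hX _

theorem mvInvol_of_hasParity {n : ℕ} {w : Multivector d F₁ A} (h : ∀ x, HasParity n (w.1 x)) :
    mvInvol w = (-1 : ℝ) ^ n • w :=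
  Subtype.ext <| funext fun x => h x

variable (p) in
theorem isAlgebroidDifferential (LB : LieAlgebroid d F₂ B) :
    IsAlgebroidDifferential LB p (differential p LB) where
  degree _ w hw x := DualFrame.delta_mem _ LB w.2 hw
  on_functions f ξ x := DualFrame.contract_delta_fun _ LB f _
  on_sections X ξ η x := DualFrame.contract_contract_delta_sec _ LB X ξ η
  wedge k w v hw := by
    rw [differential_mul, mvInvol_of_hasParity fun x => hasParity_of_mem (hw x), smul_mul_assoc]

end Differential

/-! ### Products of functions and sections -/

section Schouten

variable {d : ℕ} {P : Type*} [TopologicalSpace P] [T2Space P]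
  [ChartedSpace (EuclideanSpace ℝ (Fin d)) P] [IsManifold (𝓡 d) ∞ P]
  {F₁ : Type*} [NormedAddCommGroup F₁] [NormedSpace ℝ F₁]
  {A : P → Type*} [TopologicalSpace (TotalSpace F₁ A)]
  [∀ x, AddCommGroup (A x)] [∀ x, Module ℝ (A x)]
  [∀ x, TopologicalSpace (A x)] [FiberBundle F₁ A] [VectorBundle ℝ F₁ A]
  {F₂ : Type*} [NormedAddCommGroup F₂] [NormedSpace ℝ F₂]
  {B : P → Type*} [TopologicalSpace (TotalSpace F₂ B)]
  [∀ x, AddCommGroup (B x)] [∀ x, Module ℝ (B x)]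
  [∀ x, TopologicalSpace (B x)] [FiberBundle F₂ B] [VectorBundle ℝ F₂ B]

variable (d F₁ A) in
/-- Finite products of smooth functions and smooth sections.  Unlike general multivector fields they
have a parity, so the signs in the graded Leibniz rules make sense for them. -/
def mvMonomials : Submonoid (∀ x : P, ExteriorAlgebra ℝ (A x)) :=
  Submonoid.closure (multivectorGenerators d F₁ A)

theorem mvMonomials_le {w : ∀ x : P, ExteriorAlgebra ℝ (A x)} (hw : w ∈ mvMonomials d F₁ A) :
    w ∈ Multivector d F₁ A :=
  (Submonoid.closure_le (S := (Multivector d F₁ A).toSubmonoid)).2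
    (fun _ h => mem_multivector_of_generator h) hw

theorem exists_parity_of_generator {w : ∀ x : P, ExteriorAlgebra ℝ (A x)}
    (hw : w ∈ multivectorGenerators d F₁ A) : ∃ n, ∀ x, HasParity n (w x) := by
  rcases hw with ⟨f, rfl⟩ | ⟨X, rfl⟩
  · exact ⟨0, fun x => hasParity_algebraMap _⟩
  · exact ⟨1, fun x => hasParity_ι _⟩

theorem exists_parity {w : ∀ x : P, ExteriorAlgebra ℝ (A x)} (hw : w ∈ mvMonomials d F₁ A) :
    ∃ n, ∀ x, HasParity n (w x) := by
  induction hw using Submonoid.closure_induction with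
  | mem w hw => exact exists_parity_of_generator hw
  | one => exact ⟨0, fun x => hasParity_one⟩
  | mul a b _ _ ha hb =>
    obtain ⟨m, hm⟩ := ha
    obtain ⟨n, hn⟩ := hb
    exact ⟨m + n, fun x => (hm x).mul (hn x)⟩

/-- An induction principle for graded skew-symmetric biderivations: a property of pairs of
monomials follows from the case of generators.  The Leibniz rule is needed in the second argument
only, since the symmetry exchanges the arguments. -/
theorem mvMonomials_induction₂
    {Q : (∀ x : P, ExteriorAlgebra ℝ (A x)) → (∀ x : P, ExteriorAlgebra ℝ (A x)) → Prop}
    (one : ∀ w ∈ mvMonomials d F₁ A, Q w 1)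
    (fun_fun : ∀ f g : SmoothFun d P, Q (ofFun F₁ A f).1 (ofFun F₁ A g).1)
    (sec_fun : ∀ (X : Sec d F₁ A) (f : SmoothFun d P), Q (ofSec X).1 (ofFun F₁ A f).1)
    (sec_sec : ∀ X Y : Sec d F₁ A, Q (ofSec X).1 (ofSec Y).1)
    (symm : ∀ w ∈ mvMonomials d F₁ A, ∀ v ∈ mvMonomials d F₁ A, Q w v → Q v w)
    (mul : ∀ w ∈ mvMonomials d F₁ A, ∀ g ∈ mvMonomials d F₁ A, ∀ v ∈ mvMonomials d F₁ A,
      Q w g → Q w v → Q w (g * v))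
    {w v : ∀ x : P, ExteriorAlgebra ℝ (A x)} (hw : w ∈ mvMonomials d F₁ A)
    (hv : v ∈ mvMonomials d F₁ A) : Q w v := by
  have hgen : ∀ g ∈ multivectorGenerators d F₁ A, g ∈ mvMonomials d F₁ A := fun g hg =>
    Submonoid.subset_closure hg
  have hfun : ∀ f : SmoothFun d P, (ofFun F₁ A f).1 ∈ mvMonomials d F₁ A := fun f =>
    hgen _ (Or.inl ⟨f, rfl⟩)
  have hsec : ∀ X : Sec d F₁ A, (ofSec X).1 ∈ mvMonomials d F₁ A := fun X =>
    hgen _ (Or.inr ⟨X, rfl⟩)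
  have h1 : ∀ g ∈ multivectorGenerators d F₁ A, ∀ g' ∈ multivectorGenerators d F₁ A, Q g g' := by
    rintro g (⟨f, rfl⟩ | ⟨X, rfl⟩) g' (⟨f', rfl⟩ | ⟨X', rfl⟩)
    · exact fun_fun f f'
    · exact symm _ (hsec X') _ (hfun f) (sec_fun X' f)
    · exact sec_fun X f'
    · exact sec_sec X X'
  have h2 : ∀ w ∈ mvMonomials d F₁ A, (∀ g ∈ multivectorGenerators d F₁ A, Q w g) →
      ∀ v ∈ mvMonomials d F₁ A, Q w v := by
    intro w hw hg v hv
    induction hv using Submonoid.closure_induction with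
    | mem v hv => exact hg v hv
    | one => exact one w hw
    | mul a b ha hb iha ihb => exact mul w hw a ha b hb iha ihb
  exact h2 w hw (fun g hg => symm _ (hgen g hg) _ hw (h2 g (hgen g hg) (h1 g hg) w hw)) v hv

/-- The elements of the algebra generated by functions and sections are sums of monomials. -/
theorem adjoin_eq_span_mvMonomials :
    Subalgebra.toSubmodule (Algebra.adjoin ℝ (multivectorGenerators d F₁ A)) =
      Submodule.span ℝ (mvMonomials d F₁ A : Set (∀ x : P, ExteriorAlgebra ℝ (A x))) :=
  Algebra.adjoin_eq_span ℝ _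

theorem span_mvMonomials_le {w : ∀ x : P, ExteriorAlgebra ℝ (A x)}
    (hw : w ∈ Submodule.span ℝ (mvMonomials d F₁ A : Set (∀ x : P, ExteriorAlgebra ℝ (A x)))) :
    w ∈ Multivector d F₁ A :=
  (Submodule.span_le (p := Subalgebra.toSubmodule (Multivector d F₁ A))).2
    (fun _ h => mvMonomials_le h) hw

/-! ### The Schouten bracket in a dual frame -/

variable [FiniteDimensional ℝ F₁] [FiniteDimensional ℝ F₂]
  [ContMDiffVectorBundle ∞ F₁ A (𝓡 d)] [ContMDiffVectorBundle ∞ F₂ B (𝓡 d)]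
  {p : DualPairing d F₁ A F₂ B}

namespace DualFrame

variable {x : P} (D : DualFrame p x) (LA : LieAlgebroid d F₁ A)

/-- The Schouten bracket at the base point of a dual frame, in terms of the connection `∇` for which
the frame is parallel:
`[w, v] = ∑ ± i_{f_i} w ∧ ∇_{a e_i} v - ∑ ∇_{a e_i} w ∧ i_{f_i} v
  + ∑ ± i_{f_k} w ∧ [e_k, e_l] ∧ i_{f_l} v`,
with the sign given by the parity automorphism applied to `i_{f_i} w`. -/
def schouten (w v : ∀ y, ExteriorAlgebra ℝ (A y)) : ExteriorAlgebra ℝ (A x) :=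
  ∑ i, (invol (contract (p.pair x (D.f i x)) (w x)) * D.nabla (LA.anchor.map x (D.e i x)) v
    - D.nabla (LA.anchor.map x (D.e i x)) w * contract (p.pair x (D.f i x)) (v x)) +
  ∑ k, ∑ l, invol (contract (p.pair x (D.f k x)) (w x)) *
    (ExteriorAlgebra.ι ℝ (LA.bracket (D.e k) (D.e l) x) * contract (p.pair x (D.f l x)) (v x))

variable {w w' v v' u : ∀ y, ExteriorAlgebra ℝ (A y)}

theorem schouten_add_right (hv : v ∈ Multivector d F₁ A) (hv' : v' ∈ Multivector d F₁ A) :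
    D.schouten LA w (v + v') = D.schouten LA w v + D.schouten LA w v' := by
  simp only [schouten, D.nabla_add hv hv', Pi.add_apply, map_add, mul_add, Finset.sum_add_distrib,
    Finset.sum_sub_distrib]
  abel

theorem schouten_add_left (hw : w ∈ Multivector d F₁ A) (hw' : w' ∈ Multivector d F₁ A) :
    D.schouten LA (w + w') v = D.schouten LA w v + D.schouten LA w' v := by
  simp only [schouten, D.nabla_add hw hw', Pi.add_apply, map_add, add_mul, Finset.sum_add_distrib,
    Finset.sum_sub_distrib]
  abel

theorem schouten_smul_right (hv : v ∈ Multivector d F₁ A) (r : ℝ) :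
    D.schouten LA w (r • v) = r • D.schouten LA w v := by
  simp only [schouten, D.nabla_smul hv, Pi.smul_apply, map_smul, mul_smul_comm, smul_add,
    Finset.smul_sum, smul_sub]

theorem schouten_smul_left (hw : w ∈ Multivector d F₁ A) (r : ℝ) :
    D.schouten LA (r • w) v = r • D.schouten LA w v := by
  simp only [schouten, D.nabla_smul hw, Pi.smul_apply, map_smul, smul_mul_assoc, smul_add,
    Finset.smul_sum, smul_sub]

theorem schouten_congr (hw : ∀ᶠ y in 𝓝 x, w y = w' y) (hv : ∀ᶠ y in 𝓝 x, v y = v' y) :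
    D.schouten LA w v = D.schouten LA w' v' := by
  simp only [schouten, D.nabla_congr hw, D.nabla_congr hv, hw.self_of_nhds, hv.self_of_nhds]

theorem schouten_skew (hw : w ∈ Multivector d F₁ A) (hv : v ∈ Multivector d F₁ A) {m n : ℕ}
    (hm : ∀ y, HasParity m (w y)) (hn : ∀ y, HasParity n (v y)) :
    D.schouten LA w v = -((-1 : ℝ) ^ ((m + 1) * (n + 1)) • D.schouten LA v w) := by
  have s1 : (-1 : ℝ) ^ ((m + 1) * (n + 1)) * (-1) ^ (n * (m + 1)) = (-1) ^ (m + 1) := by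
    rw [← pow_add, show (m + 1) * (n + 1) + n * (m + 1) = (m + 1) + 2 * (n * (m + 1)) by ring,
      pow_add, pow_mul]
    simp
  have s2 : (-1 : ℝ) ^ ((m + 1) * (n + 1)) * ((-1) ^ (n + 1) * (-1) ^ (m * (n + 1))) = 1 := by
    rw [← pow_add, ← pow_add,
      show (m + 1) * (n + 1) + (n + 1 + m * (n + 1)) = 2 * ((m + 1) * (n + 1)) by ring, pow_mul]
    simp
  have s3 : (-1 : ℝ) ^ ((m + 1) * (n + 1)) *
      ((-1) ^ (n + 1) * ((-1) ^ ((n + 1) * (1 + (m + 1))) * (-1) ^ (1 * (m + 1)))) =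
      (-1) ^ (m + 1) := by
    rw [← pow_add, ← pow_add, ← pow_add,
      show (m + 1) * (n + 1) + (n + 1 + ((n + 1) * (1 + (m + 1)) + 1 * (m + 1))) =
        (m + 1) + 2 * ((n + 1) * (m + 2)) by ring, pow_add, pow_mul _ 2]
    simp
  have h1 : ∀ i, invol (contract (p.pair x (D.f i x)) (w x)) *
      D.nabla (LA.anchor.map x (D.e i x)) v = (-1 : ℝ) ^ ((m + 1) * (n + 1)) •
        (D.nabla (LA.anchor.map x (D.e i x)) v * contract (p.pair x (D.f i x)) (w x)) := by
    intro i
    have ha := (hm x).contract (p.pair x (D.f i x))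
    have hb := D.nabla_hasParity hv hn (LA.anchor.map x (D.e i x))
    rw [hb.mul_comm ha, smul_smul, s1, ← smul_mul_assoc]
    exact congrArg (· * _) ha
  have h2 : ∀ i, D.nabla (LA.anchor.map x (D.e i x)) w * contract (p.pair x (D.f i x)) (v x) =
      (-1 : ℝ) ^ ((m + 1) * (n + 1)) • (invol (contract (p.pair x (D.f i x)) (v x)) *
        D.nabla (LA.anchor.map x (D.e i x)) w) := by
    intro i
    have ha := (hn x).contract (p.pair x (D.f i x))
    have hb := D.nabla_hasParity hw hm (LA.anchor.map x (D.e i x))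
    have ha' : invol (contract (p.pair x (D.f i x)) (v x)) =
      (-1 : ℝ) ^ (n + 1) • contract (p.pair x (D.f i x)) (v x) := ha
    rw [ha', hb.mul_comm ha, smul_mul_assoc, smul_smul]
    have s4 : (-1 : ℝ) ^ (m * (n + 1)) = (-1 : ℝ) ^ ((m + 1) * (n + 1)) * (-1) ^ (n + 1) := by
      rw [← pow_add, show (m + 1) * (n + 1) + (n + 1) = m * (n + 1) + 2 * (n + 1) by ring,
        pow_add, pow_mul _ 2]
      simp
    rw [s4]
  have h3 : ∀ k l, invol (contract (p.pair x (D.f k x)) (w x)) *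
      (ExteriorAlgebra.ι ℝ (LA.bracket (D.e k) (D.e l) x) *
        contract (p.pair x (D.f l x)) (v x)) =
      -((-1 : ℝ) ^ ((m + 1) * (n + 1)) • (invol (contract (p.pair x (D.f l x)) (v x)) *
      (ExteriorAlgebra.ι ℝ (LA.bracket (D.e l) (D.e k) x) *
        contract (p.pair x (D.f k x)) (w x)))) := by
    intro k l
    have ha := (hm x).contract (p.pair x (D.f k x))
    have hb := (hn x).contract (p.pair x (D.f l x))
    have hc := hasParity_ι (LA.bracket (D.e k) (D.e l) x)
    have ha' : invol (contract (p.pair x (D.f k x)) (w x)) =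
      (-1 : ℝ) ^ (m + 1) • contract (p.pair x (D.f k x)) (w x) := ha
    have hb' : invol (contract (p.pair x (D.f l x)) (v x)) =
      (-1 : ℝ) ^ (n + 1) • contract (p.pair x (D.f l x)) (v x) := hb
    rw [LA.bracket_skew_apply (D.e l), map_neg, neg_mul, mul_neg, smul_neg, neg_neg, ha', hb',
      smul_mul_assoc, smul_mul_assoc, hb.mul_comm (hc.mul ha), hc.mul_comm ha, smul_mul_assoc,
      smul_smul, smul_smul, smul_smul, mul_assoc, mul_assoc, s3, mul_assoc]
  have h4 : ∑ k, ∑ l, invol (contract (p.pair x (D.f k x)) (w x)) *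
      (ExteriorAlgebra.ι ℝ (LA.bracket (D.e k) (D.e l) x) *
        contract (p.pair x (D.f l x)) (v x)) =
      -((-1 : ℝ) ^ ((m + 1) * (n + 1)) • ∑ k, ∑ l, invol (contract (p.pair x (D.f k x)) (v x)) *
        (ExteriorAlgebra.ι ℝ (LA.bracket (D.e k) (D.e l) x) *
        contract (p.pair x (D.f l x)) (w x))) := by
    rw [Finset.sum_comm, Finset.smul_sum, ← Finset.sum_neg_distrib]
    refine Finset.sum_congr rfl fun l _ => ?_
    rw [Finset.smul_sum, ← Finset.sum_neg_distrib]
    exact Finset.sum_congr rfl fun k _ => h3 k l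
  rw [schouten, schouten, h4, smul_add, neg_add]
  congr 1
  rw [Finset.smul_sum, ← Finset.sum_neg_distrib]
  refine Finset.sum_congr rfl fun i _ => ?_
  rw [h1, h2, smul_sub, neg_sub]

theorem schouten_mul_right (hw : w ∈ Multivector d F₁ A) (hv : v ∈ Multivector d F₁ A)
    (hu : u ∈ Multivector d F₁ A) {m n : ℕ}
    (hm : ∀ y, HasParity m (w y)) (hn : ∀ y, HasParity n (v y)) :
    D.schouten LA w (v * u) =
      D.schouten LA w v * u x + (-1 : ℝ) ^ ((m + 1) * n) • (v x * D.schouten LA w u) := by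
  have s1 : (-1 : ℝ) ^ n * (-1) ^ (m * n) = (-1) ^ ((m + 1) * n) := by
    rw [← pow_add]; congr 1; ring
  have hvi : invol (v x) = (-1 : ℝ) ^ n • v x := hn x
  have h1 : ∀ i, invol (contract (p.pair x (D.f i x)) (w x)) * v x = (-1 : ℝ) ^ ((m + 1) * n) •
      (v x * invol (contract (p.pair x (D.f i x)) (w x))) := fun i =>
    ((hm x).contract (p.pair x (D.f i x))).invol.mul_comm (hn x)
  have h2 : ∀ i, D.nabla (LA.anchor.map x (D.e i x)) w * invol (v x) =
      (-1 : ℝ) ^ ((m + 1) * n) • (v x * D.nabla (LA.anchor.map x (D.e i x)) w) := by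
    intro i
    have hb := D.nabla_hasParity hw hm (LA.anchor.map x (D.e i x))
    rw [hvi, mul_smul_comm, hb.mul_comm (hn x), smul_smul, s1]
  have h3 : ∀ k l, invol (contract (p.pair x (D.f k x)) (w x)) *
      (ExteriorAlgebra.ι ℝ (LA.bracket (D.e k) (D.e l) x) * invol (v x)) =
      (-1 : ℝ) ^ ((m + 1) * n) • (v x * (invol (contract (p.pair x (D.f k x)) (w x)) *
        ExteriorAlgebra.ι ℝ (LA.bracket (D.e k) (D.e l) x))) := by
    intro k l
    rw [ι_mul_eq, invol_invol, ← mul_assoc, h1, smul_mul_assoc, mul_assoc]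
  have h4 : ∀ i, (invol (contract (p.pair x (D.f i x)) (w x)) *
        D.nabla (LA.anchor.map x (D.e i x)) (v * u)
      - D.nabla (LA.anchor.map x (D.e i x)) w * contract (p.pair x (D.f i x)) ((v * u) x)) =
      (invol (contract (p.pair x (D.f i x)) (w x)) * D.nabla (LA.anchor.map x (D.e i x)) v
        - D.nabla (LA.anchor.map x (D.e i x)) w * contract (p.pair x (D.f i x)) (v x)) * u x +
      (-1 : ℝ) ^ ((m + 1) * n) • (v x * (invol (contract (p.pair x (D.f i x)) (w x)) *
        D.nabla (LA.anchor.map x (D.e i x)) u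
        - D.nabla (LA.anchor.map x (D.e i x)) w * contract (p.pair x (D.f i x)) (u x))) := by
    intro i
    rw [D.nabla_mul hv hu, Pi.mul_apply, contract_mul, mul_add, mul_add, ← mul_assoc, ← mul_assoc,
      ← mul_assoc, ← mul_assoc, h1, h2, sub_mul, mul_sub, smul_sub, smul_mul_assoc, smul_mul_assoc,
      mul_assoc (v x), mul_assoc (v x)]
    abel
  have h5 : ∀ k l, invol (contract (p.pair x (D.f k x)) (w x)) *
      (ExteriorAlgebra.ι ℝ (LA.bracket (D.e k) (D.e l) x) *
        contract (p.pair x (D.f l x)) ((v * u) x)) =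
      invol (contract (p.pair x (D.f k x)) (w x)) *
        (ExteriorAlgebra.ι ℝ (LA.bracket (D.e k) (D.e l) x) *
          contract (p.pair x (D.f l x)) (v x)) * u x +
      (-1 : ℝ) ^ ((m + 1) * n) • (v x * (invol (contract (p.pair x (D.f k x)) (w x)) *
        (ExteriorAlgebra.ι ℝ (LA.bracket (D.e k) (D.e l) x) *
          contract (p.pair x (D.f l x)) (u x)))) := by
    intro k l
    rw [Pi.mul_apply, contract_mul, mul_add, mul_add, ← mul_assoc _ (invol (v x)),
      ← mul_assoc _ (_ * invol (v x)), h3, smul_mul_assoc]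
    simp only [mul_assoc]
  simp only [schouten, h4, h5, Finset.sum_add_distrib, add_mul, mul_add, Finset.sum_mul,
    Finset.mul_sum, Finset.smul_sum, smul_add]
  abel

theorem schouten_mem (hw : w ∈ Multivector d F₁ A) (hv : v ∈ Multivector d F₁ A) {k l m : ℕ}
    (hklm : k + l = m + 1) (hk : ∀ y, w y ∈ ⋀[ℝ]^k (A y)) (hl : ∀ y, v y ∈ ⋀[ℝ]^l (A y)) :
    D.schouten LA w v ∈ ⋀[ℝ]^m (A x) := by
  refine add_mem (sum_mem fun i _ => sub_mem ?_ ?_)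
    (sum_mem fun i _ => sum_mem fun j _ => ?_)
  · cases k with
    | zero => rw [contract_eq_zero_of_mem _ (hk x), map_zero, zero_mul]; exact zero_mem _
    | succ k =>
      rw [show m = k + l by omega]
      exact mul_mem_exteriorPower (invol_mem (contract_mem _ (hk x))) (D.nabla_mem hv hl _)
  · cases l with
    | zero => rw [contract_eq_zero_of_mem _ (hl x), mul_zero]; exact zero_mem _
    | succ l =>
      rw [show m = k + l by omega]
      exact mul_mem_exteriorPower (D.nabla_mem hw hk _) (contract_mem _ (hl x))
  · cases k with
    | zero => rw [contract_eq_zero_of_mem _ (hk x), map_zero, zero_mul]; exact zero_mem _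
    | succ k =>
      cases l with
      | zero => rw [contract_eq_zero_of_mem _ (hl x), mul_zero, mul_zero]; exact zero_mem _
      | succ l =>
        rw [show m = k + (1 + l) by omega]
        exact mul_mem_exteriorPower (invol_mem (contract_mem _ (hk x)))
          (mul_mem_exteriorPower (ι_mem_one _) (contract_mem _ (hl x)))

theorem schouten_degree_zero (hk : ∀ y, w y ∈ ⋀[ℝ]^0 (A y)) (hl : ∀ y, v y ∈ ⋀[ℝ]^0 (A y)) :
    D.schouten LA w v = 0 := by
  simp only [schouten, contract_eq_zero_of_mem _ (hk x), contract_eq_zero_of_mem _ (hl x), map_zero,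
    zero_mul, mul_zero, sub_self, Finset.sum_const_zero, add_zero]

theorem bracket_expand_left (X Y : Sec d F₁ A) :
    LA.bracket X Y x = ∑ k, (p.pair x (D.f k x) (X x) • LA.bracket (D.e k) Y x
      - diff (p.fn (D.f k) X) x (LA.anchor.map x (Y x)) • D.e k x) := by
  rw [← LA.bracket_congr_left Y (D.eventually_sum_eq X), map_sum, LinearMap.sum_apply,
    sec_sum_apply]
  exact Finset.sum_congr rfl fun k _ => LA.leibniz_left _ _ _ _

theorem anchor_expand (v : A x) :
    LA.anchor.map x v = ∑ k, p.pair x (D.f k x) v • LA.anchor.map x (D.e k x) := by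
  conv_lhs => rw [← D.sum_eq v, map_sum]
  simp only [map_smul]

theorem nabla_sum_left {J : Type*} (s : Finset J) (r : J → ℝ) (t : J → TangentSpace (𝓡 d) x) :
    D.nabla (∑ j ∈ s, r j • t j) v = ∑ j ∈ s, r j • D.nabla (t j) v := by
  let N : TangentSpace (𝓡 d) x →ₗ[ℝ] ExteriorAlgebra ℝ (A x) :=
    { toFun := fun t => D.nabla t v
      map_add' := fun _ _ => D.nabla_add_left _ _
      map_smul' := fun _ _ => D.nabla_smul_left _ _ }
  refine (map_sum N _ _).trans (Finset.sum_congr rfl fun j _ => map_smul N _ _)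

/-- The bracket with a section `X` is `∇_{a X} + ∑ [X, e_l] ∧ i_{f_l}`. -/
theorem schouten_sec_left (X : Sec d F₁ A) :
    D.schouten LA (fun y => ExteriorAlgebra.ι ℝ (X y)) v =
      D.nabla (LA.anchor.map x (X x)) v +
        ∑ l, ExteriorAlgebra.ι ℝ (LA.bracket X (D.e l) x) *
          contract (p.pair x (D.f l x)) (v x) := by
  rw [D.anchor_expand LA, D.nabla_sum_left]
  simp only [schouten, contract_ι, AlgHom.commutes, D.nabla_sec, D.bracket_expand_left LA X,
    p.fn_eq, ← Algebra.smul_def, Finset.sum_sub_distrib, map_sub, sub_mul]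
  rw [Finset.sum_comm (γ := Fin (Module.finrank ℝ F₁))]
  simp only [map_sum, map_smul, Finset.sum_mul, smul_mul_assoc]
  abel

theorem schouten_sec_mul (X : Sec d F₁ A) (hv : v ∈ Multivector d F₁ A)
    (hu : u ∈ Multivector d F₁ A) :
    D.schouten LA (fun y => ExteriorAlgebra.ι ℝ (X y)) (v * u) =
      D.schouten LA (fun y => ExteriorAlgebra.ι ℝ (X y)) v * u x +
        v x * D.schouten LA (fun y => ExteriorAlgebra.ι ℝ (X y)) u := by
  have h : ∀ l, ExteriorAlgebra.ι ℝ (LA.bracket X (D.e l) x) *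
      contract (p.pair x (D.f l x)) ((v * u) x) =
      ExteriorAlgebra.ι ℝ (LA.bracket X (D.e l) x) * contract (p.pair x (D.f l x)) (v x) * u x +
        v x * (ExteriorAlgebra.ι ℝ (LA.bracket X (D.e l) x) *
          contract (p.pair x (D.f l x)) (u x)) := by
    intro l
    rw [Pi.mul_apply, contract_mul, mul_add, ← mul_assoc, ← mul_assoc, ι_mul_eq _ (invol (v x)),
      invol_invol, mul_assoc (v x)]
  simp only [schouten_sec_left, D.nabla_mul hv hu, h, Finset.sum_add_distrib, add_mul, mul_add,
    Finset.sum_mul, Finset.mul_sum]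
  abel

theorem schouten_sec_fun (X : Sec d F₁ A) (f : SmoothFun d P) :
    D.schouten LA (fun y => ExteriorAlgebra.ι ℝ (X y))
      (fun y => algebraMap ℝ (ExteriorAlgebra ℝ (A y)) (f y)) =
      algebraMap ℝ _ (diff f x (LA.anchor.map x (X x))) := by
  simp only [schouten_sec_left, D.nabla_fun, contract_algebraMap, mul_zero, Finset.sum_const_zero,
    add_zero]

theorem schouten_sec_sec (X Y : Sec d F₁ A) :
    D.schouten LA (fun y => ExteriorAlgebra.ι ℝ (X y)) (fun y => ExteriorAlgebra.ι ℝ (Y y)) =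
      ExteriorAlgebra.ι ℝ (LA.bracket X Y x) := by
  rw [schouten_sec_left, D.nabla_sec, LA.bracket_skew_apply X Y, D.bracket_expand_left LA Y X,
    ← Finset.sum_neg_distrib]
  simp only [contract_ι, p.fn_eq, map_sum, ← Finset.sum_add_distrib]
  refine Finset.sum_congr rfl fun l _ => ?_
  rw [← Algebra.commutes, ← Algebra.smul_def, ← map_smul, ← map_add, LA.bracket_skew_apply X]
  congr 1
  module

end DualFrame

end Schouten

/-! ### The Schouten bracket on multivector fields -/

section SchoutenBracket

variable {d : ℕ} {P : Type*} [TopologicalSpace P] [T2Space P]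
  [ChartedSpace (EuclideanSpace ℝ (Fin d)) P] [IsManifold (𝓡 d) ∞ P]
  {F₁ : Type*} [NormedAddCommGroup F₁] [NormedSpace ℝ F₁]
  {A : P → Type*} [TopologicalSpace (TotalSpace F₁ A)]
  [∀ x, AddCommGroup (A x)] [∀ x, Module ℝ (A x)]
  [∀ x, TopologicalSpace (A x)] [FiberBundle F₁ A] [VectorBundle ℝ F₁ A]
  {F₂ : Type*} [NormedAddCommGroup F₂] [NormedSpace ℝ F₂]
  {B : P → Type*} [TopologicalSpace (TotalSpace F₂ B)]
  [∀ x, AddCommGroup (B x)] [∀ x, Module ℝ (B x)]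
  [∀ x, TopologicalSpace (B x)] [FiberBundle F₂ B] [VectorBundle ℝ F₂ B]
  [FiniteDimensional ℝ F₁] [FiniteDimensional ℝ F₂]
  [ContMDiffVectorBundle ∞ F₁ A (𝓡 d)] [ContMDiffVectorBundle ∞ F₂ B (𝓡 d)]
  {p : DualPairing d F₁ A F₂ B}

theorem DualFrame.schouten_zero_right {x : P} (D : DualFrame p x) (LA : LieAlgebroid d F₁ A)
    {w : ∀ x, ExteriorAlgebra ℝ (A x)} : D.schouten LA w 0 = 0 := by
  simpa using D.schouten_smul_right LA (w := w) (zero_mem (Multivector d F₁ A)) 0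

theorem DualFrame.schouten_zero_left {x : P} (D : DualFrame p x) (LA : LieAlgebroid d F₁ A)
    {w : ∀ x, ExteriorAlgebra ℝ (A x)} : D.schouten LA 0 w = 0 := by
  simpa using D.schouten_smul_left LA (v := w) (zero_mem (Multivector d F₁ A)) 0

variable (p) in
/-- The Schouten bracket of two multivector fields, as a field of elements of exterior algebras. -/
def schoutenField (LA : LieAlgebroid d F₁ A) (w v : ∀ x, ExteriorAlgebra ℝ (A x)) (x : P) :
    ExteriorAlgebra ℝ (A x) :=
  (dualFrame p x).schouten LA w v

theorem schoutenField_one (LA : LieAlgebroid d F₁ A) {w : ∀ x, ExteriorAlgebra ℝ (A x)}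
    (hw : w ∈ mvMonomials d F₁ A) : schoutenField p LA w 1 = 0 := by
  obtain ⟨m, hm⟩ := exists_parity hw
  funext x
  have h := (dualFrame p x).schouten_mul_right LA (mvMonomials_le hw)
    (one_mem (Multivector d F₁ A)) (one_mem (Multivector d F₁ A)) hm (fun _ => hasParity_one)
  rw [mul_one, mul_zero, pow_zero, one_smul, Pi.one_apply, mul_one, one_mul] at h
  exact left_eq_add.1 h

theorem schoutenField_mem_of_monomials (LA : LieAlgebroid d F₁ A)
    {w v : ∀ x, ExteriorAlgebra ℝ (A x)}
    (hw : w ∈ mvMonomials d F₁ A) (hv : v ∈ mvMonomials d F₁ A) :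
    schoutenField p LA w v ∈ Multivector d F₁ A := by
  refine mvMonomials_induction₂ (Q := fun w v => schoutenField p LA w v ∈ Multivector d F₁ A)
    (fun w hw => ?_) (fun f g => ?_) (fun X f => ?_) (fun X Y => ?_) (fun w hw v hv h => ?_)
    (fun w hw g hg v hv h1 h2 => ?_) hw hv
  · rw [schoutenField_one LA hw]; exact zero_mem _
  · have h : schoutenField p LA (ofFun F₁ A f).1 (ofFun F₁ A g).1 = 0 :=
      funext fun x => DualFrame.schouten_degree_zero _ LA (fun _ => algebraMap_mem_zero _)
        (fun _ => algebraMap_mem_zero _)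
    rw [h]; exact zero_mem _
  · have h : schoutenField p LA (ofSec X).1 (ofFun F₁ A f).1 = (ofFun F₁ A (LA.act X f)).1 :=
      funext fun x => DualFrame.schouten_sec_fun _ LA X f
    rw [h]; exact Subtype.property _
  · have h : schoutenField p LA (ofSec X).1 (ofSec Y).1 = (ofSec (LA.bracket X Y)).1 :=
      funext fun x => DualFrame.schouten_sec_sec _ LA X Y
    rw [h]; exact Subtype.property _
  · obtain ⟨m, hm⟩ := exists_parity hw
    obtain ⟨n, hn⟩ := exists_parity hv
    have e : schoutenField p LA v w =
        -((-1 : ℝ) ^ ((n + 1) * (m + 1)) • schoutenField p LA w v) :=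
      funext fun x => DualFrame.schouten_skew _ LA (mvMonomials_le hv) (mvMonomials_le hw) hn hm
    rw [e]
    exact neg_mem (Subalgebra.smul_mem _ h _)
  · obtain ⟨m, hm⟩ := exists_parity hw
    obtain ⟨n, hn⟩ := exists_parity hg
    have e : schoutenField p LA w (g * v) = schoutenField p LA w g * v +
        (-1 : ℝ) ^ ((m + 1) * n) • (g * schoutenField p LA w v) :=
      funext fun x => DualFrame.schouten_mul_right _ LA (mvMonomials_le hw) (mvMonomials_le hg)
        (mvMonomials_le hv) hm hn
    rw [e]
    exact add_mem (mul_mem h1 (mvMonomials_le hv))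
      (Subalgebra.smul_mem _ (mul_mem (mvMonomials_le hg) h2) _)

/-- Smoothness of the Schouten bracket, by bilinearity from the case of products of functions and
sections. -/
theorem schoutenField_mem (LA : LieAlgebroid d F₁ A) {w v : ∀ x, ExteriorAlgebra ℝ (A x)}
    (hw : w ∈ Multivector d F₁ A) (hv : v ∈ Multivector d F₁ A) :
    schoutenField p LA w v ∈ Multivector d F₁ A := by
  refine mem_multivector_of_locally fun x₀ => ?_
  obtain ⟨w', hw', hww⟩ := hw x₀
  obtain ⟨v', hv', hvv⟩ := hv x₀
  refine ⟨schoutenField p LA w' v', ?_, ?_⟩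
  · rw [← Subalgebra.mem_toSubmodule, adjoin_eq_span_mvMonomials] at hw' hv'
    have h1 : ∀ w ∈ mvMonomials d F₁ A, schoutenField p LA w v' ∈ Multivector d F₁ A := by
      intro w hw
      clear hvv
      induction hv' using Submodule.span_induction with
      | mem v hv => exact schoutenField_mem_of_monomials LA hw hv
      | zero =>
        have e : schoutenField p LA w 0 = 0 :=
          funext fun x => (dualFrame p x).schouten_zero_right LA
        rw [e]; exact zero_mem _
      | add a b ha hb iha ihb =>
        have e : schoutenField p LA w (a + b) =
            schoutenField p LA w a + schoutenField p LA w b :=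
          funext fun x => DualFrame.schouten_add_right _ LA (span_mvMonomials_le ha)
            (span_mvMonomials_le hb)
        rw [e]; exact add_mem iha ihb
      | smul r a ha iha =>
        have e : schoutenField p LA w (r • a) = r • schoutenField p LA w a :=
          funext fun x => DualFrame.schouten_smul_right _ LA (span_mvMonomials_le ha) r
        rw [e]; exact Subalgebra.smul_mem _ iha r
    clear hww
    induction hw' using Submodule.span_induction with
    | mem w hw => exact h1 w hw
    | zero =>
      have e : schoutenField p LA 0 v' = 0 :=
        funext fun x => (dualFrame p x).schouten_zero_left LA
      rw [e]; exact zero_mem _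
    | add a b ha hb iha ihb =>
      have e : schoutenField p LA (a + b) v' =
          schoutenField p LA a v' + schoutenField p LA b v' :=
        funext fun x => DualFrame.schouten_add_left _ LA (span_mvMonomials_le ha)
          (span_mvMonomials_le hb)
      rw [e]; exact add_mem iha ihb
    | smul r a ha iha =>
      have e : schoutenField p LA (r • a) v' = r • schoutenField p LA a v' :=
        funext fun x => DualFrame.schouten_smul_left _ LA (span_mvMonomials_le ha) r
      rw [e]; exact Subalgebra.smul_mem _ iha r
  · filter_upwards [eventually_eventually_nhds.2 hww, eventually_eventually_nhds.2 hvv] with y h1 h2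
    exact DualFrame.schouten_congr _ LA h1 h2

variable (p) in
/-- The Schouten bracket on multivector fields, computed at each point in the dual frame chosen
there. -/
def schoutenBracket (LA : LieAlgebroid d F₁ A) :
    Multivector d F₁ A →ₗ[ℝ] Multivector d F₁ A →ₗ[ℝ] Multivector d F₁ A :=
  LinearMap.mk₂ ℝ (fun w v => ⟨schoutenField p LA w.1 v.1, schoutenField_mem LA w.2 v.2⟩)
    (fun w w' _ => Subtype.ext <| funext fun _ => DualFrame.schouten_add_left _ LA w.2 w'.2)
    (fun r w _ => Subtype.ext <| funext fun _ => DualFrame.schouten_smul_left _ LA w.2 r)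
    (fun _ v v' => Subtype.ext <| funext fun _ => DualFrame.schouten_add_right _ LA v.2 v'.2)
    (fun r _ v => Subtype.ext <| funext fun _ => DualFrame.schouten_smul_right _ LA v.2 r)

theorem schoutenBracket_apply (LA : LieAlgebroid d F₁ A) (w v : Multivector d F₁ A) (x : P) :
    (schoutenBracket p LA w v).1 x = (dualFrame p x).schouten LA w.1 v.1 := rfl

/-- All values of a multivector field have parity `n`. -/
def MvParity (n : ℕ) (w : Multivector d F₁ A) : Prop := ∀ x, HasParity n (w.1 x)

theorem IsHomogeneous.mvParity {k : ℕ} {w : Multivector d F₁ A} (h : IsHomogeneous k w) :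
    MvParity k w := fun x => hasParity_of_mem (h x)

theorem schoutenBracket_skew (LA : LieAlgebroid d F₁ A) {m n : ℕ} {w v : Multivector d F₁ A}
    (hw : MvParity m w) (hv : MvParity n v) :
    schoutenBracket p LA w v =
      -((-1 : ℝ) ^ ((m + 1) * (n + 1)) • schoutenBracket p LA v w) :=
  Subtype.ext <| funext fun _ => DualFrame.schouten_skew _ LA w.2 v.2 hw hv

theorem schoutenBracket_mul (LA : LieAlgebroid d F₁ A) {m n : ℕ} {w v : Multivector d F₁ A}
    (hw : MvParity m w) (hv : MvParity n v) (u : Multivector d F₁ A) :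
    schoutenBracket p LA w (v * u) = schoutenBracket p LA w v * u +
      (-1 : ℝ) ^ ((m + 1) * n) • (v * schoutenBracket p LA w u) :=
  Subtype.ext <| funext fun _ => DualFrame.schouten_mul_right _ LA w.2 v.2 u.2 hw hv

theorem schoutenBracket_sec_sec (LA : LieAlgebroid d F₁ A) (X Y : Sec d F₁ A) :
    schoutenBracket p LA (ofSec X) (ofSec Y) = ofSec (LA.bracket X Y) :=
  Subtype.ext <| funext fun _ => DualFrame.schouten_sec_sec _ LA X Y

theorem schoutenBracket_sec_fun (LA : LieAlgebroid d F₁ A) (X : Sec d F₁ A) (f : SmoothFun d P) :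
    schoutenBracket p LA (ofSec X) (ofFun F₁ A f) = ofFun F₁ A (LA.act X f) :=
  Subtype.ext <| funext fun _ => DualFrame.schouten_sec_fun _ LA X f

theorem schoutenBracket_fun_fun (LA : LieAlgebroid d F₁ A) (f g : SmoothFun d P) :
    schoutenBracket p LA (ofFun F₁ A f) (ofFun F₁ A g) = 0 :=
  Subtype.ext <| funext fun _ => DualFrame.schouten_degree_zero _ LA
    (fun _ => algebraMap_mem_zero _) (fun _ => algebraMap_mem_zero _)

variable (p) in
theorem isSchoutenBracket (LA : LieAlgebroid d F₁ A) :
    IsSchoutenBracket LA (schoutenBracket p LA) where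
  degree _ _ _ w v h hw hv _ := DualFrame.schouten_mem _ LA w.2 v.2 h hw hv
  degree_zero _ _ hw hv := Subtype.ext <| funext fun _ => DualFrame.schouten_degree_zero _ LA hw hv
  on_sections := schoutenBracket_sec_sec LA
  on_functions X f _ := DualFrame.schouten_sec_fun _ LA X f
  skew _ _ _ _ hw hv := schoutenBracket_skew LA hw.mvParity hv.mvParity
  wedge _ _ _ _ u hw hv := schoutenBracket_mul LA hw.mvParity hv.mvParity u

theorem MvParity.differential {LB : LieAlgebroid d F₂ B} {m : ℕ} {w : Multivector d F₁ A}
    (hw : MvParity m w) : MvParity (m + 1) (differential p LB w) := fun x => by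
  refine HasParity.add (HasParity.sum fun i _ => ?_) (HasParity.sum fun k _ => ?_)
  · rw [add_comm]
    exact (hasParity_ι _).mul (DualFrame.nabla_hasParity _ w.2 hw _)
  · exact ((hasParity_of_mem (DualFrame.bivector_mem _ _)).mul
      ((hw x).contract _)).congr (by omega)

theorem MvParity.schoutenBracket {LA : LieAlgebroid d F₁ A} {m n : ℕ} {w v : Multivector d F₁ A}
    (hw : MvParity m w) (hv : MvParity n v) :
    MvParity (m + n + 1) (schoutenBracket p LA w v) := fun x => by
  refine HasParity.add (HasParity.sum fun i _ => HasParity.sub ?_ ?_)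
    (HasParity.sum fun k _ => HasParity.sum fun l _ => ?_)
  · exact (((hw x).contract _).invol.mul (DualFrame.nabla_hasParity _ v.2 hv _)).congr (by omega)
  · exact ((DualFrame.nabla_hasParity _ w.2 hw _).mul ((hv x).contract _)).congr (by omega)
  · exact (((hw x).contract _).invol.mul ((hasParity_ι _).mul ((hv x).contract _))).congr
      (by omega)

/-! ### Contractions and Lie derivatives -/

theorem contract_mem_multivector (ξ : Sec d F₂ B) {w : ∀ x, ExteriorAlgebra ℝ (A x)}
    (hw : w ∈ Multivector d F₁ A) :
    (fun x => contract (p.pair x (ξ x)) (w x)) ∈ Multivector d F₁ A := by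
  refine mem_multivector_of_locally fun x₀ => ?_
  obtain ⟨v, hv, h⟩ := hw x₀
  refine ⟨fun x => contract (p.pair x (ξ x)) (v x), ?_, h.mono fun x hx => congrArg _ hx⟩
  clear h
  induction hv using Algebra.adjoin_induction with
  | mem v hv =>
    rcases hv with ⟨f, rfl⟩ | ⟨X, rfl⟩
    · simp only [contract_algebraMap]
      exact zero_mem _
    · simp only [contract_ι]
      exact mem_multivector_of_generator (Or.inl ⟨p.fn ξ X, rfl⟩)
  | algebraMap r =>
    simp only [Pi.algebraMap_apply, contract_algebraMap]
    exact zero_mem _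
  | add a b _ _ ha hb => simp only [Pi.add_apply, map_add]; exact add_mem ha hb
  | mul a b ha hb iha ihb =>
    simp only [Pi.mul_apply, contract_mul]
    exact add_mem (mul_mem iha (adjoin_le_multivector hb))
      (mul_mem (invol_mem_multivector (adjoin_le_multivector ha)) ihb)

namespace DualFrame

variable {x : P} (D : DualFrame p x) (LA : LieAlgebroid d F₁ A)

theorem schouten_sec_algebraMap (X : Sec d F₁ A) (r : ℝ) :
    D.schouten LA (fun y => ExteriorAlgebra.ι ℝ (X y))
      (algebraMap ℝ (∀ y, ExteriorAlgebra ℝ (A y)) r) = 0 := by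
  have h := D.schouten_sec_fun LA X (⟨fun _ => r, contMDiff_const⟩ : SmoothFun d P)
  refine h.trans ?_
  have : diff (fun _ : P => r) x (LA.anchor.map x (X x)) = 0 := diff_const r x _
  exact (congrArg _ this).trans (map_zero _)

/-- The Lie derivative along a section preserves parity. -/
theorem schouten_sec_invol (X : Sec d F₁ A) {v : ∀ y, ExteriorAlgebra ℝ (A y)}
    (hv : v ∈ Multivector d F₁ A) :
    D.schouten LA (fun y => ExteriorAlgebra.ι ℝ (X y)) (fun y => invol (v y)) =
      invol (D.schouten LA (fun y => ExteriorAlgebra.ι ℝ (X y)) v) := by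
  have key : ∀ u ∈ Algebra.adjoin ℝ (multivectorGenerators d F₁ A),
      D.schouten LA (fun y => ExteriorAlgebra.ι ℝ (X y)) (fun y => invol (u y)) =
        invol (D.schouten LA (fun y => ExteriorAlgebra.ι ℝ (X y)) u) := by
    intro u hu
    induction hu using Algebra.adjoin_induction with
    | mem u hu =>
      rcases hu with ⟨f, rfl⟩ | ⟨Y, rfl⟩
      · simp only [AlgHom.commutes, D.schouten_sec_fun]
      · have h1 : (fun y => invol (ExteriorAlgebra.ι ℝ (Y y))) =
            fun y => ExteriorAlgebra.ι ℝ ((-Y) y) := funext fun y => by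
          rw [invol_ι, ← map_neg]; rfl
        rw [h1, D.schouten_sec_sec, D.schouten_sec_sec, invol_ι, ← map_neg, map_neg (LA.bracket X)]
        rfl
    | algebraMap r =>
      have h1 : (fun y => invol (algebraMap ℝ (∀ y, ExteriorAlgebra ℝ (A y)) r y)) =
          algebraMap ℝ (∀ y, ExteriorAlgebra ℝ (A y)) r := funext fun y => AlgHom.commutes _ r
      rw [h1, D.schouten_sec_algebraMap, map_zero]
    | add a b ha hb iha ihb =>
      have ha := adjoin_le_multivector ha
      have hb := adjoin_le_multivector hb
      have h1 : (fun y => invol ((a + b) y)) = (fun y => invol (a y)) + fun y => invol (b y) :=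
        funext fun y => map_add _ _ _
      rw [h1, D.schouten_add_right LA (invol_mem_multivector ha) (invol_mem_multivector hb),
        D.schouten_add_right LA ha hb, map_add, iha, ihb]
    | mul a b ha hb iha ihb =>
      have ha := adjoin_le_multivector ha
      have hb := adjoin_le_multivector hb
      have h1 : (fun y => invol ((a * b) y)) = (fun y => invol (a y)) * fun y => invol (b y) :=
        funext fun y => map_mul _ _ _
      rw [h1, D.schouten_sec_mul LA X (invol_mem_multivector ha) (invol_mem_multivector hb),
        D.schouten_sec_mul LA X ha hb, map_add, map_mul, map_mul, iha, ihb]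
  obtain ⟨u, hu, h⟩ := hv x
  have e := Eventually.of_forall (f := 𝓝 x) fun y => Eq.refl (ExteriorAlgebra.ι ℝ (X y))
  rw [D.schouten_congr LA e h, ← key u hu]
  exact D.schouten_congr LA e (h.mono fun y hy => congrArg _ hy)

/-- The commutator of the Lie derivative along `X` and the contraction with `ξ` is the contraction
with `θ = L_X ξ`. -/
theorem contract_schouten_sec {X : Sec d F₁ A} {ξ θ : Sec d F₂ B}
    (hθ : IsLieDerivative LA p X ξ θ) {v : ∀ y, ExteriorAlgebra ℝ (A y)}
    (hv : v ∈ Multivector d F₁ A) :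
    contract (p.pair x (ξ x)) (D.schouten LA (fun y => ExteriorAlgebra.ι ℝ (X y)) v) =
      D.schouten LA (fun y => ExteriorAlgebra.ι ℝ (X y))
        (fun y => contract (p.pair y (ξ y)) (v y)) - contract (p.pair x (θ x)) (v x) := by
  have key : ∀ u ∈ Algebra.adjoin ℝ (multivectorGenerators d F₁ A),
      contract (p.pair x (ξ x)) (D.schouten LA (fun y => ExteriorAlgebra.ι ℝ (X y)) u) =
        D.schouten LA (fun y => ExteriorAlgebra.ι ℝ (X y))
          (fun y => contract (p.pair y (ξ y)) (u y)) - contract (p.pair x (θ x)) (u x) := by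
    intro u hu
    induction hu using Algebra.adjoin_induction with
    | mem u hu =>
      rcases hu with ⟨f, rfl⟩ | ⟨Y, rfl⟩
      · rw [D.schouten_sec_fun]
        simp only [contract_algebraMap, sub_zero]
        exact (D.schouten_zero_right LA).symm
      · rw [D.schouten_sec_sec]
        simp only [contract_ι]
        have h1 := D.schouten_sec_fun LA X (p.fn ξ Y)
        simp only [p.fn_apply] at h1
        rw [h1, ← map_sub, hθ Y x, p.fn_eq, sub_sub_cancel]
    | algebraMap r =>
      rw [D.schouten_sec_algebraMap, map_zero]
      simp only [Pi.algebraMap_apply, contract_algebraMap, sub_zero]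
      exact (D.schouten_zero_right LA).symm
    | add a b ha hb iha ihb =>
      have ha := adjoin_le_multivector ha
      have hb := adjoin_le_multivector hb
      have h1 : (fun y => contract (p.pair y (ξ y)) ((a + b) y)) =
          (fun y => contract (p.pair y (ξ y)) (a y)) + fun y => contract (p.pair y (ξ y)) (b y) :=
        funext fun y => map_add _ _ _
      rw [h1, D.schouten_add_right LA (contract_mem_multivector ξ ha)
        (contract_mem_multivector ξ hb), D.schouten_add_right LA ha hb, map_add, iha, ihb,
        Pi.add_apply, map_add]
      abel
    | mul a b ha hb iha ihb =>
      have ha := adjoin_le_multivector ha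
      have hb := adjoin_le_multivector hb
      have ha' := contract_mem_multivector (p := p) ξ ha
      have hb' := contract_mem_multivector (p := p) ξ hb
      have h1 : (fun y => contract (p.pair y (ξ y)) ((a * b) y)) =
          (fun y => contract (p.pair y (ξ y)) (a y)) * b +
            (fun y => invol (a y)) * fun y => contract (p.pair y (ξ y)) (b y) :=
        funext fun y => contract_mul _ _ _
      rw [h1, D.schouten_add_right LA (mul_mem ha' hb) (mul_mem (invol_mem_multivector ha) hb'),
        D.schouten_sec_mul LA X ha hb, D.schouten_sec_mul LA X ha' hb,
        D.schouten_sec_mul LA X (invol_mem_multivector ha) hb', map_add, contract_mul,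
        contract_mul, iha, ihb, D.schouten_sec_invol LA X ha, Pi.mul_apply, contract_mul]
      simp only [sub_mul, mul_sub]
      abel
  obtain ⟨u, hu, h⟩ := hv x
  have e := Eventually.of_forall (f := 𝓝 x) fun y => Eq.refl (ExteriorAlgebra.ι ℝ (X y))
  rw [D.schouten_congr LA e h, h.self_of_nhds, key u hu]
  exact congrArg (· - _) (D.schouten_congr LA e (h.mono fun y hy => congrArg _ hy.symm))

end DualFrame

end SchoutenBracket

/-! ### The compatibility condition on generators -/

section Criterion

variable {d : ℕ} {P : Type*} [TopologicalSpace P] [T2Space P]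
  [ChartedSpace (EuclideanSpace ℝ (Fin d)) P] [IsManifold (𝓡 d) ∞ P]
  {F₁ : Type*} [NormedAddCommGroup F₁] [NormedSpace ℝ F₁]
  {A : P → Type*} [TopologicalSpace (TotalSpace F₁ A)]
  [∀ x, AddCommGroup (A x)] [∀ x, Module ℝ (A x)]
  [∀ x, TopologicalSpace (A x)] [FiberBundle F₁ A] [VectorBundle ℝ F₁ A]
  {F₂ : Type*} [NormedAddCommGroup F₂] [NormedSpace ℝ F₂]
  {B : P → Type*} [TopologicalSpace (TotalSpace F₂ B)]
  [∀ x, AddCommGroup (B x)] [∀ x, Module ℝ (B x)]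
  [∀ x, TopologicalSpace (B x)] [FiberBundle F₂ B] [VectorBundle ℝ F₂ B]
  [FiniteDimensional ℝ F₁] [FiniteDimensional ℝ F₂]
  [ContMDiffVectorBundle ∞ F₁ A (𝓡 d)] [ContMDiffVectorBundle ∞ F₂ B (𝓡 d)]
  {p : DualPairing d F₁ A F₂ B}

variable (p) in
/-- The failure of `d_*` to be a derivation of the Schouten bracket.  On `w` of degree `k` the parity
automorphism is `(-1) ^ k`, so the last term is `-(-1) ^ (k - 1) [w, d_* v]`, without a truncated
subtraction and for inhomogeneous `w`. -/
def defect (LA : LieAlgebroid d F₁ A) (LB : LieAlgebroid d F₂ B) (w v : Multivector d F₁ A) :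
    Multivector d F₁ A :=
  differential p LB (schoutenBracket p LA w v) - schoutenBracket p LA (differential p LB w) v +
    schoutenBracket p LA (mvInvol w) (differential p LB v)

variable {LA : LieAlgebroid d F₁ A} {LB : LieAlgebroid d F₂ B}

theorem mvInvol_add (w w' : Multivector d F₁ A) : mvInvol (w + w') = mvInvol w + mvInvol w' :=
  Subtype.ext <| funext fun _ => map_add invol _ _

theorem mvInvol_smul (r : ℝ) (w : Multivector d F₁ A) : mvInvol (r • w) = r • mvInvol w :=
  Subtype.ext <| funext fun x => map_smul invol r (w.1 x)

theorem defect_add_left (w w' v : Multivector d F₁ A) :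
    defect p LA LB (w + w') v = defect p LA LB w v + defect p LA LB w' v := by
  simp only [defect, map_add, LinearMap.add_apply, mvInvol_add]
  abel

theorem defect_add_right (w v v' : Multivector d F₁ A) :
    defect p LA LB w (v + v') = defect p LA LB w v + defect p LA LB w v' := by
  simp only [defect, map_add]
  abel

theorem defect_smul_left (r : ℝ) (w v : Multivector d F₁ A) :
    defect p LA LB (r • w) v = r • defect p LA LB w v := by
  simp only [defect, map_smul, LinearMap.smul_apply, mvInvol_smul, smul_add, smul_sub]

theorem defect_smul_right (r : ℝ) (w v : Multivector d F₁ A) :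
    defect p LA LB w (r • v) = r • defect p LA LB w v := by
  simp only [defect, map_smul, smul_add, smul_sub]

theorem schoutenBracket_congr {w w' v v' : Multivector d F₁ A} {x : P}
    (hw : ∀ᶠ y in 𝓝 x, w.1 y = w'.1 y) (hv : ∀ᶠ y in 𝓝 x, v.1 y = v'.1 y) :
    (schoutenBracket p LA w v).1 x = (schoutenBracket p LA w' v').1 x :=
  DualFrame.schouten_congr _ LA hw hv

theorem defect_congr {w w' v v' : Multivector d F₁ A} {x : P}
    (hw : ∀ᶠ y in 𝓝 x, w.1 y = w'.1 y) (hv : ∀ᶠ y in 𝓝 x, v.1 y = v'.1 y) :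
    (defect p LA LB w v).1 x = (defect p LA LB w' v').1 x := by
  have hδ : ∀ {u u' : Multivector d F₁ A}, (∀ᶠ y in 𝓝 x, u.1 y = u'.1 y) →
      ∀ᶠ y in 𝓝 x, (differential p LB u).1 y = (differential p LB u').1 y := fun h =>
    (eventually_eventually_nhds.2 h).mono fun _ hy => differential_congr LB hy
  have h1 : (differential p LB (schoutenBracket p LA w v)).1 x =
      (differential p LB (schoutenBracket p LA w' v')).1 x := by
    refine differential_congr LB ?_
    filter_upwards [eventually_eventually_nhds.2 hw, eventually_eventually_nhds.2 hv] with y h1 h2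
    exact schoutenBracket_congr h1 h2
  have h2 := schoutenBracket_congr (p := p) (LA := LA) (hδ hw) hv
  have h3 := schoutenBracket_congr (p := p) (LA := LA) (w := mvInvol w) (w' := mvInvol w')
    (hw.mono fun y hy => congrArg invol hy) (hδ hv)
  change (differential p LB (schoutenBracket p LA w v)).1 x -
    (schoutenBracket p LA (differential p LB w) v).1 x +
    (schoutenBracket p LA (mvInvol w) (differential p LB v)).1 x = _
  rw [h1, h2, h3]
  rfl

theorem MvParity.of_mod {m : ℕ} {w : Multivector d F₁ A} (hw : MvParity m w) :
    MvParity (m % 2) w := fun x => (hw x).congr (by omega)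

theorem MvParity.mvInvol_eq {m : ℕ} {w : Multivector d F₁ A} (hw : MvParity m w) :
    mvInvol w = (-1 : ℝ) ^ m • w :=
  mvInvol_of_hasParity hw

/-- The defect is a graded derivation in its second argument.  Only parities enter the signs, which
leaves four cases. -/
theorem defect_mul {m n : ℕ} {w v : Multivector d F₁ A} (hw : MvParity m w) (hv : MvParity n v)
    (u : Multivector d F₁ A) :
    defect p LA LB w (v * u) =
      defect p LA LB w v * u + (-1 : ℝ) ^ (m * n) • (v * defect p LA LB w u) := by
  have hm2 : m % 2 < 2 := Nat.mod_lt _ two_pos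
  have hn2 : n % 2 < 2 := Nat.mod_lt _ two_pos
  have hpow : (-1 : ℝ) ^ (m * n) = (-1) ^ ((m % 2) * (n % 2)) := by
    rw [pow_mul, neg_one_pow_eq_pow_mod_two m, ← pow_mul, mul_comm, pow_mul,
      neg_one_pow_eq_pow_mod_two n, ← pow_mul, mul_comm]
  rw [hpow]
  replace hw := hw.of_mod
  replace hv := hv.of_mod
  generalize m % 2 = m at *
  generalize n % 2 = n at *
  have e1 := schoutenBracket_mul (p := p) LA hw hv u
  have e2 := schoutenBracket_mul (p := p) LA (hw.differential (p := p) (LB := LB)) hv u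
  have e3 := schoutenBracket_mul (p := p) LA hw (hv.differential (p := p) (LB := LB)) u
  have e4 := schoutenBracket_mul (p := p) LA hw hv (differential p LB u)
  have e5 := hw.mvInvol_eq
  have e6 := hv.mvInvol_eq
  have e7 := (hw.schoutenBracket (p := p) (LA := LA) hv).mvInvol_eq
  simp only [defect, differential_mul, e1, e2, e3, e4, e5, e6, e7, map_add, map_smul,
    LinearMap.smul_apply, add_mul, sub_mul, mul_add, mul_sub, smul_mul_assoc, mul_smul_comm, smul_add,
    smul_sub]
  obtain rfl | rfl : m = 0 ∨ m = 1 := by omega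
  all_goals obtain rfl | rfl : n = 0 ∨ n = 1 := by omega
  all_goals norm_num
  all_goals abel

/-- The defect has the graded skew-symmetry of the Schouten bracket. -/
theorem defect_skew {m n : ℕ} {w v : Multivector d F₁ A} (hw : MvParity m w) (hv : MvParity n v) :
    defect p LA LB w v = -((-1 : ℝ) ^ ((m + 1) * (n + 1)) • defect p LA LB v w) := by
  have hm2 : m % 2 < 2 := Nat.mod_lt _ two_pos
  have hn2 : n % 2 < 2 := Nat.mod_lt _ two_pos
  have hpow : (-1 : ℝ) ^ ((m + 1) * (n + 1)) = (-1) ^ ((m % 2 + 1) * (n % 2 + 1)) := by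
    rw [neg_one_pow_eq_pow_mod_two, neg_one_pow_eq_pow_mod_two ((m % 2 + 1) * (n % 2 + 1))]
    congr 1
    simp [Nat.mul_mod, Nat.add_mod]
  rw [hpow]
  replace hw := hw.of_mod
  replace hv := hv.of_mod
  generalize m % 2 = m at *
  generalize n % 2 = n at *
  have e1 := schoutenBracket_skew (p := p) LA hw hv
  have e2 := schoutenBracket_skew (p := p) LA (hw.differential (p := p) (LB := LB)) hv
  have e3 := schoutenBracket_skew (p := p) LA hw (hv.differential (p := p) (LB := LB))
  have e5 := hw.mvInvol_eq
  have e6 := hv.mvInvol_eq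
  simp only [defect, e1, e2, e3, e5, e6, map_smul, map_neg, LinearMap.smul_apply]
  obtain rfl | rfl : m = 0 ∨ m = 1 := by omega
  all_goals obtain rfl | rfl : n = 0 ∨ n = 1 := by omega
  all_goals norm_num
  all_goals abel

theorem defect_one {m : ℕ} {w : Multivector d F₁ A} (hw : MvParity m w) :
    defect p LA LB w 1 = 0 := by
  have h := defect_mul (p := p) (LA := LA) (LB := LB) hw (n := 0) (v := 1)
    (fun _ => hasParity_one) 1
  rw [mul_one, mul_one, mul_zero, pow_zero, one_smul, one_mul] at h
  exact left_eq_add.1 h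

/-- The defect vanishes if it does on functions and sections. -/
theorem defect_eq_zero
    (fun_fun : ∀ f g : SmoothFun d P, defect p LA LB (ofFun F₁ A f) (ofFun F₁ A g) = 0)
    (sec_fun : ∀ (X : Sec d F₁ A) (f : SmoothFun d P),
      defect p LA LB (ofSec X) (ofFun F₁ A f) = 0)
    (sec_sec : ∀ X Y : Sec d F₁ A, defect p LA LB (ofSec X) (ofSec Y) = 0)
    (w v : Multivector d F₁ A) : defect p LA LB w v = 0 := by
  have hmon : ∀ w v, ∀ hw : w ∈ mvMonomials d F₁ A, ∀ hv : v ∈ mvMonomials d F₁ A,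
      defect p LA LB ⟨w, mvMonomials_le hw⟩ ⟨v, mvMonomials_le hv⟩ = 0 := by
    intro w v hw hv
    have h := mvMonomials_induction₂ (d := d) (F₁ := F₁) (A := A)
      (Q := fun w v => ∀ (hw : w ∈ Multivector d F₁ A) (hv : v ∈ Multivector d F₁ A),
        defect p LA LB ⟨w, hw⟩ ⟨v, hv⟩ = 0) ?_ (fun f g _ _ => fun_fun f g)
        (fun X f _ _ => sec_fun X f) (fun X Y _ _ => sec_sec X Y) ?_ ?_ hw hv
    · exact h _ _
    · intro w hw hw' _
      obtain ⟨m, hm⟩ := exists_parity hw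
      exact defect_one (w := ⟨w, hw'⟩) hm
    · intro w hw v hv h hv' hw'
      obtain ⟨m, hm⟩ := exists_parity hw
      obtain ⟨n, hn⟩ := exists_parity hv
      rw [defect_skew (w := ⟨v, hv'⟩) (v := ⟨w, hw'⟩) hn hm, h hw' hv', smul_zero, neg_zero]
    · intro w hw g hg v hv h1 h2 hw' _
      obtain ⟨m, hm⟩ := exists_parity hw
      obtain ⟨n, hn⟩ := exists_parity hg
      have h := defect_mul (p := p) (LA := LA) (LB := LB) (w := ⟨w, hw'⟩)
        (v := ⟨g, mvMonomials_le hg⟩) hm hn ⟨v, mvMonomials_le hv⟩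
      rw [h1, h2, zero_mul, mul_zero, smul_zero, add_zero] at h
      exact h
  have hspan : ∀ w
      (hw : w ∈ Submodule.span ℝ (mvMonomials d F₁ A : Set (∀ x, ExteriorAlgebra ℝ (A x)))) v
      (hv : v ∈ Submodule.span ℝ (mvMonomials d F₁ A : Set (∀ x, ExteriorAlgebra ℝ (A x)))),
      defect p LA LB ⟨w, span_mvMonomials_le hw⟩ ⟨v, span_mvMonomials_le hv⟩ = 0 := by
    intro w hw v hv
    induction hw using Submodule.span_induction with
    | mem w hw =>
      induction hv using Submodule.span_induction with
      | mem v hv => exact hmon w v hw hv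
      | zero =>
        have := defect_smul_right (p := p) (LA := LA) (LB := LB) 0 ⟨w, mvMonomials_le hw⟩ 0
        rw [zero_smul, zero_smul] at this
        exact this
      | add a b ha hb iha ihb =>
        have := defect_add_right (p := p) (LA := LA) (LB := LB) ⟨w, mvMonomials_le hw⟩
          ⟨a, span_mvMonomials_le ha⟩ ⟨b, span_mvMonomials_le hb⟩
        rw [iha, ihb, add_zero] at this
        exact this
      | smul r a ha iha =>
        have := defect_smul_right (p := p) (LA := LA) (LB := LB) r ⟨w, mvMonomials_le hw⟩
          ⟨a, span_mvMonomials_le ha⟩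
        rw [iha, smul_zero] at this
        exact this
    | zero =>
      have := defect_smul_left (p := p) (LA := LA) (LB := LB) 0 0 ⟨v, span_mvMonomials_le hv⟩
      rw [zero_smul, zero_smul] at this
      exact this
    | add a b ha hb iha ihb =>
      have := defect_add_left (p := p) (LA := LA) (LB := LB)
        ⟨a, span_mvMonomials_le ha⟩ ⟨b, span_mvMonomials_le hb⟩ ⟨v, span_mvMonomials_le hv⟩
      rw [iha, ihb, add_zero] at this
      exact this
    | smul r a ha iha =>
      have := defect_smul_left (p := p) (LA := LA) (LB := LB) r
        ⟨a, span_mvMonomials_le ha⟩ ⟨v, span_mvMonomials_le hv⟩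
      rw [iha, smul_zero] at this
      exact this
  refine Subtype.ext (funext fun x => ?_)
  obtain ⟨w', hw', hww⟩ := w.2 x
  obtain ⟨v', hv', hvv⟩ := v.2 x
  rw [← Subalgebra.mem_toSubmodule, adjoin_eq_span_mvMonomials] at hw' hv'
  rw [defect_congr (w' := ⟨w', span_mvMonomials_le hw'⟩) (v' := ⟨v', span_mvMonomials_le hv'⟩)
    hww hvv, hspan w' hw' v' hv']

theorem schoutenBracket_fun_sec (X : Sec d F₁ A) (f : SmoothFun d P) :
    schoutenBracket p LA (ofFun F₁ A f) (ofSec X) = -ofFun F₁ A (LA.act X f) := by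
  rw [schoutenBracket_skew LA (m := 0) (n := 1) (fun _ => hasParity_algebraMap _)
    (fun _ => hasParity_ι _), schoutenBracket_sec_fun]
  norm_num

theorem mvParity_ofSec (X : Sec d F₁ A) : MvParity 1 (ofSec X) := fun _ => hasParity_ι _

theorem isHomogeneous_ofSec (X : Sec d F₁ A) : IsHomogeneous 1 (ofSec X) := fun _ => ι_mem_one _

theorem isHomogeneous_ofFun (f : SmoothFun d P) : IsHomogeneous 0 (ofFun F₁ A f) :=
  fun _ => algebraMap_mem_zero _

/-- The contraction of `[X, d_* Y]` with two sections of `A^*`. -/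
theorem contract_contract_schoutenBracket (X Y : Sec d F₁ A) {ξ η θ ζ : Sec d F₂ B}
    (hθ : IsLieDerivative LA p X ξ θ) (hζ : IsLieDerivative LA p X η ζ) (x : P) :
    contract (p.pair x (η x)) (contract (p.pair x (ξ x))
      ((schoutenBracket p LA (ofSec X) (differential p LB (ofSec Y))).1 x)) =
      algebraMap ℝ _ (LA.act X (dform p LB Y ξ η) x - dform p LB Y θ η x
        - dform p LB Y ξ ζ x) := by
  have hW := (differential p LB (ofSec Y)).2
  have hc : ∀ (ξ η : Sec d F₂ B) y, contract (p.pair y (η y)) (contract (p.pair y (ξ y))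
      ((differential p LB (ofSec Y)).1 y)) = algebraMap ℝ _ (dform p LB Y ξ η y) := fun ξ η y =>
    DualFrame.contract_contract_delta_sec _ LB Y ξ η
  rw [schoutenBracket_apply]
  have h1 := (dualFrame p x).contract_schouten_sec LA hθ hW
  have h2 := (dualFrame p x).contract_schouten_sec LA hζ (contract_mem_multivector (p := p) ξ hW)
  simp only [hc] at h2
  rw [DualFrame.schouten_sec_fun] at h2
  refine (congrArg _ h1).trans ?_
  rw [map_sub, h2, hc, ← map_sub, ← map_sub]
  congr 1
  rw [LA.act_apply]
  ring

/-- The contraction of `[d_* X, f]` with a section of `A^*`. -/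
theorem contract_schoutenBracket_fun (X : Sec d F₁ A) (f : SmoothFun d P) {θ : Sec d F₂ B}
    (hθ : IsDifferential LA p f θ) (ξ : Sec d F₂ B) (x : P) :
    contract (p.pair x (ξ x))
      ((schoutenBracket p LA (differential p LB (ofSec X)) (ofFun F₁ A f)).1 x) =
      algebraMap ℝ _ (dform p LB X ξ θ x) := by
  set D := dualFrame p x
  set W := (differential p LB (ofSec X)).1 x with hWdef
  have hW : HasParity 2 W := (mvParity_ofSec X).differential x
  have h1 : ∀ i, invol (contract (p.pair x (D.f i x)) W) = -contract (p.pair x (D.f i x)) W := by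
    intro i
    rw [hW.contract (p.pair x (D.f i x))]
    norm_num
  have h2 : (schoutenBracket p LA (differential p LB (ofSec X)) (ofFun F₁ A f)).1 x =
      -∑ i, p.pair x (θ x) (D.e i x) • contract (p.pair x (D.f i x)) W := by
    rw [schoutenBracket_apply]
    simp only [DualFrame.schouten, ofFun, contract_algebraMap, mul_zero, sub_zero,
      Finset.sum_const_zero, add_zero, DualFrame.nabla_fun]
    rw [← Finset.sum_neg_distrib]
    refine Finset.sum_congr rfl fun i _ => ?_
    rw [← Algebra.commutes, ← Algebra.smul_def, hθ (D.e i) x, ← smul_neg]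
    exact congrArg _ (h1 i)
  have h3 : ∀ i, contract (p.pair x (ξ x)) (contract (p.pair x (D.f i x)) W) =
      algebraMap ℝ _ (dform p LB X (D.f i) ξ x) := fun i =>
    DualFrame.contract_contract_delta_sec _ LB X (D.f i) ξ
  rw [h2, map_neg, map_sum, dform_antisymm,
    D.tensorial_dual (fun η => dform p LB X η ξ x) (fun η η' => dform_add_left p LB X η η' ξ x)
      (fun g η => dform_smul_left p LB X g η ξ x) θ, map_neg, map_sum]
  congr 1
  refine Finset.sum_congr rfl fun i _ => ?_
  rw [map_smul, h3, Algebra.smul_def, ← map_mul]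

/-- A pair of Lie algebroids in duality is a Lie bialgebroid as soon as the compatibility condition
holds on functions and sections, where it can be tested by contractions.  The hypotheses say that
`d_*` is compatible with the bracket of two functions, of a section and a function, and of two
sections. -/
theorem isLieBialgebroid_of_generators (lie : Sec d F₁ A → Sec d F₂ B → Sec d F₂ B)
    (hlie : ∀ X ξ, IsLieDerivative LA p X ξ (lie X ξ))
    (fun_fun : ∀ (f g : SmoothFun d P) (U V : Sec d F₁ A), IsDifferential LB p.flip f U →
      IsDifferential LB p.flip g V → ∀ x, LA.act U g x + LA.act V f x = 0)
    (sec_fun : ∀ (X : Sec d F₁ A) (f : SmoothFun d P) (U : Sec d F₁ A) (θ : Sec d F₂ B),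
      IsDifferential LB p.flip f U → IsDifferential LA p f θ → ∀ (ξ : Sec d F₂ B) x,
      LB.act ξ (LA.act X f) x = dform p LB X ξ θ x + p.pair x (ξ x) (LA.bracket X U x))
    (sec_sec : ∀ (X Y : Sec d F₁ A) (ξ η : Sec d F₂ B) x,
      dform p LB (LA.bracket X Y) ξ η x =
        (LA.act X (dform p LB Y ξ η) x - dform p LB Y (lie X ξ) η x
          - dform p LB Y ξ (lie X η) x) -
        (LA.act Y (dform p LB X ξ η) x - dform p LB X (lie Y ξ) η x
          - dform p LB X ξ (lie Y η) x)) :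
    IsLieBialgebroid LA LB p := by
  refine ⟨differential p LB, schoutenBracket p LA, isAlgebroidDifferential p LB,
    isSchoutenBracket p LA, ?_⟩
  have key : ∀ w v : Multivector d F₁ A, defect p LA LB w v = 0 := by
    refine defect_eq_zero (fun f g => ?_) (fun X f => ?_) fun X Y => ?_
    · obtain ⟨U, hU⟩ := exists_isDifferential_flip p LB f
      obtain ⟨V, hV⟩ := exists_isDifferential_flip p LB g
      have e : mvInvol (ofFun F₁ A f) = ofFun F₁ A f :=
        (mvInvol_of_hasParity (n := 0) fun _ => hasParity_algebraMap _).trans (by simp)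
      rw [defect, schoutenBracket_fun_fun, map_zero, e, differential_ofFun LB hU,
        differential_ofFun LB hV, schoutenBracket_sec_fun, schoutenBracket_fun_sec]
      refine Subtype.ext (funext fun x => ?_)
      change 0 - algebraMap ℝ (ExteriorAlgebra ℝ (A x)) (LA.act U g x) +
        -algebraMap ℝ (ExteriorAlgebra ℝ (A x)) (LA.act V f x) = 0
      rw [zero_sub, ← neg_add, ← map_add, fun_fun f g U V hU hV x, map_zero, neg_zero]
    · obtain ⟨U, hU⟩ := exists_isDifferential_flip p LB f
      obtain ⟨θ, hθ⟩ : ∃ θ, IsDifferential LA p f θ := exists_isDifferential_flip p.flip LA f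
      obtain ⟨Z, hZ⟩ := exists_isDifferential_flip p LB (LA.act X f)
      have e : mvInvol (ofSec X) = -ofSec X :=
        (mvInvol_of_hasParity (n := 1) fun _ => hasParity_ι _).trans (by simp)
      rw [defect, schoutenBracket_sec_fun, e, differential_ofFun LB hU,
        differential_ofFun LB hZ, map_neg, LinearMap.neg_apply, schoutenBracket_sec_sec]
      refine Subtype.ext (funext fun x => ?_)
      have hdeg := (isSchoutenBracket p LA).degree 2 0 1 _ _ rfl
        ((isAlgebroidDifferential p LB).degree 1 _ (isHomogeneous_ofSec X))
        (isHomogeneous_ofFun (F₁ := F₁) (A := A) f) x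
      have h : ExteriorAlgebra.ι ℝ (Z x) = (schoutenBracket p LA (differential p LB (ofSec X))
          (ofFun F₁ A f)).1 x + ExteriorAlgebra.ι ℝ (LA.bracket X U x) := by
        refine (dualFrame p x).ext_of_contract (k := 0) (ι_mem_one _)
          (add_mem hdeg (ι_mem_one _)) fun j => ?_
        rw [map_add, contract_schoutenBracket_fun X f hθ, contract_ι, contract_ι, ← map_add,
          ← sec_fun X f U θ hU hθ]
        exact congrArg _ (hZ _ x)
      change ExteriorAlgebra.ι ℝ (Z x) - (schoutenBracket p LA (differential p LB (ofSec X))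
          (ofFun F₁ A f)).1 x + -ExteriorAlgebra.ι ℝ (LA.bracket X U x) = 0
      rw [h]
      abel
    · have e : mvInvol (ofSec X) = -ofSec X :=
        (mvInvol_of_hasParity (n := 1) fun _ => hasParity_ι _).trans (by simp)
      have hd : ∀ Z : Sec d F₁ A, IsHomogeneous 2 (differential p LB (ofSec Z)) := fun Z =>
        (isAlgebroidDifferential p LB).degree 1 _ (isHomogeneous_ofSec Z)
      have hs : schoutenBracket p LA (differential p LB (ofSec X)) (ofSec Y) =
          -schoutenBracket p LA (ofSec Y) (differential p LB (ofSec X)) := by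
        rw [schoutenBracket_skew LA (hd X).mvParity (mvParity_ofSec Y)]
        norm_num
      rw [defect, schoutenBracket_sec_sec, e, map_neg, LinearMap.neg_apply, hs]
      refine Subtype.ext (funext fun x => ?_)
      have hdeg : ∀ U V : Sec d F₁ A, (schoutenBracket p LA (ofSec U)
          (differential p LB (ofSec V))).1 x ∈ ⋀[ℝ]^2 (A x) := fun U V =>
        (isSchoutenBracket p LA).degree 1 2 2 _ _ rfl (isHomogeneous_ofSec U) (hd V) x
      have h : (differential p LB (ofSec (LA.bracket X Y))).1 x =
          (schoutenBracket p LA (ofSec X) (differential p LB (ofSec Y))).1 x -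
          (schoutenBracket p LA (ofSec Y) (differential p LB (ofSec X))).1 x := by
        refine (dualFrame p x).ext_of_contract_contract (hd _ x)
          (sub_mem (hdeg X Y) (hdeg Y X)) fun ξ η => ?_
        rw [map_sub, map_sub, contract_contract_schoutenBracket X Y (hlie X ξ) (hlie X η),
          contract_contract_schoutenBracket Y X (hlie Y ξ) (hlie Y η), ← map_sub, ← sec_sec]
        exact DualFrame.contract_contract_delta_sec _ LB _ ξ η
      change (differential p LB (ofSec (LA.bracket X Y))).1 x -
        -(schoutenBracket p LA (ofSec Y) (differential p LB (ofSec X))).1 x +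
        -(schoutenBracket p LA (ofSec X) (differential p LB (ofSec Y))).1 x = 0
      rw [h]
      abel
  intro k w v hw
  have h := key w v
  rw [defect, hw.mvParity.mvInvol_eq, map_smul, LinearMap.smul_apply] at h
  rw [pow_succ, mul_neg_one, neg_smul, ← sub_eq_add_neg, eq_sub_iff_add_eq]
  rw [sub_add_eq_add_sub, sub_eq_zero] at h
  exact h

end Criterion

/-! ### The Dorfman product of a Courant algebroid -/

section Dorfman

variable {d : ℕ} {P : Type*} [TopologicalSpace P] [T2Space P]
  [ChartedSpace (EuclideanSpace ℝ (Fin d)) P] [IsManifold (𝓡 d) ∞ P]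
  {F : Type*} [NormedAddCommGroup F] [NormedSpace ℝ F] [FiniteDimensional ℝ F]
  {E : P → Type*} [TopologicalSpace (TotalSpace F E)]
  [∀ x, AddCommGroup (E x)] [∀ x, Module ℝ (E x)]
  [∀ x, TopologicalSpace (E x)] [FiberBundle F E] [VectorBundle ℝ F E]

/-- The form of a Courant algebroid as a duality of `E` with itself. -/
def PreCourant.selfPairing (C : PreCourant d F E) : DualPairing d F E F E where
  pair := C.form
  nondegenerate := C.form_nondegenerate
  smooth := C.form_smooth

/-- The form on sections. -/
def PreCourant.fn (C : PreCourant d F E) : Sec d F E →ₗ[ℝ] Sec d F E →ₗ[ℝ] SmoothFun d P :=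
  LinearMap.mk₂ ℝ (fun e h => ⟨fun x => C.form x (e x) (h x), C.form_smooth e h⟩)
    (fun e e' h => ContMDiffMap.ext fun x => by
      change C.form x (e x + e' x) (h x) = C.form x (e x) (h x) + C.form x (e' x) (h x)
      rw [map_add, LinearMap.add_apply])
    (fun r e h => ContMDiffMap.ext fun x => by
      change C.form x (r • e x) (h x) = r • C.form x (e x) (h x)
      rw [map_smul, LinearMap.smul_apply])
    (fun e h h' => ContMDiffMap.ext fun x => by
      change C.form x (e x) (h x + h' x) = C.form x (e x) (h x) + C.form x (e x) (h' x)
      rw [map_add])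
    (fun r e h => ContMDiffMap.ext fun x => by
      change C.form x (e x) (r • h x) = r • C.form x (e x) (h x)
      rw [map_smul])

theorem PreCourant.fn_symm (C : PreCourant d F E) (e h : Sec d F E) : C.fn e h = C.fn h e :=
  ContMDiffMap.ext fun x => C.form_symm x _ _

/-- The derivative `ρ(e) f`. -/
def PreCourant.act (C : PreCourant d F E) :
    Sec d F E →ₗ[ℝ] SmoothFun d P →ₗ[ℝ] SmoothFun d P :=
  LinearMap.mk₂ ℝ
    (fun e f => ⟨fun x => diff f x (C.rho.map x (e x)), contMDiff_diff f.contMDiff (C.rho.smooth e)⟩)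
    (fun e e' f => ContMDiffMap.ext fun x => by
      change diff f x (C.rho.map x (e x + e' x)) = diff f x (C.rho.map x (e x)) +
        diff f x (C.rho.map x (e' x))
      rw [map_add, map_add])
    (fun r e f => ContMDiffMap.ext fun x => by
      change diff f x (C.rho.map x (r • e x)) = r • diff f x (C.rho.map x (e x))
      rw [map_smul, map_smul])
    (fun e f g => ContMDiffMap.ext fun x => diff_add (f.mdiff x) (g.mdiff x) _)
    (fun r e f => ContMDiffMap.ext fun x => diff_const_mul r (f.mdiff x) _)

theorem PreCourant.act_apply (C : PreCourant d F E) (e : Sec d F E) (f : SmoothFun d P) (x : P) :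
    C.act e f x = diff f x (C.rho.map x (e x)) := rfl

theorem PreCourant.ext_form (C : PreCourant d F E) {x : P} {v w : E x}
    (h : ∀ u, C.form x u v = C.form x u w) : v = w :=
  C.selfPairing.pair_ext h

variable [ContMDiffVectorBundle ∞ F E (𝓡 d)]

/-- `𝒟 f` is smooth because its pairings with smooth sections are. -/
theorem PreCourant.contMDiff_D (C : PreCourant d F E) (f : SmoothFun d P) :
    ContMDiff (𝓡 d) ((𝓡 d).prod 𝓘(ℝ, F)) ∞
      (fun x => (⟨x, C.D f x⟩ : TotalSpace F E)) := by
  obtain ⟨X, hX⟩ := C.selfPairing.exists_sec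
    (fun x => (2⁻¹ : ℝ) • (diff f x ∘ₗ C.rho.map x)) fun e =>
      contMDiff_const.mul (C.act e f).contMDiff
  have h : ∀ x, C.D f x = X x := fun x => C.ext_form fun u => by
    rw [C.form_symm, C.form_D]
    exact (hX x u).symm
  simp only [h]
  exact X.contMDiff

/-- The operator `𝒟` on smooth functions. -/
def PreCourant.grad (C : PreCourant d F E) : SmoothFun d P →ₗ[ℝ] Sec d F E where
  toFun f := ⟨fun x => C.D f x, C.contMDiff_D f⟩
  map_add' f g := by
    ext x
    refine C.ext_form fun u => ?_
    change C.form x u (C.D (fun y => f y + g y) x) = C.form x u (C.D f x + C.D g x)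
    rw [map_add, C.form_symm x u, C.form_symm x u, C.form_symm x u, C.form_D, C.form_D, C.form_D,
      diff_add (f.mdiff x) (g.mdiff x), mul_add]
  map_smul' r f := by
    ext x
    refine C.ext_form fun u => ?_
    change C.form x u (C.D (fun y => r * f y) x) = C.form x u (r • C.D f x)
    rw [map_smul, C.form_symm x u, C.form_symm x u, C.form_D, C.form_D,
      diff_const_mul r (f.mdiff x), smul_eq_mul]
    ring

theorem PreCourant.grad_apply (C : PreCourant d F E) (f : SmoothFun d P) (x : P) :
    C.grad f x = C.D f x := rfl

theorem PreCourant.fn_grad (C : PreCourant d F E) (f : SmoothFun d P) (e : Sec d F E) :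
    C.fn (C.grad f) e = (2⁻¹ : ℝ) • C.act e f :=
  ContMDiffMap.ext fun x => C.form_D f x (e x)

theorem PreCourant.sec_ext (C : PreCourant d F E) {e h : Sec d F E}
    (H : ∀ u, C.fn e u = C.fn h u) : e = h := by
  ext x
  refine C.ext_form fun v => ?_
  obtain ⟨D⟩ := exists_dualFrame C.selfPairing x
  obtain ⟨u, rfl⟩ := D.exists_sec_eq v
  rw [C.form_symm, C.form_symm x _ (h x)]
  exact DFunLike.congr_fun (H u) x

namespace CourantAlgebroid

variable (C : CourantAlgebroid d F E)

/-- The Dorfman product `e ∘ h = [e, h] + 𝒟 (e, h)`. -/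
def dorfman : Sec d F E →ₗ[ℝ] Sec d F E →ₗ[ℝ] Sec d F E :=
  C.bracket + C.fn.compr₂ C.grad

theorem dorfman_eq (e h : Sec d F E) : C.dorfman e h = C.bracket e h + C.grad (C.fn e h) := rfl

theorem bracket_eq (e h : Sec d F E) : C.bracket e h = C.dorfman e h - C.grad (C.fn e h) := by
  rw [dorfman_eq, add_sub_cancel_right]

theorem act_fn (e h₁ h₂ : Sec d F E) :
    C.act e (C.fn h₁ h₂) = C.fn (C.dorfman e h₁) h₂ + C.fn h₁ (C.dorfman e h₂) :=
  ContMDiffMap.ext fun x => C.invariance e h₁ h₂ x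

theorem act_grad (f g : SmoothFun d P) : C.act (C.grad f) g = 0 :=
  ContMDiffMap.ext fun x => by
    rw [C.act_apply, C.grad_apply, C.rho_D, map_zero]
    rfl

theorem act_dorfman (e h : Sec d F E) (f : SmoothFun d P) :
    C.act (C.dorfman e h) f = C.act e (C.act h f) - C.act h (C.act e f) := by
  rw [dorfman_eq, map_add, LinearMap.add_apply, act_grad, add_zero]
  refine ContMDiffMap.ext fun x => ?_
  refine (congrArg (diff f x) (C.rho_bracket e h x)).trans ?_
  exact diff_mlieBracket f.contMDiff (C.rho.smooth e) (C.rho.smooth h) x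

theorem dorfman_add_dorfman (e h : Sec d F E) :
    C.dorfman e h + C.dorfman h e = (2 : ℝ) • C.grad (C.fn e h) := by
  rw [dorfman_eq, dorfman_eq, C.bracket_skew e h, C.fn_symm h e]
  module

theorem dorfman_grad (e : Sec d F E) (f : SmoothFun d P) :
    C.dorfman e (C.grad f) = C.grad (C.act e f) := by
  refine C.sec_ext fun u => ?_
  have h := C.act_fn e (C.grad f) u
  rw [C.fn_grad, C.fn_grad, C.act_dorfman, map_smul] at h
  rw [C.fn_grad, ← sub_eq_iff_eq_add.2 h]
  module

theorem grad_dorfman (e : Sec d F E) (f : SmoothFun d P) : C.dorfman (C.grad f) e = 0 := by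
  have h := C.dorfman_add_dorfman (C.grad f) e
  rw [C.fn_grad, dorfman_grad, map_smul, smul_smul] at h
  norm_num at h
  exact h

/-- The Leibniz form of the Jacobi identity.  It follows from the Jacobi anomaly because the
invariance of the form expresses `ρ(e₁)(e₂, e₃) - ρ(e₂)(e₁, e₃)` through the three functions
`([e₁, e₂], e₃)`, `([e₂, e₃], e₁)`, `([e₃, e₁], e₂)`. -/
theorem dorfman_dorfman (e₁ e₂ e₃ : Sec d F E) :
    C.dorfman e₁ (C.dorfman e₂ e₃) =
      C.dorfman (C.dorfman e₁ e₂) e₃ + C.dorfman e₂ (C.dorfman e₁ e₃) := by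
  have hJ : C.bracket (C.bracket e₁ e₂) e₃ + C.bracket (C.bracket e₂ e₃) e₁ +
      C.bracket (C.bracket e₃ e₁) e₂ = C.grad ((1 / 3 : ℝ) • (C.fn (C.bracket e₁ e₂) e₃ +
        C.fn (C.bracket e₂ e₃) e₁ + C.fn (C.bracket e₃ e₁) e₂)) :=
    ContMDiffSection.ext fun x => C.jacobi_anomaly e₁ e₂ e₃ x
  have r1 := C.act_fn e₁ e₂ e₃
  have r2 := C.act_fn e₂ e₁ e₃
  simp only [dorfman_eq, map_add, LinearMap.add_apply, C.fn_grad] at r1 r2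
  rw [C.fn_symm e₂ (C.grad _), C.fn_grad, C.bracket_skew e₁ e₃] at r1
  rw [C.fn_symm e₁ (C.grad _), C.fn_grad, C.bracket_skew e₂ e₁, C.fn_symm e₂ e₁] at r2
  have l1 : C.dorfman e₁ (C.dorfman e₂ e₃) = -C.bracket (C.bracket e₂ e₃) e₁ +
      C.grad (C.fn (C.bracket e₂ e₃) e₁ + C.act e₁ (C.fn e₂ e₃)) := by
    rw [C.dorfman_eq e₂ e₃, map_add, dorfman_grad, dorfman_eq, C.bracket_skew e₁, C.fn_symm e₁,
      map_add]
    abel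
  have l2 : C.dorfman (C.dorfman e₁ e₂) e₃ = C.bracket (C.bracket e₁ e₂) e₃ +
      C.grad (C.fn (C.bracket e₁ e₂) e₃) := by
    rw [C.dorfman_eq e₁ e₂, map_add, LinearMap.add_apply, grad_dorfman, dorfman_eq, add_zero]
  have l3 : C.dorfman e₂ (C.dorfman e₁ e₃) = C.bracket (C.bracket e₃ e₁) e₂ +
      C.grad (C.act e₂ (C.fn e₁ e₃) - C.fn (C.bracket e₃ e₁) e₂) := by
    rw [C.dorfman_eq e₁ e₃, map_add, dorfman_grad, dorfman_eq, C.bracket_skew e₁ e₃,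
      C.bracket_skew e₂, C.fn_symm e₂, map_neg, map_neg, LinearMap.neg_apply, LinearMap.neg_apply,
      neg_neg, map_neg, map_sub]
    abel
  rw [l1, l2, l3]
  have hK : C.fn (C.bracket e₂ e₃) e₁ + C.act e₁ (C.fn e₂ e₃) =
      (1 / 3 : ℝ) • (C.fn (C.bracket e₁ e₂) e₃ +
        C.fn (C.bracket e₂ e₃) e₁ + C.fn (C.bracket e₃ e₁) e₂) + C.fn (C.bracket e₁ e₂) e₃ +
        (C.act e₂ (C.fn e₁ e₃) - C.fn (C.bracket e₃ e₁) e₂) := by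
    rw [C.fn_symm e₁ (C.bracket e₂ e₃)] at r2
    rw [C.fn_symm e₂ (-_)] at r1
    simp only [map_neg, LinearMap.neg_apply] at r1 r2
    refine ContMDiffMap.ext fun x => ?_
    have r1 := DFunLike.congr_fun r1 x
    have r2 := DFunLike.congr_fun r2 x
    simp only [ContMDiffMap.coe_add, ContMDiffMap.coe_sub, ContMDiffMap.coe_neg,
      ContMDiffMap.coe_smul, Pi.add_apply, Pi.sub_apply, Pi.neg_apply, Pi.smul_apply,
      smul_eq_mul] at r1 r2 ⊢
    linarith
  rw [hK, map_add, map_add, ← hJ]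
  abel

end CourantAlgebroid

end Dorfman

/-! ### Dirac subbundles as Lie algebroids -/

section Dirac

variable {d : ℕ} {P : Type*} [TopologicalSpace P] [T2Space P]
  [ChartedSpace (EuclideanSpace ℝ (Fin d)) P] [IsManifold (𝓡 d) ∞ P]
  {F : Type*} [NormedAddCommGroup F] [NormedSpace ℝ F] [FiniteDimensional ℝ F]
  {E : P → Type*} [TopologicalSpace (TotalSpace F E)]
  [∀ x, AddCommGroup (E x)] [∀ x, Module ℝ (E x)]
  [∀ x, TopologicalSpace (E x)] [FiberBundle F E] [VectorBundle ℝ F E]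
  [ContMDiffVectorBundle ∞ F E (𝓡 d)]
  {F₁ : Type*} [NormedAddCommGroup F₁] [NormedSpace ℝ F₁]
  {L₁ : P → Type*} [TopologicalSpace (TotalSpace F₁ L₁)]
  [∀ x, AddCommGroup (L₁ x)] [∀ x, Module ℝ (L₁ x)]
  [∀ x, TopologicalSpace (L₁ x)] [FiberBundle F₁ L₁] [VectorBundle ℝ F₁ L₁]
  {F₂ : Type*} [NormedAddCommGroup F₂] [NormedSpace ℝ F₂]
  {L₂ : P → Type*} [TopologicalSpace (TotalSpace F₂ L₂)]
  [∀ x, AddCommGroup (L₂ x)] [∀ x, Module ℝ (L₂ x)]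
  [∀ x, TopologicalSpace (L₂ x)] [FiberBundle F₂ L₂] [VectorBundle ℝ F₂ L₂]
  {C : CourantAlgebroid d F E} {i₁ : Subbundle d F₁ L₁ F E} {i₂ : Subbundle d F₂ L₂ F E}

/-- The inclusion of the sections of a subbundle as a linear map. -/
def Subbundle.secL (i : Subbundle d F₁ L₁ F E) : Sec d F₁ L₁ →ₗ[ℝ] Sec d F E where
  toFun := i.sec
  map_add' X Y := ContMDiffSection.ext fun x => map_add (i.incl x) (X x) (Y x)
  map_smul' r X := ContMDiffSection.ext fun x => map_smul (i.incl x) r (X x)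

theorem Subbundle.secL_apply (i : Subbundle d F₁ L₁ F E) (X : Sec d F₁ L₁) (x : P) :
    i.secL X x = i.incl x (X x) := rfl

theorem Subbundle.secL_injective (i : Subbundle d F₁ L₁ F E) : Function.Injective i.secL :=
  fun _ _ h => ContMDiffSection.ext fun x => i.injective x (DFunLike.congr_fun h x)

theorem Subbundle.secL_smulSec (i : Subbundle d F₁ L₁ F E) (f : SmoothFun d P)
    (X : Sec d F₁ L₁) : i.secL (smulSec f X) = smulSec f (i.secL X) :=
  ContMDiffSection.ext fun x => map_smul (i.incl x) (f x) (X x)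

theorem IsDirac.form_eq_zero (h : IsDirac C i₁) (x : P) (v w : L₁ x) :
    C.form x (i₁.incl x v) (i₁.incl x w) = 0 :=
  (h.maximal_isotropic x).1 _ ⟨v, rfl⟩ _ ⟨w, rfl⟩

theorem IsDirac.fn_eq_zero (h : IsDirac C i₁) (X Y : Sec d F₁ L₁) :
    C.fn (i₁.secL X) (i₁.secL Y) = 0 :=
  ContMDiffMap.ext fun x => h.form_eq_zero x _ _

/-- The restriction of the bracket to a Dirac subbundle. -/
def IsDirac.bracket (h : IsDirac C i₁) (X Y : Sec d F₁ L₁) : Sec d F₁ L₁ :=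
  Classical.choose (h.integrable X Y)

theorem IsDirac.secL_bracket (h : IsDirac C i₁) (X Y : Sec d F₁ L₁) :
    i₁.secL (h.bracket X Y) = C.bracket (i₁.secL X) (i₁.secL Y) :=
  Classical.choose_spec (h.integrable X Y)

/-- The Lie algebroid structure on a Dirac subbundle.  The anomaly of the Jacobi identity and the
extra term of the Leibniz rule vanish by isotropy. -/
def IsDirac.lieAlgebroid (h : IsDirac C i₁) : LieAlgebroid d F₁ L₁ where
  anchor :=
    { map := fun x => C.rho.map x ∘ₗ i₁.incl x
      smooth := fun X => C.rho.smooth (i₁.secL X) }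
  bracket := LinearMap.mk₂ ℝ h.bracket
    (fun X Y Z => i₁.secL_injective <| by simp only [h.secL_bracket, map_add, LinearMap.add_apply])
    (fun r X Y => i₁.secL_injective <| by
      simp only [h.secL_bracket, map_smul, LinearMap.smul_apply])
    (fun X Y Z => i₁.secL_injective <| by simp only [h.secL_bracket, map_add])
    (fun r X Y => i₁.secL_injective <| by simp only [h.secL_bracket, map_smul])
  bracket_skew X Y := i₁.secL_injective <| by
    simp only [LinearMap.mk₂_apply, h.secL_bracket, map_neg]
    exact C.bracket_skew _ _
  jacobi X Y Z := i₁.secL_injective <| by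
    simp only [LinearMap.mk₂_apply, h.secL_bracket, map_add, map_zero]
    refine ContMDiffSection.ext fun x => (C.jacobi_anomaly _ _ _ x).trans ?_
    have h0 : ∀ X Y Z : Sec d F₁ L₁, ∀ y,
        C.form y (C.bracket (i₁.secL X) (i₁.secL Y) y) (i₁.secL Z y) = 0 := by
      intro X Y Z y
      rw [← h.secL_bracket]
      exact h.form_eq_zero y _ _
    simp only [h0, add_zero, mul_zero]
    exact DFunLike.congr_fun (map_zero C.grad) x
  anchor_bracket X Y x := by
    refine Eq.trans ?_ (C.rho_bracket (i₁.secL X) (i₁.secL Y) x)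
    rw [← h.secL_bracket]
    rfl
  leibniz X Y f x := i₁.injective x <| by
    have h1 := C.leibniz (i₁.secL X) (i₁.secL Y) f x
    rw [← i₁.secL_smulSec, ← h.secL_bracket, ← h.secL_bracket] at h1
    simp only [Subbundle.secL_apply, h.form_eq_zero, zero_smul, sub_zero] at h1
    rw [map_add, map_smul, map_smul]
    exact h1

theorem IsDirac.isRestriction (h : IsDirac C i₁) : IsRestriction C i₁ h.lieAlgebroid :=
  ⟨fun _ _ => rfl, h.secL_bracket⟩

/-- On a Dirac subbundle the bracket and the Dorfman product agree. -/
theorem IsDirac.secL_lieAlgebroid_bracket (h : IsDirac C i₁) (X Y : Sec d F₁ L₁) :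
    i₁.secL (h.lieAlgebroid.bracket X Y) = C.dorfman (i₁.secL X) (i₁.secL Y) := by
  rw [C.dorfman_eq, h.fn_eq_zero, map_zero, add_zero]
  exact h.secL_bracket X Y

theorem IsDirac.act_eq (h : IsDirac C i₁) (X : Sec d F₁ L₁) (f : SmoothFun d P) :
    h.lieAlgebroid.act X f = C.act (i₁.secL X) f := rfl

/-! ### Transversal Dirac subbundles -/

/-- A pair of complementary Dirac subbundles. -/
structure DiracPair (C : CourantAlgebroid d F E) (i₁ : Subbundle d F₁ L₁ F E)
    (i₂ : Subbundle d F₂ L₂ F E) : Prop where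
  left : IsDirac C i₁
  right : IsDirac C i₂
  compl : ∀ x, IsCompl (LinearMap.range (i₁.incl x)) (LinearMap.range (i₂.incl x))

namespace DiracPair

theorem swap (T : DiracPair C i₁ i₂) : DiracPair C i₂ i₁ :=
  ⟨T.right, T.left, fun x => (T.compl x).symm⟩

theorem exists_add (T : DiracPair C i₁ i₂) (x : P) (v : E x) :
    ∃ (X : L₁ x) (ξ : L₂ x), i₁.incl x X + i₂.incl x ξ = v := by
  obtain ⟨_, ⟨X, rfl⟩, _, ⟨ξ, rfl⟩, h⟩ := Submodule.mem_sup.1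
    ((T.compl x).sup_eq_top ▸ Submodule.mem_top (x := v))
  exact ⟨X, ξ, h⟩

/-- The pairing of `L₂` with `L₁` is nondegenerate: a vector of `L₂` orthogonal to `L₁` is orthogonal
to all of `E`, as `L₂` is isotropic. -/
theorem eq_zero_of_form (T : DiracPair C i₁ i₂) (x : P) (ξ : L₂ x)
    (h : ∀ X : L₁ x, C.form x (i₂.incl x ξ) (i₁.incl x X) = 0) : ξ = 0 := by
  refine i₂.injective x ?_
  rw [map_zero]
  refine C.ext_form fun u => ?_
  obtain ⟨X, η, rfl⟩ := T.exists_add x u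
  rw [C.form_symm, map_add, h, T.right.form_eq_zero, map_zero, add_zero]

/-- The pairing `⟨ξ, X⟩ = 2 (ξ, X)`. -/
def pairing (T : DiracPair C i₁ i₂) : DualPairing d F₁ L₁ F₂ L₂ where
  pair x := (2 : ℝ) • (C.form x).compl₁₂ (i₂.incl x) (i₁.incl x)
  nondegenerate x := by
    have h2 : ∀ ξ X, ((2 : ℝ) • (C.form x).compl₁₂ (i₂.incl x) (i₁.incl x)) ξ X =
      2 * C.form x (i₂.incl x ξ) (i₁.incl x X) := fun _ _ => rfl
    refine ⟨fun ξ hξ => T.eq_zero_of_form x ξ fun X => ?_,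
      fun X hX => T.swap.eq_zero_of_form x X fun ξ => ?_⟩
    · simpa [h2] using hξ X
    · rw [C.form_symm]
      simpa [h2] using hX ξ
  smooth ξ X := contMDiff_const.mul (C.fn (i₂.secL ξ) (i₁.secL X)).contMDiff

theorem pairing_fn (T : DiracPair C i₁ i₂) (ξ : Sec d F₂ L₂) (X : Sec d F₁ L₁) :
    T.pairing.fn ξ X = (2 : ℝ) • C.fn (i₂.secL ξ) (i₁.secL X) := rfl

theorem pairing_apply (T : DiracPair C i₁ i₂) (x : P) (ξ : L₂ x) (X : L₁ x) :
    T.pairing.pair x ξ X = 2 * C.form x (i₂.incl x ξ) (i₁.incl x X) := rfl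

variable [FiniteDimensional ℝ F₁] [FiniteDimensional ℝ F₂]
  [ContMDiffVectorBundle ∞ F₁ L₁ (𝓡 d)] [ContMDiffVectorBundle ∞ F₂ L₂ (𝓡 d)]

/-- The component of a smooth section along `L₁` is smooth: by isotropy it is determined by its pairing
with `L₂`. -/
theorem exists_left (T : DiracPair C i₁ i₂) (e : Sec d F E) :
    ∃ X : Sec d F₁ L₁, ∀ x ξ, C.form x (i₂.incl x ξ) (i₁.incl x (X x)) =
      C.form x (i₂.incl x ξ) (e x) := by
  obtain ⟨X, hX⟩ := T.pairing.exists_sec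
    (fun x => (2 : ℝ) • ((C.form x).flip (e x) ∘ₗ i₂.incl x))
    (fun ξ => contMDiff_const.mul (C.fn (i₂.secL ξ) e).contMDiff)
  exact ⟨X, fun x ξ => mul_left_cancel₀ two_ne_zero (hX x ξ)⟩

theorem exists_decomposition (T : DiracPair C i₁ i₂) (e : Sec d F E) :
    ∃ (X : Sec d F₁ L₁) (ξ : Sec d F₂ L₂), i₁.secL X + i₂.secL ξ = e := by
  obtain ⟨X, hX⟩ := T.exists_left e
  obtain ⟨ξ, hξ⟩ := T.swap.exists_left e
  refine ⟨X, ξ, ContMDiffSection.ext fun x => C.ext_form fun u => ?_⟩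
  obtain ⟨Y, η, rfl⟩ := T.exists_add x u
  change C.form x (i₁.incl x Y + i₂.incl x η) (i₁.incl x (X x) + i₂.incl x (ξ x)) = _
  simp only [map_add, LinearMap.add_apply, hX, hξ, T.left.form_eq_zero, T.right.form_eq_zero]
  ring

/-- The component of a section of `E` in the first subbundle. -/
def fst (T : DiracPair C i₁ i₂) (e : Sec d F E) : Sec d F₁ L₁ :=
  Classical.choose (T.exists_decomposition e)

/-- The component of a section of `E` in the second subbundle. -/
def snd (T : DiracPair C i₁ i₂) (e : Sec d F E) : Sec d F₂ L₂ :=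
  Classical.choose (Classical.choose_spec (T.exists_decomposition e))

theorem fst_add_snd (T : DiracPair C i₁ i₂) (e : Sec d F E) :
    i₁.secL (T.fst e) + i₂.secL (T.snd e) = e :=
  Classical.choose_spec (Classical.choose_spec (T.exists_decomposition e))

theorem fn_snd (T : DiracPair C i₁ i₂) (e : Sec d F E) (Y : Sec d F₁ L₁) :
    C.fn (i₂.secL (T.snd e)) (i₁.secL Y) = C.fn e (i₁.secL Y) := by
  conv_rhs => rw [← T.fst_add_snd e, map_add, LinearMap.add_apply, T.left.fn_eq_zero, zero_add]

theorem fn_fst (T : DiracPair C i₁ i₂) (e : Sec d F E) (η : Sec d F₂ L₂) :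
    C.fn (i₁.secL (T.fst e)) (i₂.secL η) = C.fn e (i₂.secL η) := by
  conv_rhs => rw [← T.fst_add_snd e, map_add, LinearMap.add_apply, T.right.fn_eq_zero, add_zero]

theorem fn_eq (T : DiracPair C i₁ i₂) (e h : Sec d F E) :
    C.fn e h = C.fn (i₁.secL (T.fst e)) (i₂.secL (T.snd h)) +
      C.fn (i₂.secL (T.snd e)) (i₁.secL (T.fst h)) := by
  conv_lhs => rw [← T.fst_add_snd e, ← T.fst_add_snd h]
  simp only [map_add, LinearMap.add_apply, T.left.fn_eq_zero, T.right.fn_eq_zero]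
  abel

/-- The second component of `X ∘ ξ` is the Lie derivative `L_X ξ`. -/
theorem isLieDerivative (T : DiracPair C i₁ i₂) (X : Sec d F₁ L₁) (ξ : Sec d F₂ L₂) :
    IsLieDerivative T.left.lieAlgebroid T.pairing X ξ
      (T.snd (C.dorfman (i₁.secL X) (i₂.secL ξ))) := by
  have h : ∀ Y, T.pairing.fn (T.snd (C.dorfman (i₁.secL X) (i₂.secL ξ))) Y =
      T.left.lieAlgebroid.act X (T.pairing.fn ξ Y) -
        T.pairing.fn ξ (T.left.lieAlgebroid.bracket X Y) := by
    intro Y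
    rw [pairing_fn, pairing_fn, pairing_fn, T.fn_snd, T.left.act_eq,
      T.left.secL_lieAlgebroid_bracket, map_smul, C.act_fn]
    module
  exact fun Y x => DFunLike.congr_fun (h Y) x

theorem isLieDerivative_flip (T : DiracPair C i₁ i₂) (ξ : Sec d F₂ L₂) (X : Sec d F₁ L₁) :
    IsLieDerivative T.right.lieAlgebroid T.pairing.flip ξ X
      (T.fst (C.dorfman (i₂.secL ξ) (i₁.secL X))) := by
  have h : ∀ η, T.pairing.fn η (T.fst (C.dorfman (i₂.secL ξ) (i₁.secL X))) =
      T.right.lieAlgebroid.act ξ (T.pairing.fn η X) -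
        T.pairing.fn (T.right.lieAlgebroid.bracket ξ η) X := by
    intro η
    rw [pairing_fn, pairing_fn, pairing_fn, C.fn_symm, T.fn_fst, T.right.act_eq,
      T.right.secL_lieAlgebroid_bracket, map_smul, C.act_fn, C.fn_symm (i₂.secL η)]
    module
  exact fun η x => DFunLike.congr_fun (h η) x

theorem isDifferential (T : DiracPair C i₁ i₂) (f : SmoothFun d P) :
    IsDifferential T.left.lieAlgebroid T.pairing f (T.snd (C.grad f)) := by
  have h : ∀ Y, T.pairing.fn (T.snd (C.grad f)) Y = T.left.lieAlgebroid.act Y f := by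
    intro Y
    rw [pairing_fn, T.fn_snd, C.fn_grad, T.left.act_eq]
    module
  exact fun Y x => DFunLike.congr_fun (h Y) x

theorem isDifferential_flip (T : DiracPair C i₁ i₂) (f : SmoothFun d P) :
    IsDifferential T.right.lieAlgebroid T.pairing.flip f (T.fst (C.grad f)) := by
  have h : ∀ η, T.pairing.fn η (T.fst (C.grad f)) = T.right.lieAlgebroid.act η f := by
    intro η
    rw [pairing_fn, C.fn_symm, T.fn_fst, C.fn_grad, T.right.act_eq]
    module
  exact fun η x => DFunLike.congr_fun (h η) x

theorem eq_fst_grad (T : DiracPair C i₁ i₂) {f : SmoothFun d P} {U : Sec d F₁ L₁}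
    (hU : IsDifferential T.right.lieAlgebroid T.pairing.flip f U) : U = T.fst (C.grad f) :=
  ContMDiffSection.ext fun x => T.pairing.pair_ext fun w => by
    obtain ⟨D⟩ := exists_dualFrame T.pairing x
    obtain ⟨ξ, rfl⟩ := D.exists_sec_eq w
    exact (hU ξ x).trans (T.isDifferential_flip f ξ x).symm

theorem eq_snd_grad (T : DiracPair C i₁ i₂) {f : SmoothFun d P} {θ : Sec d F₂ L₂}
    (hθ : IsDifferential T.left.lieAlgebroid T.pairing f θ) : θ = T.snd (C.grad f) :=
  ContMDiffSection.ext fun x => T.pairing.flip.pair_ext fun w => by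
    obtain ⟨D⟩ := exists_dualFrame T.pairing.flip x
    obtain ⟨X, rfl⟩ := D.exists_sec_eq w
    exact (hθ X x).trans (T.isDifferential f X x).symm

/-- `(d_* X)(ξ, η) = -2 (X ∘ ξ, η)`. -/
theorem dform_eq (T : DiracPair C i₁ i₂) (X : Sec d F₁ L₁) (ξ η : Sec d F₂ L₂) :
    dform T.pairing T.right.lieAlgebroid X ξ η =
      (-2 : ℝ) • C.fn (C.dorfman (i₁.secL X) (i₂.secL ξ)) (i₂.secL η) := by
  have h := C.dorfman_add_dorfman (i₁.secL X) (i₂.secL ξ)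
  rw [← eq_sub_iff_add_eq] at h
  rw [h, dform, T.right.act_eq, T.right.act_eq, pairing_fn, pairing_fn, pairing_fn,
    T.right.secL_lieAlgebroid_bracket, map_smul, map_smul, C.fn_symm (i₂.secL η), C.act_fn,
    C.fn_symm (i₂.secL ξ) (i₁.secL X), map_sub, LinearMap.sub_apply, map_smul,
    LinearMap.smul_apply, C.fn_grad, C.fn_symm (C.dorfman (i₂.secL ξ) (i₂.secL η))]
  module

/-- The derivatives `a(d_* f) g` and `a(d_* g) f` are opposite: this is `ρ(𝒟 f) g = 0`, split into
components. -/
theorem act_add_act (T : DiracPair C i₁ i₂) (f g : SmoothFun d P) :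
    C.act (i₁.secL (T.fst (C.grad f))) g + C.act (i₁.secL (T.fst (C.grad g))) f = 0 := by
  have h0 := C.act_grad f g
  have h1 : C.act (i₂.secL (T.snd (C.grad f))) g =
      (2 : ℝ) • C.fn (C.grad g) (i₂.secL (T.snd (C.grad f))) := by
    rw [C.fn_grad]; module
  have h2 : C.act (i₁.secL (T.fst (C.grad g))) f =
      (2 : ℝ) • C.fn (C.grad f) (i₁.secL (T.fst (C.grad g))) := by
    rw [C.fn_grad]; module
  rw [← T.fst_add_snd (C.grad f), map_add, LinearMap.add_apply, h1, ← T.fn_fst,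
    ← eq_neg_iff_add_eq_zero] at h0
  rw [h0, h2, ← T.fn_snd, C.fn_symm (i₂.secL _)]
  abel

/-- The compatibility of `d_*` with the bracket `[X, f]`, contracted with `ξ`.  It comes from
`X ∘ 𝒟 f = 𝒟 (ρ(X) f)` and the invariance of the form. -/
theorem act_act (T : DiracPair C i₁ i₂) (X : Sec d F₁ L₁) (f : SmoothFun d P)
    (ξ : Sec d F₂ L₂) :
    C.act (i₂.secL ξ) (C.act (i₁.secL X) f) =
      (-2 : ℝ) • C.fn (C.dorfman (i₁.secL X) (i₂.secL ξ)) (i₂.secL (T.snd (C.grad f))) +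
      (2 : ℝ) • C.fn (i₂.secL ξ) (C.dorfman (i₁.secL X) (i₁.secL (T.fst (C.grad f)))) := by
  have h1 : C.act (i₂.secL ξ) (C.act (i₁.secL X) f) =
      (2 : ℝ) • C.fn (i₂.secL ξ) (C.dorfman (i₁.secL X) (C.grad f)) := by
    rw [C.dorfman_grad, C.fn_symm, C.fn_grad]; module
  have h2 := C.act_fn (i₁.secL X) (i₂.secL ξ) (i₂.secL (T.snd (C.grad f)))
  rw [T.right.fn_eq_zero, map_zero, eq_comm, ← eq_neg_iff_add_eq_zero] at h2
  rw [h1, h2]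
  conv_lhs => rw [← T.fst_add_snd (C.grad f)]
  simp only [map_add]
  module

/-- The compatibility of `d_*` with the bracket `[X, Y]`, evaluated on `ξ, η`.  Since
`X ∘ Y = [X, Y]`, the left-hand side is `-2 ((X ∘ Y) ∘ ξ, η)`, to which the Jacobi identity applies;
isotropy separates the remaining pairings into those of the components in `L₁` and `L₂`. -/
theorem dform_bracket (T : DiracPair C i₁ i₂) (X Y : Sec d F₁ L₁) (ξ η : Sec d F₂ L₂) :
    dform T.pairing T.right.lieAlgebroid (T.left.lieAlgebroid.bracket X Y) ξ η =
      (T.left.lieAlgebroid.act X (dform T.pairing T.right.lieAlgebroid Y ξ η)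
        - dform T.pairing T.right.lieAlgebroid Y
            (T.snd (C.dorfman (i₁.secL X) (i₂.secL ξ))) η
        - dform T.pairing T.right.lieAlgebroid Y ξ
            (T.snd (C.dorfman (i₁.secL X) (i₂.secL η)))) -
      (T.left.lieAlgebroid.act Y (dform T.pairing T.right.lieAlgebroid X ξ η)
        - dform T.pairing T.right.lieAlgebroid X
            (T.snd (C.dorfman (i₁.secL Y) (i₂.secL ξ))) η
        - dform T.pairing T.right.lieAlgebroid X ξ
            (T.snd (C.dorfman (i₁.secL Y) (i₂.secL η)))) := by
  have h1 : ∀ (Z : Sec d F₁ L₁) (ζ : Sec d F₂ L₂),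
      C.fn (C.dorfman (i₁.secL Z) (i₂.secL ζ)) (i₂.secL η) =
        -C.fn (i₂.secL ζ) (i₁.secL (T.fst (C.dorfman (i₁.secL Z) (i₂.secL η)))) := by
    intro Z ζ
    have h := C.act_fn (i₁.secL Z) (i₂.secL ζ) (i₂.secL η)
    rw [T.right.fn_eq_zero, map_zero, eq_comm, ← eq_neg_iff_add_eq_zero] at h
    rw [h, C.fn_symm (i₂.secL ζ) (i₁.secL _), T.fn_fst, C.fn_symm]
  have h2 : ∀ Z W : Sec d F₁ L₁, C.fn (C.dorfman (i₁.secL Z)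
      (C.dorfman (i₁.secL W) (i₂.secL ξ))) (i₂.secL η) =
      C.act (i₁.secL Z) (C.fn (C.dorfman (i₁.secL W) (i₂.secL ξ)) (i₂.secL η)) -
        C.fn (C.dorfman (i₁.secL W) (i₂.secL ξ)) (C.dorfman (i₁.secL Z) (i₂.secL η)) := by
    intro Z W
    rw [C.act_fn, add_sub_cancel_right]
  have hJ := C.dorfman_dorfman (i₁.secL X) (i₁.secL Y) (i₂.secL ξ)
  rw [← sub_eq_iff_eq_add] at hJ
  simp only [dform_eq, T.left.act_eq, map_smul]
  rw [T.left.secL_lieAlgebroid_bracket, ← hJ, map_sub, LinearMap.sub_apply, h2, h2,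
    h1 Y (T.snd _), h1 X (T.snd _),
    ← T.fn_fst (C.dorfman (i₁.secL Y) (i₂.secL ξ)) (T.snd _),
    ← T.fn_fst (C.dorfman (i₁.secL X) (i₂.secL ξ)) (T.snd _),
    T.fn_eq (C.dorfman (i₁.secL Y) (i₂.secL ξ)) (C.dorfman (i₁.secL X) (i₂.secL η)),
    T.fn_eq (C.dorfman (i₁.secL X) (i₂.secL ξ)) (C.dorfman (i₁.secL Y) (i₂.secL η))]
  module

theorem isLieBialgebroid (T : DiracPair C i₁ i₂) :
    IsLieBialgebroid T.left.lieAlgebroid T.right.lieAlgebroid T.pairing := by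
  refine isLieBialgebroid_of_generators
    (fun X ξ => T.snd (C.dorfman (i₁.secL X) (i₂.secL ξ))) T.isLieDerivative
    (fun f g U V hU hV x => ?_) (fun X f U θ hU hθ ξ x => ?_) (fun X Y ξ η x => ?_)
  · rw [T.eq_fst_grad hU, T.eq_fst_grad hV]
    exact DFunLike.congr_fun (T.act_add_act f g) x
  · rw [T.eq_fst_grad hU, T.eq_snd_grad hθ, dform_eq, T.left.act_eq, T.right.act_eq,
      ← T.pairing.fn_apply, pairing_fn, T.left.secL_lieAlgebroid_bracket]
    exact DFunLike.congr_fun (T.act_act X f ξ) x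
  · exact DFunLike.congr_fun (T.dform_bracket X Y ξ η) x

/-- The bracket of `X ∈ Γ(L₁)` and `ξ ∈ Γ(L₂)` is
`(½ d_*⟨ξ, X⟩ - L_ξ X) + (L_X ξ - ½ d⟨ξ, X⟩)`. -/
theorem bracket_left_right (T : DiracPair C i₁ i₂) (X : Sec d F₁ L₁) (ξ : Sec d F₂ L₂) :
    C.bracket (i₁.secL X) (i₂.secL ξ) =
      i₁.secL (T.fst (C.grad (C.fn (i₁.secL X) (i₂.secL ξ))) -
        T.fst (C.dorfman (i₂.secL ξ) (i₁.secL X))) +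
      i₂.secL (T.snd (C.dorfman (i₁.secL X) (i₂.secL ξ)) -
        T.snd (C.grad (C.fn (i₁.secL X) (i₂.secL ξ)))) := by
  refine C.sec_ext fun u => ?_
  rw [← T.fst_add_snd u]
  simp only [map_add, map_sub, LinearMap.add_apply, LinearMap.sub_apply, T.left.fn_eq_zero,
    T.right.fn_eq_zero, T.fn_fst, T.fn_snd]
  have h := C.dorfman_add_dorfman (i₁.secL X) (i₂.secL ξ)
  rw [← eq_sub_iff_add_eq'] at h
  rw [h, C.bracket_eq]
  simp only [map_sub, map_smul, LinearMap.sub_apply, LinearMap.smul_apply]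
  module

theorem isDouble (T : DiracPair C i₁ i₂) :
    IsDouble C i₁ i₂ T.left.lieAlgebroid T.right.lieAlgebroid T.pairing where
  bijective x := by
    refine ⟨fun v w h => ?_, fun v => ?_⟩
    · have h1 : i₁.incl x (v.1 - w.1) = i₂.incl x (w.2 - v.2) := by
        simp only at h
        rw [map_sub, map_sub, sub_eq_sub_iff_add_eq_add, h, add_comm]
      have h2 : i₁.incl x (v.1 - w.1) = 0 :=
        Submodule.disjoint_def.1 (T.compl x).disjoint _ ⟨_, rfl⟩ ⟨_, h1.symm⟩
      have h3 := h1 ▸ h2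
      rw [← map_zero (i₁.incl x)] at h2
      rw [← map_zero (i₂.incl x)] at h3
      exact Prod.ext (sub_eq_zero.1 (i₁.injective x h2)) (sub_eq_zero.1 (i₂.injective x h3)).symm
    · obtain ⟨X, ξ, h⟩ := T.exists_add x v
      exact ⟨(X, ξ), h⟩
  form_eq x X₁ X₂ ξ₁ ξ₂ := by
    rw [pairing_apply, pairing_apply, C.form_symm x (i₂.incl x ξ₂)]
    simp only [map_add, LinearMap.add_apply, T.left.form_eq_zero, T.right.form_eq_zero]
    ring
  rho_eq x X ξ := map_add _ _ _
  bracket_eq X₁ X₂ ξ₁ ξ₂ := by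
    let h := C.fn (i₁.secL X₂) (i₂.secL ξ₁) - C.fn (i₁.secL X₁) (i₂.secL ξ₂)
    have hh : (fun y => (1 / 2 : ℝ) * (T.pairing.pair y (ξ₁ y) (X₂ y) -
        T.pairing.pair y (ξ₂ y) (X₁ y))) = h := by
      funext y
      rw [pairing_apply, pairing_apply, C.form_symm, C.form_symm y (i₂.incl y (ξ₂ y))]
      change _ = C.form y (i₁.incl y (X₂ y)) (i₂.incl y (ξ₁ y)) -
        C.form y (i₁.incl y (X₁ y)) (i₂.incl y (ξ₂ y))
      ring
    refine ⟨_, _, ⟨_, _, _, _, _, _, T.isLieDerivative_flip ξ₁ X₂, T.isLieDerivative_flip ξ₂ X₁,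
      hh ▸ T.isDifferential_flip h, T.isLieDerivative X₁ ξ₂, T.isLieDerivative X₂ ξ₁,
      hh ▸ T.isDifferential h, rfl, rfl⟩, ?_⟩
    change C.bracket (i₁.secL X₁ + i₂.secL ξ₁) (i₁.secL X₂ + i₂.secL ξ₂) =
      i₁.secL _ + i₂.secL _
    have hg : C.grad h = C.grad (C.fn (i₁.secL X₂) (i₂.secL ξ₁)) -
        C.grad (C.fn (i₁.secL X₁) (i₂.secL ξ₂)) := map_sub _ _ _
    have b₁ : C.bracket (i₁.secL X₁) (i₁.secL X₂) =
        i₁.secL (T.left.lieAlgebroid.bracket X₁ X₂) := (T.left.secL_bracket X₁ X₂).symm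
    have b₂ : C.bracket (i₂.secL ξ₁) (i₂.secL ξ₂) =
        i₂.secL (T.right.lieAlgebroid.bracket ξ₁ ξ₂) := (T.right.secL_bracket ξ₁ ξ₂).symm
    simp only [map_add, LinearMap.add_apply]
    rw [b₁, b₂, C.bracket_skew (i₂.secL ξ₁), T.bracket_left_right X₁ ξ₂,
      T.bracket_left_right X₂ ξ₁]
    refine C.sec_ext fun u => ?_
    rw [← T.fst_add_snd u]
    simp only [map_add, map_sub, map_neg, LinearMap.add_apply, LinearMap.sub_apply,
      LinearMap.neg_apply, T.left.fn_eq_zero, T.right.fn_eq_zero, T.fn_fst, T.fn_snd, hg]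
    abel

end DiracPair

end Dirac

end CourantBialgebroid

end

theorem theorem2p6 {d : ℕ} {P : Type*} [TopologicalSpace P] [T2Space P]
    [SecondCountableTopology P] [ChartedSpace (EuclideanSpace ℝ (Fin d)) P]
    [IsManifold (𝓡 d) ∞ P]
    {F : Type*} [NormedAddCommGroup F] [NormedSpace ℝ F] [FiniteDimensional ℝ F]
    {E : P → Type*} [TopologicalSpace (TotalSpace F E)]
    [∀ x, AddCommGroup (E x)] [∀ x, Module ℝ (E x)] [∀ x, TopologicalSpace (E x)]
    [FiberBundle F E] [VectorBundle ℝ F E] [ContMDiffVectorBundle ∞ F E (𝓡 d)]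
    {F₁ : Type*} [NormedAddCommGroup F₁] [NormedSpace ℝ F₁] [FiniteDimensional ℝ F₁]
    {L₁ : P → Type*} [TopologicalSpace (TotalSpace F₁ L₁)]
    [∀ x, AddCommGroup (L₁ x)] [∀ x, Module ℝ (L₁ x)] [∀ x, TopologicalSpace (L₁ x)]
    [FiberBundle F₁ L₁] [VectorBundle ℝ F₁ L₁] [ContMDiffVectorBundle ∞ F₁ L₁ (𝓡 d)]
    {F₂ : Type*} [NormedAddCommGroup F₂] [NormedSpace ℝ F₂] [FiniteDimensional ℝ F₂]
    {L₂ : P → Type*} [TopologicalSpace (TotalSpace F₂ L₂)]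
    [∀ x, AddCommGroup (L₂ x)] [∀ x, Module ℝ (L₂ x)] [∀ x, TopologicalSpace (L₂ x)]
    [FiberBundle F₂ L₂] [VectorBundle ℝ F₂ L₂] [ContMDiffVectorBundle ∞ F₂ L₂ (𝓡 d)]
    (C : CourantBialgebroid.CourantAlgebroid d F E)
    (i₁ : CourantBialgebroid.Subbundle d F₁ L₁ F E)
    (i₂ : CourantBialgebroid.Subbundle d F₂ L₂ F E)
    (h₁ : CourantBialgebroid.IsDirac C i₁) (h₂ : CourantBialgebroid.IsDirac C i₂)
    (htransversal : ∀ x, IsCompl (LinearMap.range (i₁.incl x)) (LinearMap.range (i₂.incl x))) :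
    ∃ (A₁ : CourantBialgebroid.LieAlgebroid d F₁ L₁)
      (A₂ : CourantBialgebroid.LieAlgebroid d F₂ L₂)
      (p : CourantBialgebroid.DualPairing d F₁ L₁ F₂ L₂),
      CourantBialgebroid.IsRestriction C i₁ A₁ ∧
      CourantBialgebroid.IsRestriction C i₂ A₂ ∧
      (∀ (x : P) (ξ : L₂ x) (X : L₁ x),
        p.pair x ξ X = 2 * C.form x (i₂.incl x ξ) (i₁.incl x X)) ∧
      CourantBialgebroid.IsLieBialgebroid A₁ A₂ p ∧
      CourantBialgebroid.IsDouble C i₁ i₂ A₁ A₂ p := by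
  have T : CourantBialgebroid.DiracPair C i₁ i₂ := ⟨h₁, h₂, htransversal⟩
  exact ⟨h₁.lieAlgebroid, h₂.lieAlgebroid, T.pairing, h₁.isRestriction, h₂.isRestriction,
    T.pairing_apply, T.isLieBialgebroid, T.isDouble⟩
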